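/- **Setting.** Let $\alpha\in(1,2)$, $\beta\in\{-1,0,1\}$, $\sigma>3$. Let $w\in L^1_{loc}(\mathbb R^3)$ be a real potential with weak gradient $\nabla w\in L^1_{loc}(\mathbb R^3)$ such that $|w(x)|\le K|x|^{-\alpha}$ and $|\nabla w(x)|\le K|x|^{-(\alpha+1)}$ for some $K>0$ and almost all sufficiently large $|x|$. For $1\le c\le\infty$ let $v_c(p)=p/\sqrt{1+|p|^2/c^2}$ (so $v_\infty(p)=p$; we read $1/c=0$ for $c=\infty$), and write $\langle y\rangle=\sqrt{1+|y|^2}$. For $f^0\ge 0$ consider on $[0,\infty)\times\mathbb R^3\times\mathbb R^3$ the Vlasov equation $$\partial_t f_c+v_c(p)\cdot\nabla_x f_c+E_c\cdot\nabla_p f_c=0,\qquad f_c(0)=f^0,\qquad E_c(t,x)=\beta\iint \nabla w(x-y)f_c(t,y,p)\,dy\,dp .$$ A solution is a nonnegative $C^1$ function $f_c$, integrable over $\mathbb R^6$ at each time, that satisfies the equation pointwise, whose field $E_c$ is given by a convergent integral, is continuous in $(t,x)$ and differentiable in $x$, with $E_c$ and $\nabla_xE_c$ bounded on bounded time intervals.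 Let $\Phi_c(t)(x,p)=(\mathcal X_c(t),\mathcal P_c(t))$ be the characteristic flow, i.e. the solution of $\dot{\mathcal X}_c=v_c(\mathcal P_c)$, $\dot{\mathcal P}_c=E_c(t,\mathcal X_c)$ with value $(x,p)$ at $t=0$; let $\mathcal W_c(t)(x,p)=(\mathcal X_c(t)-t\,v_c(\mathcal P_c(t)),\mathcal P_c(t))$ be the finite-time wave operator, and let $\mathcal W_c^+=\lim_{t\to\infty}\mathcal W_c(t)$ (pointwise) be the limiting wave operator. The scattering state $f_c^+\ge 0$ is the limit of $f_c(t,x+tv_c(p),p)$ as $t\to\infty$, pointwise and in $L^1(\mathbb R^6)$. **Theorem 3 (Non-relativistic limit).** There are $\varepsilon>0$ and $C>0$, depending only on $w,\alpha,\beta,\sigma$, such that the following holds for every $0<\eta_0\le\varepsilon$ and every nonnegative $f^0\in C^1(\mathbb R^6)$ with $$\big\|\langle x\rangle^{\sigma}\langle p\rangle^8f^0\big\|_{L^\infty}+\big\|\langle x\rangle^{\sigma}\langle p\rangle^9\nabla_{(x,p)}f^0\big\|_{L^\infty}\le\eta_0 .$$ For every $1\le c\le\infty$ there is a unique global solution $f_c$,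 and its characteristic flow, its limiting wave operator $\mathcal W_c^+\in C(\mathbb R^6)$ and its scattering state $0\le f_c^+\in L^1(\mathbb R^6)$ exist. Moreover $\|\langle p\rangle^3\nabla_{(x,p)}f^0\|_{L^1}<\infty$, and $f_c^+\to f_\infty^+$ in $L^1(\mathbb R^6)$ as $c\to\infty$; more precisely, for all $1\le c\le\infty$, $$\|f_c^+-f_\infty^+\|_{L^1(\mathbb R^6)}\le\frac{C}{c^2}\,\big\|\langle p\rangle^3\nabla_{(x,p)}f^0\big\|_{L^1(\mathbb R^6)} ,$$ $$\sup_{(x,p)}\langle p\rangle^{-3}\big|\mathcal W_c^+-\mathcal W_\infty^+\big|\le\frac{C\eta_0}{c^2},\qquad \sup_{t\ge0}\sup_{(x,p)}\langle p\rangle^{-3}\big|\mathcal W_c(t)-\mathcal W_\infty(t)\big|\le\frac{C\eta_0}{c^2}.$$ Similarly the force fields and the characteristic flows converge at the same order: for all $t\ge0$ and $1\le c\le\infty$, $$\|(E_c-E_\infty)(t)\|_{L^\infty(\mathbb R^3)}\le\frac{C\eta_0}{c^2\langle t\rangle^{\alpha+1}},\qquad \sup_{(x,p)}\langle p\rangle^{-3}|\mathcal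 X_c(t)-\mathcal X_\infty(t)|\le\frac{C(1+t)}{c^2},\qquad \sup_{(x,p)}\langle p\rangle^{-3}|\mathcal P_c(t)-\mathcal P_\infty(t)|\le\frac{C\eta_0}{c^2}.$$ -/

import Mathlib

open MeasureTheory Filter Topology Set
open scoped ENNReal ContDiff

noncomputable section

namespace Vlasov

/-- The space `ℝ³` with its Euclidean norm (used for positions and for momenta). -/
abbrev R3 : Type := EuclideanSpace ℝ (Fin 3)

/-- The phase space of pairs `(x, p)`. Its norm is the maximum of the two Euclidean norms, which is
equivalent to the Euclidean norm of `ℝ⁶`; its measure is the Lebesgue measure of `ℝ⁶`. -/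
abbrev Phase : Type := R3 × R3

/-- The Japanese bracket `⟨y⟩ = √(1 + |y|²)`. -/
def bracket {V : Type*} [Norm V] (y : V) : ℝ := Real.sqrt (1 + ‖y‖ ^ 2)

/-- The number `1 / c` for a speed of light `c ∈ [1, ∞]`; it is `0` for `c = ∞`. -/
def invSpeed (c : ℝ≥0∞) : ℝ := (c⁻¹).toReal

/-- `γ_c(p) = √(1 + |p|² / c²)`, so that `γ_∞ = 1`. -/
def gammaFactor (c : ℝ≥0∞) (p : R3) : ℝ := Real.sqrt (1 + invSpeed c ^ 2 * ‖p‖ ^ 2)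

/-- The velocity `v_c(p) = p / γ_c(p)`, so that `v_∞(p) = p`. -/
def velocity (c : ℝ≥0∞) (p : R3) : R3 := (gammaFactor c p)⁻¹ • p

/-- `gradw` is the weak (distributional) gradient of the locally integrable function `w`. -/
structure IsWeakGradient (w : R3 → ℝ) (gradw : R3 → R3) : Prop where
  locallyIntegrable : LocallyIntegrable w
  locallyIntegrable_grad : LocallyIntegrable gradw
  integral_eq : ∀ φ : R3 → ℝ, ContDiff ℝ ∞ φ → HasCompactSupport φ →
    ∫ x, w x • gradient φ x = -∫ x, φ x • gradw x

/-- A short-range potential `w` with gradient `gradw`: for large `|x|`,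
`|w(x)| ≤ K |x|^{-α}` and `|∇w(x)| ≤ K |x|^{-(α+1)}`. -/
structure IsShortRange (α : ℝ) (w : R3 → ℝ) (gradw : R3 → R3) : Prop where
  isWeakGradient : IsWeakGradient w gradw
  decay : ∃ K : ℝ, 0 < K ∧ ∃ R : ℝ, 0 < R ∧ ∀ᵐ x : R3, R ≤ ‖x‖ →
    |w x| ≤ K * ‖x‖ ^ (-α) ∧ ‖gradw x‖ ≤ K * ‖x‖ ^ (-(α + 1))

/-- The force field `β ∬ ∇w(x - y) h(y, p) dy dp` generated by a distribution `h` on phase space. -/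
def force (gradw : R3 → R3) (β : ℝ) (h : Phase → ℝ) (x : R3) : R3 :=
  β • ∫ z : Phase, h z • gradw (x - z.1)

/-- The size of the initial datum,
`‖⟨x⟩^σ ⟨p⟩^8 f⁰‖_{L^∞} + ‖⟨x⟩^σ ⟨p⟩^9 ∇_{(x,p)} f⁰‖_{L^∞}`. -/
def dataSize (σ : ℝ) (f0 : Phase → ℝ) : ℝ≥0∞ :=
  eLpNorm (fun z : Phase => bracket z.1 ^ σ * bracket z.2 ^ 8 * f0 z) ∞ volume +
  eLpNorm (fun z : Phase => bracket z.1 ^ σ * bracket z.2 ^ 9 * ‖fderiv ℝ f0 z‖) ∞ volume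

/-- `f` is a global classical solution on `[0, ∞) × ℝ⁶` of
`∂_t f + v_c(p) · ∇_x f + E · ∇_p f = 0`, `f(0) = f⁰`, with the self-consistent force field
`E(t) = force gradw β (f t)`: the defining integral of `E` converges, `E` is continuous in `(t, x)`
and differentiable in `x`, and `E` and `∇_x E` are bounded on bounded time intervals, so that
the characteristics are well defined. Values at negative times play no role. -/
structure IsSolution (gradw : R3 → R3) (β : ℝ) (c : ℝ≥0∞) (f0 : Phase → ℝ)
    (f : ℝ → Phase → ℝ) : Prop where
  initial : f 0 = f0
  nonneg : ∀ t, 0 ≤ t → ∀ z, 0 ≤ f t z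
  contDiff : ContDiffOn ℝ 1 (fun q : ℝ × Phase => f q.1 q.2) (Ici 0 ×ˢ univ)
  integrable : ∀ t, 0 ≤ t → Integrable (f t)
  integrable_force : ∀ t, 0 ≤ t → ∀ x : R3,
    Integrable (fun z : Phase => f t z • gradw (x - z.1))
  continuous_force :
    ContinuousOn (fun q : ℝ × R3 => force gradw β (f q.1) q.2) (Ici 0 ×ˢ univ)
  differentiable_force : ∀ t, 0 ≤ t → Differentiable ℝ (force gradw β (f t))
  bounded_force : ∀ T : ℝ, ∃ M : ℝ, ∀ t, 0 ≤ t → t ≤ T → ∀ x : R3,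
    ‖force gradw β (f t) x‖ ≤ M ∧ ‖fderiv ℝ (force gradw β (f t)) x‖ ≤ M
  equation : ∀ t, 0 ≤ t → ∀ x p : R3,
    HasDerivWithinAt (fun s => f s (x, p))
      (-(fderiv ℝ (f t) (x, p) (velocity c p, force gradw β (f t) x))) (Ici 0) t

/-- `Φ t (x, p) = (𝒳_c(t,0,x,p), 𝒫_c(t,0,x,p))` is the forward characteristic flow: for `t ≥ 0`
it solves `𝒳' = v_c(𝒫)`, `𝒫' = E(t, 𝒳)` with value `(x, p)` at `t = 0`. -/
structure IsCharFlow (c : ℝ≥0∞) (E : ℝ → R3 → R3) (Φ : ℝ → Phase → Phase) : Prop where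
  initial : ∀ z, Φ 0 z = z
  equation : ∀ t, 0 ≤ t → ∀ z,
    HasDerivWithinAt (fun s => Φ s z) (velocity c (Φ t z).2, E t (Φ t z).1) (Ici 0) t

/-- The free flow `(x, p) ↦ (x + t v_c(p), p)`; its inverse is the free flow at time `-t`. -/
def freeFlow (c : ℝ≥0∞) (t : ℝ) (z : Phase) : Phase := (z.1 + t • velocity c z.2, z.2)

/-- The finite-time wave operator `𝒲_c(t) = Φ_c^free(t)⁻¹ ∘ Φ_c(t)`. -/
def waveOp (c : ℝ≥0∞) (Φ : ℝ → Phase → Phase) (t : ℝ) (z : Phase) : Phase :=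
  freeFlow c (-t) (Φ t z)

/-- `f` is a global solution with initial datum `f0`, `Φ` is its characteristic flow, `Wp` is its
limiting wave operator `𝒲_c^+ = (𝒳_c^+, 𝒫_c^+) = lim_{t → ∞} 𝒲_c(t)`, and `fp` is its scattering
state, the limit of `f(t, x + t v_c(p), p)` as `t → ∞`, pointwise and in `L¹`. -/
structure IsScattering (gradw : R3 → R3) (β : ℝ) (c : ℝ≥0∞) (f0 : Phase → ℝ)
    (f : ℝ → Phase → ℝ) (Φ : ℝ → Phase → Phase) (Wp : Phase → Phase) (fp : Phase → ℝ) :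
    Prop where
  solution : IsSolution gradw β c f0 f
  flow : IsCharFlow c (fun t => force gradw β (f t)) Φ
  continuous_wave : Continuous Wp
  tendsto_wave : ∀ z, Tendsto (fun t => waveOp c Φ t z) atTop (𝓝 (Wp z))
  nonneg_state : ∀ z, 0 ≤ fp z
  integrable_state : Integrable fp
  tendsto_state : ∀ z, Tendsto (fun t => f t (freeFlow c t z)) atTop (𝓝 (fp z))
  tendsto_state_L1 :
    Tendsto (fun t => ∫ z, |f t (freeFlow c t z) - fp z|) atTop (𝓝 0)

end Vlasov

end

open Vlasov

noncomputable section

namespace Vlasov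

/-! ### The Japanese bracket -/

section Bracket

variable {V : Type*} [SeminormedAddCommGroup V]

/-! Put θ = 1/c and follow characteristics in the free-streaming coordinates (x - t v_c(p), p),
where they solve an equation with vector field `waveField` = (-t Dv_c(p) E, E). If E decays like
(1+|t|)^{-(α+1)} and its spatial Lipschitz constant like (1+|t|)^{-(α+2)} (`IsField`), the factor t
costs one power, and the vector field and its Lipschitz constant are O((1+|t|)^{-α}). Since α > 1,
this is integrable in time: the flow stays within a bounded distance of the identity, is Lipschitz
uniformly in time, and converges as t → ∞. This convergence contains the scattering theory: W^+ is
the limit of the flow from time 0 to t, and f^+ is f⁰ composed with the limit of the flow from time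
t to 0.

Conversely, a datum carried by such a flow keeps its weighted bounds (`exists_pull_bounds`), so its
spatial density disperses like t^{-3}. Splitting ∇w at a radius of order 1+|t| gives
(1+|t|)^{(2-α)-3} from the inside and (1+|t|)^{-(α+1)} from the outside, so the decay of the field
is reproduced. The extra power for increments comes from trading a shift h in space for a shift h/t
in velocity. This requires regularity of the density in the variable u = v_c(p), uniformly in c,
although the Jacobian blows up at the boundary of the ball of admissible velocities; the powers 8
and 9 of ⟨p⟩ pay for it (`exists_abs_velDensity_sub_le`). For small data the map `newField`
therefore preserves a class of fields and contracts it, and its fixed point is the field of a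
solution (`exists_selfConsistent`, `exists_isScattering`). Uniqueness (`IsSolution.eq_distr`): a
solution is the transport of its datum by its own field, and two self-consistent fields agree on [0,
T] by a contraction in an exponentially weighted norm, without smallness.

For the limit, |v_c(p) - p| ≤ θ²|p|³. Flows whose fields have size M and differ by D(1+|t|)^{-(α+1)}
are O((D + Mθ²)⟨p⟩³) apart, and flows that are D'⟨p⟩³ apart generate fields differing by O(η(D' +
θ²)) times the decay rate. Smallness of η closes this loop with D = O(ηθ²)
(`exists_norm_selfConsistent_sub_le`), which yields the pointwise estimates. For the L¹ estimate,
f_c^+ - f_∞^+ = f⁰∘V - f⁰∘V' is the integral of ∇f⁰ along the segments from V' to V; the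
interpolating maps are small Lipschitz perturbations of the identity, so changing variables costs a
constant (`integral_comp_sub_comp_le`). -/

lemma one_le_bracket (y : V) : 1 ≤ bracket y := by
  unfold bracket
  exact Real.one_le_sqrt.2 (by nlinarith [sq_nonneg ‖y‖])

lemma bracket_pos (y : V) : 0 < bracket y := one_pos.trans_le (one_le_bracket y)

lemma bracket_sq (y : V) : bracket y ^ 2 = 1 + ‖y‖ ^ 2 := by
  unfold bracket
  exact Real.sq_sqrt (by positivity)

lemma norm_le_bracket (y : V) : ‖y‖ ≤ bracket y := by
  unfold bracket
  exact Real.le_sqrt_of_sq_le (by linarith)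

lemma bracket_le_one_add_norm (y : V) : bracket y ≤ 1 + ‖y‖ := by
  unfold bracket
  exact Real.sqrt_le_iff.2 ⟨by positivity, by nlinarith [norm_nonneg y]⟩

lemma bracket_le_add (x y : V) : bracket x ≤ bracket y + ‖x - y‖ := by
  have h1 : ‖x‖ ≤ ‖y‖ + ‖x - y‖ := by
    have := norm_add_le y (x - y)
    simpa using this
  have hb := bracket_pos y
  refine Real.sqrt_le_iff.2 ⟨by positivity, ?_⟩
  have h2 := bracket_sq y
  have h3 := norm_le_bracket y
  nlinarith [norm_nonneg x, norm_nonneg y, norm_nonneg (x - y)]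

lemma bracket_le_mul {A : ℝ} {x y : V} (h : ‖x - y‖ ≤ A) : bracket x ≤ (1 + A) * bracket y := by
  have h1 := bracket_le_add x y
  have hA : 0 ≤ A := (norm_nonneg _).trans h
  nlinarith [one_le_bracket y]

lemma continuous_bracket : Continuous (bracket : V → ℝ) := by
  unfold bracket
  fun_prop

end Bracket

/-- The weight `⟨y⟩^{-σ} ⟨p⟩^{-k}` on phase space. -/
def weight (σ : ℝ) (k : ℕ) (z : Phase) : ℝ := bracket z.1 ^ (-σ) * (bracket z.2 ^ k)⁻¹

lemma weight_pos (σ : ℝ) (k : ℕ) (z : Phase) : 0 < weight σ k z := by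
  have h1 := bracket_pos z.1
  have h2 := bracket_pos z.2
  unfold weight
  positivity

lemma weight_nonneg (σ : ℝ) (k : ℕ) (z : Phase) : 0 ≤ weight σ k z := (weight_pos σ k z).le

lemma continuous_weight (σ : ℝ) (k : ℕ) : Continuous (weight σ k) := by
  unfold weight
  refine Continuous.mul ?_ ?_
  · exact (continuous_bracket.comp continuous_fst).rpow_const fun z => Or.inl (bracket_pos _).ne'
  · exact ((continuous_bracket.comp continuous_snd).pow k).inv₀
      fun z => (pow_pos (bracket_pos _) k).ne'

lemma weight_anti {σ : ℝ} {j k : ℕ} (h : j ≤ k) (z : Phase) : weight σ k z ≤ weight σ j z := by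
  have h1 := bracket_pos z.1
  have h2 := bracket_pos z.2
  unfold weight
  gcongr
  exact one_le_bracket _

lemma bracket_pow_mul_weight (σ : ℝ) (j k : ℕ) (z : Phase) :
    bracket z.2 ^ j * weight σ (j + k) z = weight σ k z := by
  have h2 := bracket_pos z.2
  unfold weight
  rw [pow_add]
  field_simp

lemma bracket_rpow_neg_le {σ A : ℝ} (hσ : 0 ≤ σ) {x y : R3} (hA : 0 < A)
    (h : bracket y ≤ A * bracket x) : bracket x ^ (-σ) ≤ A ^ σ * bracket y ^ (-σ) := by
  have hx := bracket_pos x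
  have hy := bracket_pos y
  have h1 : bracket y ^ σ ≤ A ^ σ * bracket x ^ σ := by
    rw [← Real.mul_rpow hA.le hx.le]
    exact Real.rpow_le_rpow hy.le h hσ
  have e1 : bracket x ^ σ * bracket x ^ (-σ) = 1 := by
    rw [← Real.rpow_add hx]; simp
  have e2 : bracket y ^ σ * bracket y ^ (-σ) = 1 := by
    rw [← Real.rpow_add hy]; simp
  have hx' : 0 < bracket x ^ (-σ) := by positivity
  have hy' : 0 < bracket y ^ (-σ) := by positivity
  calc bracket x ^ (-σ) = bracket y ^ σ * (bracket x ^ (-σ) * bracket y ^ (-σ)) := by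
        rw [mul_left_comm, e2, mul_one]
    _ ≤ (A ^ σ * bracket x ^ σ) * (bracket x ^ (-σ) * bracket y ^ (-σ)) := by gcongr
    _ = A ^ σ * bracket y ^ (-σ) := by
        rw [mul_assoc, ← mul_assoc (bracket x ^ σ), e1, one_mul]

lemma inv_bracket_pow_le {A : ℝ} {p q : R3} (k : ℕ) (hA : 0 < A)
    (h : bracket q ≤ A * bracket p) : (bracket p ^ k)⁻¹ ≤ A ^ k * (bracket q ^ k)⁻¹ := by
  have hp := bracket_pos p
  have hq := bracket_pos q
  have h1 : bracket q ^ k ≤ A ^ k * bracket p ^ k := by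
    rw [← mul_pow]
    exact pow_le_pow_left₀ hq.le h k
  rw [← div_eq_mul_inv, le_div_iff₀ (by positivity), inv_mul_le_iff₀ (by positivity)]
  linarith

lemma weight_le_of_bracket_le {σ A B : ℝ} (hσ : 0 ≤ σ) (k : ℕ) {z z' : Phase} (hA : 0 < A)
    (hB : 0 < B) (h1 : bracket z'.1 ≤ A * bracket z.1) (h2 : bracket z'.2 ≤ B * bracket z.2) :
    weight σ k z ≤ A ^ σ * B ^ k * weight σ k z' := by
  have e1 := bracket_rpow_neg_le hσ hA h1
  have e2 := inv_bracket_pow_le k hB h2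
  have p1 := bracket_pos z.1
  have p2 := bracket_pos z'.1
  have p3 := bracket_pos z.2
  unfold weight
  calc _ ≤ (A ^ σ * bracket z'.1 ^ (-σ)) * (B ^ k * (bracket z'.2 ^ k)⁻¹) := by gcongr
    _ = _ := by ring

/-- A bounded displacement costs only a constant factor in the weight. Characteristics in
free-streaming coordinates are displaced by a bounded amount, so this is what lets the weighted
bounds on the datum survive transport for all times. -/
lemma weight_le_of_norm_le {σ A : ℝ} (hσ : 0 ≤ σ) (k : ℕ) {z z' : Phase}
    (h : ‖z' - z‖ ≤ A) :
    weight σ k z ≤ (1 + A) ^ σ * (1 + A) ^ k * weight σ k z' := by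
  have hA : 0 ≤ A := (norm_nonneg _).trans h
  exact weight_le_of_bracket_le hσ k (by linarith) (by linarith)
    (bracket_le_mul ((norm_fst_le (z' - z)).trans h))
    (bracket_le_mul ((norm_snd_le (z' - z)).trans h))

lemma weight_anti_left {σ σ' : ℝ} (h : σ' ≤ σ) (k : ℕ) (z : Phase) :
    weight σ k z ≤ weight σ' k z := by
  have p3 := bracket_pos z.2
  unfold weight
  gcongr
  exact one_le_bracket _

/-! ### The velocity -/

section Velocity

variable {θ : ℝ}

/-- The Lorentz factor `√(1 + θ²|p|²)` as a function of the inverse speed of light `θ`. -/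
def gam (θ : ℝ) (p : R3) : ℝ := Real.sqrt (1 + θ ^ 2 * ‖p‖ ^ 2)

/-- The velocity as a function of the inverse speed of light `θ`. -/
def vel (θ : ℝ) (p : R3) : R3 := (gam θ p)⁻¹ • p

lemma velocity_eq_vel (c : ℝ≥0∞) : velocity c = vel (invSpeed c) := rfl

lemma one_le_gam (θ : ℝ) (p : R3) : 1 ≤ gam θ p :=
  Real.one_le_sqrt.2 (by nlinarith [sq_nonneg (θ * ‖p‖)])

lemma gam_pos (θ : ℝ) (p : R3) : 0 < gam θ p := one_pos.trans_le (one_le_gam θ p)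

lemma gam_sq (θ : ℝ) (p : R3) : gam θ p ^ 2 = 1 + θ ^ 2 * ‖p‖ ^ 2 :=
  Real.sq_sqrt (by positivity)

lemma gam_inv_le_one (θ : ℝ) (p : R3) : (gam θ p)⁻¹ ≤ 1 := inv_le_one_of_one_le₀ (one_le_gam θ p)

lemma gam_zero (p : R3) : gam 0 p = 1 := by simp [gam]

lemma vel_zero (p : R3) : vel 0 p = p := by simp [vel, gam_zero]

lemma norm_vel (θ : ℝ) (p : R3) : ‖vel θ p‖ = (gam θ p)⁻¹ * ‖p‖ := by
  rw [vel, norm_smul, Real.norm_of_nonneg (inv_nonneg.2 (gam_pos θ p).le)]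

lemma norm_vel_le (θ : ℝ) (p : R3) : ‖vel θ p‖ ≤ ‖p‖ := by
  rw [norm_vel]
  exact mul_le_of_le_one_left (norm_nonneg _) (gam_inv_le_one θ p)

lemma mul_norm_vel_le_one (θ : ℝ) (p : R3) : θ * ‖vel θ p‖ ≤ 1 := by
  have h := gam_pos θ p
  rw [norm_vel, mul_left_comm, inv_mul_le_iff₀ h, mul_one]
  exact Real.le_sqrt_of_sq_le (by nlinarith)

/-- Difference of squares: γ(p)² - γ(q)² = θ²(|p|² - |q|²), and θ|p| ≤ γ(p) cancels the sum γ(p) +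
γ(q). -/
lemma abs_gam_sub_le (hθ : 0 ≤ θ) (p q : R3) : |gam θ p - gam θ q| ≤ θ * ‖p - q‖ := by
  have h1 := gam_pos θ p
  have h2 := gam_pos θ q
  have e1 := gam_sq θ p
  have e2 := gam_sq θ q
  have h3 : θ * ‖p‖ ≤ gam θ p := Real.le_sqrt_of_sq_le (by nlinarith)
  have h4 : θ * ‖q‖ ≤ gam θ q := Real.le_sqrt_of_sq_le (by nlinarith)
  have h5 : |‖p‖ - ‖q‖| ≤ ‖p - q‖ := abs_norm_sub_norm_le p q
  have h6 : |gam θ p - gam θ q| * (gam θ p + gam θ q)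
      = θ * |‖p‖ - ‖q‖| * (θ * ‖p‖ + θ * ‖q‖) := by
    have e3 : (gam θ p - gam θ q) * (gam θ p + gam θ q)
        = θ * (‖p‖ - ‖q‖) * (θ * ‖p‖ + θ * ‖q‖) := by linear_combination e1 - e2
    have e4 := congrArg abs e3
    rwa [abs_mul, abs_mul, abs_mul, abs_of_pos (add_pos h1 h2), abs_of_nonneg hθ,
      abs_of_nonneg (by positivity : 0 ≤ θ * ‖p‖ + θ * ‖q‖)] at e4
  refine le_of_mul_le_mul_right ?_ (add_pos h1 h2)
  rw [h6]
  gcongr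

lemma abs_gam_inv_sub_le (hθ : 0 ≤ θ) (p q : R3) :
    |(gam θ p)⁻¹ - (gam θ q)⁻¹| ≤ θ * ‖p - q‖ := by
  have h1 := one_le_gam θ p
  have h2 := one_le_gam θ q
  have h3 := gam_pos θ p
  have h4 := gam_pos θ q
  rw [inv_sub_inv h3.ne' h4.ne', abs_div, abs_of_pos (mul_pos h3 h4), abs_sub_comm]
  exact (div_le_self (abs_nonneg _) (by nlinarith)).trans (abs_gam_sub_le hθ p q)

lemma one_sub_gam_inv_le (θ : ℝ) (p : R3) : 1 - (gam θ p)⁻¹ ≤ θ ^ 2 * ‖p‖ ^ 2 := by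
  have h1 := one_le_gam θ p
  have h3 := gam_pos θ p
  have e1 := gam_sq θ p
  have h4 : (gam θ p)⁻¹ * gam θ p = 1 := inv_mul_cancel₀ h3.ne'
  have h5 : 0 < (gam θ p)⁻¹ := by positivity
  nlinarith

/-- The origin of both the rate c^{-2} and the weight ⟨p⟩³ in the theorem. -/
lemma norm_vel_sub_self_le (θ : ℝ) (p : R3) : ‖vel θ p - p‖ ≤ θ ^ 2 * ‖p‖ ^ 3 := by
  have h : vel θ p - p = -((1 - (gam θ p)⁻¹) • p) := by
    rw [vel, sub_smul, one_smul]; abel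
  rw [h, norm_neg, norm_smul, Real.norm_of_nonneg (by linarith [gam_inv_le_one θ p])]
  calc _ ≤ (θ ^ 2 * ‖p‖ ^ 2) * ‖p‖ := by gcongr; exact one_sub_gam_inv_le θ p
    _ = _ := by ring

/-- The derivative of the velocity. -/
def dvel (θ : ℝ) (p : R3) : R3 →L[ℝ] R3 :=
  (gam θ p)⁻¹ • (ContinuousLinearMap.id ℝ R3 -
    (innerSL ℝ (θ • vel θ p)).smulRight (θ • vel θ p))

lemma contDiff_gam (θ : ℝ) : ContDiff ℝ ∞ (gam θ) := by
  unfold gam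
  refine ContDiff.sqrt ?_ fun p => by positivity
  exact contDiff_const.add (contDiff_const.mul (contDiff_norm_sq ℝ))

lemma contDiff_vel (θ : ℝ) : ContDiff ℝ ∞ (vel θ) :=
  ((contDiff_gam θ).inv fun p => (gam_pos θ p).ne').smul contDiff_id

lemma hasFDerivAt_vel (θ : ℝ) (p : R3) : HasFDerivAt (vel θ) (dvel θ p) p := by
  have h1 : HasFDerivAt (fun p : R3 => 1 + θ ^ 2 * ‖p‖ ^ 2) (θ ^ 2 • (2 • innerSL ℝ p)) p :=
    ((hasStrictFDerivAt_norm_sq p).hasFDerivAt.const_mul (θ ^ 2)).const_add 1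
  have h2 := h1.sqrt (by positivity)
  have h3 : HasFDerivAt (fun p => (gam θ p)⁻¹) _ p :=
    (hasFDerivAt_inv (gam_pos θ p).ne').comp p h2
  have h4 := h3.smul (hasFDerivAt_id p)
  refine h4.congr_fderiv ?_
  have hg := gam_pos θ p
  ext1 h
  change (gam θ p)⁻¹ • h + _ = (gam θ p)⁻¹ • (h - inner ℝ (θ • vel θ p) h • θ • vel θ p)
  rw [smul_sub, sub_eq_add_neg]
  congr 1
  simp only [vel, inner_smul_left, smul_smul, ← neg_smul]
  simp
  congr 1
  change (gam θ p)⁻¹ * 2⁻¹ * _ * _ = _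
  field_simp

lemma norm_dvel_le (hθ : 0 ≤ θ) (p : R3) : ‖dvel θ p‖ ≤ 2 := by
  have h1 := gam_inv_le_one θ p
  have h2 : ‖θ • vel θ p‖ ≤ 1 := by
    rw [norm_smul, Real.norm_of_nonneg hθ]; exact mul_norm_vel_le_one θ p
  have h3 : ‖(innerSL ℝ (θ • vel θ p)).smulRight (θ • vel θ p)‖ ≤ 1 := by
    rw [ContinuousLinearMap.norm_smulRight_apply, innerSL_apply_norm]
    exact mul_le_one₀ h2 (norm_nonneg _) h2
  rw [dvel, norm_smul, Real.norm_of_nonneg (inv_nonneg.2 (gam_pos θ p).le)]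
  have h4 := (norm_sub_le _ _).trans (add_le_add
    (ContinuousLinearMap.norm_id_le (𝕜 := ℝ) (E := R3)) h3)
  have h5 := mul_le_mul h1 h4 (norm_nonneg _) zero_le_one
  linarith

lemma norm_vel_sub_le (hθ : 0 ≤ θ) (p q : R3) : ‖vel θ p - vel θ q‖ ≤ 2 * ‖p - q‖ :=
  convex_univ.norm_image_sub_le_of_norm_hasFDerivWithin_le
    (fun x _ => (hasFDerivAt_vel θ x).hasFDerivWithinAt) (fun x _ => norm_dvel_le hθ x)
    (mem_univ q) (mem_univ p)

lemma norm_smulRight_innerSL_sub_le {a b : R3} (ha : ‖a‖ ≤ 1) (hb : ‖b‖ ≤ 1) :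
    ‖(innerSL ℝ a).smulRight a - (innerSL ℝ b).smulRight b‖ ≤ 2 * ‖a - b‖ := by
  have h : (innerSL ℝ a).smulRight a - (innerSL ℝ b).smulRight b
      = (innerSL ℝ a).smulRight (a - b) + (innerSL ℝ (a - b)).smulRight b := by
    ext1 h
    simp only [sub_apply, add_apply,
      ContinuousLinearMap.smulRight_apply, innerSL_apply_apply, inner_sub_left, smul_sub, sub_smul]
    abel
  rw [h]
  refine (norm_add_le _ _).trans ?_
  rw [ContinuousLinearMap.norm_smulRight_apply, ContinuousLinearMap.norm_smulRight_apply,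
    innerSL_apply_norm, innerSL_apply_norm]
  nlinarith [norm_nonneg (a - b)]

/-- The constant must not depend on θ, so everything is expressed through θ v(p), which lies in the
unit ball; there a ↦ a ⊗ a is Lipschitz with constant 2. -/
lemma norm_dvel_sub_le (hθ : 0 ≤ θ) (hθ1 : θ ≤ 1) (p q : R3) :
    ‖dvel θ p - dvel θ q‖ ≤ 6 * ‖p - q‖ := by
  have n1 : ∀ p, ‖θ • vel θ p‖ ≤ 1 := fun p => by
    rw [norm_smul, Real.norm_of_nonneg hθ]; exact mul_norm_vel_le_one θ p
  set B : R3 → R3 →L[ℝ] R3 := fun p => ContinuousLinearMap.id ℝ R3 -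
    (innerSL ℝ (θ • vel θ p)).smulRight (θ • vel θ p) with hB
  have hBn : ‖B q‖ ≤ 2 := by
    refine (norm_sub_le _ _).trans ?_
    have h3 : ‖(innerSL ℝ (θ • vel θ q)).smulRight (θ • vel θ q)‖ ≤ 1 := by
      rw [ContinuousLinearMap.norm_smulRight_apply, innerSL_apply_norm]
      exact mul_le_one₀ (n1 q) (norm_nonneg _) (n1 q)
    linarith [ContinuousLinearMap.norm_id_le (𝕜 := ℝ) (E := R3)]
  have hBd : ‖B p - B q‖ ≤ 4 * ‖p - q‖ := by
    simp only [hB, sub_sub_sub_cancel_left]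
    refine (norm_smulRight_innerSL_sub_le (n1 q) (n1 p)).trans ?_
    rw [← smul_sub, norm_smul, Real.norm_of_nonneg hθ, norm_sub_rev]
    nlinarith [norm_vel_sub_le hθ p q, norm_nonneg (vel θ p - vel θ q)]
  have h : dvel θ p - dvel θ q
      = (gam θ p)⁻¹ • (B p - B q) + ((gam θ p)⁻¹ - (gam θ q)⁻¹) • B q := by
    simp only [dvel, smul_sub, sub_smul, hB]
    abel
  rw [h]
  refine (norm_add_le _ _).trans ?_
  rw [norm_smul, norm_smul, Real.norm_of_nonneg (inv_nonneg.2 (gam_pos θ p).le), Real.norm_eq_abs]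
  have h1 := abs_gam_inv_sub_le hθ p q
  have h2 : |(gam θ p)⁻¹ - (gam θ q)⁻¹| ≤ ‖p - q‖ := by
    refine h1.trans ?_
    nlinarith [norm_nonneg (p - q)]
  calc _ ≤ 1 * (4 * ‖p - q‖) + ‖p - q‖ * 2 := by
        gcongr
        exact gam_inv_le_one θ p
    _ = _ := by ring

lemma norm_dvel_sub_id_le (hθ : 0 ≤ θ) (p : R3) :
    ‖dvel θ p - ContinuousLinearMap.id ℝ R3‖ ≤ 2 * (θ ^ 2 * ‖p‖ ^ 2) := by
  have h : dvel θ p - ContinuousLinearMap.id ℝ R3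
      = -((1 - (gam θ p)⁻¹) • ContinuousLinearMap.id ℝ R3
        + (gam θ p)⁻¹ • (innerSL ℝ (θ • vel θ p)).smulRight (θ • vel θ p)) := by
    rw [dvel]
    module
  rw [h, norm_neg]
  refine (norm_add_le _ _).trans ?_
  rw [norm_smul, norm_smul, Real.norm_of_nonneg (by linarith [gam_inv_le_one θ p]),
    Real.norm_of_nonneg (inv_nonneg.2 (gam_pos θ p).le),
    ContinuousLinearMap.norm_smulRight_apply, innerSL_apply_norm, norm_smul,
    Real.norm_of_nonneg hθ]
  have h1 := one_sub_gam_inv_le θ p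
  have h2 := gam_inv_le_one θ p
  have h3 := norm_vel_le θ p
  have h4 : θ * ‖vel θ p‖ * (θ * ‖vel θ p‖) ≤ θ ^ 2 * ‖p‖ ^ 2 := by
    calc _ ≤ θ * ‖p‖ * (θ * ‖p‖) := by gcongr
      _ = _ := by ring
  calc _ ≤ (θ ^ 2 * ‖p‖ ^ 2) * 1 + 1 * (θ ^ 2 * ‖p‖ ^ 2) := by
        have := gam_pos θ p
        gcongr
        exact ContinuousLinearMap.norm_id_le
    _ = _ := by ring

lemma one_sub_sq_norm_vel (θ : ℝ) (p : R3) : 1 - θ ^ 2 * ‖vel θ p‖ ^ 2 = ((gam θ p)⁻¹) ^ 2 := by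
  have h := gam_pos θ p
  have e := gam_sq θ p
  rw [norm_vel]
  field_simp
  linarith

/-- Dv is γ^{-1} times a rank-one perturbation of the identity. The scalar contributes γ^{-3} and
the perturbation 1 - θ²|v|² = γ^{-2}. -/
lemma det_dvel (θ : ℝ) (p : R3) : (dvel θ p).det = ((gam θ p)⁻¹) ^ 5 := by
  have h : ((dvel θ p : R3 →L[ℝ] R3) : R3 →ₗ[ℝ] R3)
      = (gam θ p)⁻¹ • LinearMap.transvection (-(innerSL ℝ (θ • vel θ p) : R3 →ₗ[ℝ] ℝ))
        (θ • vel θ p) := by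
    ext1 h
    simp [dvel, LinearMap.transvection.apply, sub_eq_add_neg]
  rw [ContinuousLinearMap.det, h, LinearMap.det_smul, LinearMap.transvection.det]
  have h2 : 1 + (-(innerSL ℝ (θ • vel θ p) : R3 →ₗ[ℝ] ℝ)) (θ • vel θ p)
      = 1 - θ ^ 2 * ‖vel θ p‖ ^ 2 := by
    simp
    ring
  rw [h2, one_sub_sq_norm_vel, finrank_euclideanSpace_fin]
  ring

/-- The factor `√(1 - θ²|u|²)`, equal to `0` outside the ball of admissible velocities. -/
def mfac (θ : ℝ) (u : R3) : ℝ := Real.sqrt (1 - θ ^ 2 * ‖u‖ ^ 2)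

/-- The momentum belonging to the velocity `u` (zero if `u` is not admissible). -/
def mom (θ : ℝ) (u : R3) : R3 := (mfac θ u)⁻¹ • u

lemma mfac_nonneg (θ : ℝ) (u : R3) : 0 ≤ mfac θ u := Real.sqrt_nonneg _

lemma mfac_le_one (θ : ℝ) (u : R3) : mfac θ u ≤ 1 :=
  Real.sqrt_le_one.2 (by nlinarith [sq_nonneg (θ * ‖u‖)])

lemma continuous_mfac (θ : ℝ) : Continuous (mfac θ) := by
  unfold mfac
  fun_prop

lemma measurable_mom (θ : ℝ) : Measurable (mom θ) :=
  (continuous_mfac θ).measurable.inv.smul measurable_id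

lemma mfac_vel (θ : ℝ) (p : R3) : mfac θ (vel θ p) = (gam θ p)⁻¹ := by
  rw [mfac, one_sub_sq_norm_vel, Real.sqrt_sq (inv_nonneg.2 (gam_pos θ p).le)]

lemma mom_vel (θ : ℝ) (p : R3) : mom θ (vel θ p) = p := by
  rw [mom, mfac_vel, vel, inv_inv, smul_inv_smul₀ (gam_pos θ p).ne']

lemma injective_vel (θ : ℝ) : Function.Injective (vel θ) :=
  Function.LeftInverse.injective (mom_vel θ)

lemma mfac_sq {u : R3} (h : mfac θ u ≠ 0) : mfac θ u ^ 2 = 1 - θ ^ 2 * ‖u‖ ^ 2 := by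
  refine Real.sq_sqrt ?_
  by_contra hneg
  exact h (Real.sqrt_eq_zero_of_nonpos (not_le.1 hneg).le)

lemma gam_mom {u : R3} (h : mfac θ u ≠ 0) : gam θ (mom θ u) = (mfac θ u)⁻¹ := by
  have h0 : 0 < mfac θ u := lt_of_le_of_ne (mfac_nonneg θ u) h.symm
  have e := mfac_sq h
  rw [gam, Real.sqrt_eq_iff_mul_self_eq_of_pos (by positivity), mom, norm_smul,
    Real.norm_of_nonneg (by positivity)]
  field_simp
  linarith

lemma vel_mom {u : R3} (h : mfac θ u ≠ 0) : vel θ (mom θ u) = u := by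
  rw [vel, gam_mom h, inv_inv, mom, smul_inv_smul₀ h]

lemma range_vel (θ : ℝ) : range (vel θ) = {u | mfac θ u ≠ 0} := by
  ext u
  constructor
  · rintro ⟨p, rfl⟩
    simp only [mem_ofPred_eq, mfac_vel]
    exact inv_ne_zero (gam_pos θ p).ne'
  · exact fun h => ⟨_, vel_mom h⟩

/-- `⟨p⟩ ≥ ⟨u⟩ / (2 m)` for the momentum `p` of the velocity `u`. -/
lemma bracket_le_mul_bracket_mom (hθ : 0 ≤ θ) (hθ1 : θ ≤ 1) {u : R3} (h : mfac θ u ≠ 0) :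
    bracket u ≤ 2 * mfac θ u * bracket (mom θ u) := by
  have h0 : 0 < mfac θ u := lt_of_le_of_ne (mfac_nonneg θ u) h.symm
  have e := mfac_sq h
  have hb := bracket_pos (mom θ u)
  refine Real.sqrt_le_iff.2 ⟨by positivity, ?_⟩
  rw [mul_pow, mul_pow, bracket_sq, mom, norm_smul, Real.norm_of_nonneg (by positivity), mul_pow,
    mul_assoc, mul_add, ← mul_assoc (mfac θ u ^ 2), ← mul_pow, mul_inv_cancel₀ h, e]
  have : θ ^ 2 ≤ 1 := by nlinarith
  nlinarith [sq_nonneg ‖u‖]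

lemma mfac_eq_one_of_zero (u : R3) : mfac 0 u = 1 := by simp [mfac]

lemma mom_zero (u : R3) : mom 0 u = u := by simp [mom, mfac_eq_one_of_zero]

end Velocity

end Vlasov

end

noncomputable section

namespace Vlasov

/-! ### Integrals of the weights -/

lemma integrable_bracket_rpow_neg {σ : ℝ} (hσ : 3 < σ) :
    Integrable (fun y : R3 => bracket y ^ (-σ)) := by
  have h := integrable_rpow_neg_one_add_norm_sq (E := R3) (μ := volume) (r := σ)
    (by rw [finrank_euclideanSpace_fin]; exact_mod_cast hσ)
  refine h.congr (Eventually.of_forall fun y => ?_)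
  simp only [bracket, Real.sqrt_eq_rpow]
  rw [← Real.rpow_mul (by positivity)]
  congr 1
  ring

lemma integrable_inv_bracket_pow {k : ℕ} (hk : 3 < k) :
    Integrable (fun y : R3 => (bracket y ^ k)⁻¹) := by
  refine (integrable_bracket_rpow_neg (σ := k) (by exact_mod_cast hk)).congr
    (Eventually.of_forall fun y => ?_)
  simp only
  rw [Real.rpow_neg (bracket_pos y).le, Real.rpow_natCast]

lemma integrable_weight {σ : ℝ} (hσ : 3 < σ) {k : ℕ} (hk : 3 < k) : Integrable (weight σ k) :=
  (integrable_bracket_rpow_neg hσ).mul_prod (integrable_inv_bracket_pow hk)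

lemma continuous_bracket_rpow_neg (σ : ℝ) : Continuous fun y : R3 => bracket y ^ (-σ) :=
  continuous_bracket.rpow_const fun y => Or.inl (bracket_pos y).ne'

lemma lintegral_comp_smul_R3 (f : R3 → ℝ≥0∞) (hf : Measurable f) {r : ℝ} (hr : r ≠ 0) :
    ∫⁻ y, f (r • y) = ENNReal.ofReal (|r| ^ 3)⁻¹ * ∫⁻ y, f y := by
  have h := Measure.map_addHaar_smul (volume : Measure R3) hr
  rw [← lintegral_map hf (measurable_const_smul r), h, lintegral_smul_measure, smul_eq_mul,
    finrank_euclideanSpace_fin, abs_inv, abs_pow]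

lemma measurable_shifted_weight (σ : ℝ) (k : ℕ) {sh : R3 → R3} (hsh : Measurable sh) :
    Measurable fun z : Phase => ENNReal.ofReal (weight σ k (z.1 - sh z.2, z.2)) := by
  have h := (continuous_weight σ k).measurable
  exact (h.comp ((measurable_fst.sub (hsh.comp measurable_snd)).prodMk measurable_snd)).ennreal_ofReal

lemma lintegral_shifted_weight (σ : ℝ) (k : ℕ) {sh : R3 → R3} (hsh : Measurable sh) :
    ∫⁻ z : Phase, ENNReal.ofReal (weight σ k (z.1 - sh z.2, z.2))
      = ∫⁻ z, ENNReal.ofReal (weight σ k z) := by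
  rw [Measure.volume_eq_prod, lintegral_prod_symm _ (measurable_shifted_weight σ k hsh).aemeasurable,
    lintegral_prod_symm _ (continuous_weight σ k).measurable.ennreal_ofReal.aemeasurable]
  refine lintegral_congr fun u => ?_
  exact lintegral_sub_right_eq_self (fun y => ENNReal.ofReal (weight σ k (y, u))) (sh u)

/-- The local density of a weight under an arbitrary displacement is bounded, and its total mass is
conserved. -/
lemma exists_shifted_weight_bound {σ : ℝ} (hσ : 3 < σ) : ∃ C : ℝ, 0 < C ∧
    ∀ sh : R3 → R3, Measurable sh →
      (∀ x : R3, ∫⁻ u, ENNReal.ofReal (weight σ 4 (x - sh u, u)) ≤ ENNReal.ofReal C) ∧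
      ∫⁻ z : Phase, ENNReal.ofReal (weight σ 4 (z.1 - sh z.2, z.2)) ≤ ENNReal.ofReal C := by
  have h1 := integrable_inv_bracket_pow (k := 4) (by norm_num)
  have h2 := integrable_weight hσ (k := 4) (by norm_num)
  have n1 : 0 ≤ ∫ u : R3, (bracket u ^ 4)⁻¹ :=
    integral_nonneg fun u => inv_nonneg.2 (pow_nonneg (bracket_pos u).le 4)
  have n2 : 0 ≤ ∫ z, weight σ 4 z := integral_nonneg fun z => weight_nonneg σ 4 z
  refine ⟨(∫ u : R3, (bracket u ^ 4)⁻¹) + (∫ z, weight σ 4 z) + 1, by positivity,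
    fun sh hsh => ⟨fun x => ?_, ?_⟩⟩
  · calc _ ≤ ∫⁻ u : R3, ENNReal.ofReal (bracket u ^ 4)⁻¹ := by
          refine lintegral_mono fun u => ENNReal.ofReal_le_ofReal ?_
          have := bracket_pos u
          unfold weight
          refine mul_le_of_le_one_left (by positivity) ?_
          exact Real.rpow_le_one_of_one_le_of_nonpos (one_le_bracket _) (by linarith)
      _ = ENNReal.ofReal (∫ u : R3, (bracket u ^ 4)⁻¹) :=
          (ofReal_integral_eq_lintegral_ofReal h1 (Eventually.of_forall fun u =>
            inv_nonneg.2 (pow_nonneg (bracket_pos u).le 4))).symm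
      _ ≤ _ := ENNReal.ofReal_le_ofReal (by linarith)
  · rw [lintegral_shifted_weight σ 4 hsh,
      ← ofReal_integral_eq_lintegral_ofReal h2 (Eventually.of_forall fun z => weight_nonneg σ 4 z)]
    exact ENNReal.ofReal_le_ofReal (by linarith)

/-- Dispersion: the local density of a freely streaming weight decays like `t^{-3}`. -/
lemma exists_free_streaming_bound {σ : ℝ} (hσ : 3 < σ) : ∃ C : ℝ, 0 < C ∧
    ∀ (t : ℝ) (x : R3), ∫⁻ u, ENNReal.ofReal (weight σ 4 (x - t • u, u))
      ≤ ENNReal.ofReal (C * (1 + |t|) ^ (-3 : ℝ)) := by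
  obtain ⟨C, hC, hb⟩ := exists_shifted_weight_bound hσ
  have h1 := integrable_bracket_rpow_neg hσ
  have n1 : 0 ≤ ∫ u : R3, bracket u ^ (-σ) :=
    integral_nonneg fun u => Real.rpow_nonneg (bracket_pos u).le _
  set S := ∫ u : R3, bracket u ^ (-σ) with hS
  refine ⟨8 * (C + S), by positivity, fun t x => ?_⟩
  have e3 : (1 + |t|) ^ (-3 : ℝ) = ((1 + |t|) ^ 3)⁻¹ := by
    rw [Real.rpow_neg (by positivity)]; norm_cast
  rw [e3]
  rcases le_total |t| 1 with ht | ht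
  · refine ((hb (fun u => t • u) (measurable_const_smul t)).1 x).trans
      (ENNReal.ofReal_le_ofReal ?_)
    rw [← div_eq_mul_inv, le_div_iff₀ (by positivity)]
    have : (1 + |t|) ^ 3 ≤ 2 ^ 3 := pow_le_pow_left₀ (by positivity) (by linarith) 3
    nlinarith
  · have ht0 : t ≠ 0 := by rintro rfl; simp at ht; linarith
    -- For |t| ≥ 1 the momentum weight is discarded and the substitution of t u for u produces
    -- |t|^{-3}; the factor 8 comes from (1+|t|)³ ≤ (2|t|)³.
    calc _ ≤ ∫⁻ u : R3, ENNReal.ofReal (bracket (x - t • u) ^ (-σ)) := by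
          refine lintegral_mono fun u => ENNReal.ofReal_le_ofReal ?_
          have := bracket_pos (x - t • u)
          unfold weight
          refine mul_le_of_le_one_right (by positivity) ?_
          exact inv_le_one_of_one_le₀ (one_le_pow₀ (one_le_bracket _))
      _ = ENNReal.ofReal (|t| ^ 3)⁻¹ * ∫⁻ u : R3, ENNReal.ofReal (bracket (x - u) ^ (-σ)) :=
          lintegral_comp_smul_R3 (fun u => ENNReal.ofReal (bracket (x - u) ^ (-σ)))
            ((continuous_bracket_rpow_neg σ).measurable.comp
              (measurable_const.sub measurable_id)).ennreal_ofReal ht0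
      _ = ENNReal.ofReal (|t| ^ 3)⁻¹ * ENNReal.ofReal S := by
          rw [lintegral_sub_left_eq_self (fun u : R3 => ENNReal.ofReal (bracket u ^ (-σ))) x,
            hS, ofReal_integral_eq_lintegral_ofReal h1 (Eventually.of_forall fun u =>
            Real.rpow_nonneg (bracket_pos u).le _)]
      _ = ENNReal.ofReal ((|t| ^ 3)⁻¹ * S) := (ENNReal.ofReal_mul (by positivity)).symm
      _ ≤ _ := by
          refine ENNReal.ofReal_le_ofReal ?_
          have h8 : (1 + |t|) ^ 3 ≤ 8 * |t| ^ 3 := by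
            calc _ ≤ (2 * |t|) ^ 3 := pow_le_pow_left₀ (by positivity) (by linarith) 3
              _ = _ := by ring
          rw [inv_mul_le_iff₀ (by positivity), ← div_eq_mul_inv, ← mul_div_assoc,
            le_div_iff₀ (by positivity)]
          nlinarith [pow_pos (lt_of_lt_of_le one_pos ht) 3]

/-! ### Change of variables from momentum to velocity -/

section ChangeOfVariables

variable {θ : ℝ}

/-- The Jacobian of p = p(u) is m^{-5} with m = √(1 - θ²|u|²) = 1/γ. The integral on the right may
run over all u: off the ball of admissible velocities m = 0, and since 0⁻¹ = 0 the integrand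
vanishes there. -/
lemma lintegral_eq_lintegral_mom (θ : ℝ) (F : R3 → ℝ≥0∞) :
    ∫⁻ p, F p = ∫⁻ u, ENNReal.ofReal ((mfac θ u)⁻¹ ^ 5) * F (mom θ u) := by
  have h := lintegral_image_eq_lintegral_abs_det_fderiv_mul volume (s := univ) MeasurableSet.univ
    (fun p _ => (hasFDerivAt_vel θ p).hasFDerivWithinAt) (injective_vel θ).injOn
    (fun u => ENNReal.ofReal ((mfac θ u)⁻¹ ^ 5) * F (mom θ u))
  have hm : MeasurableSet (vel θ '' univ) := by
    rw [image_univ, range_vel]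
    exact (measurableSet_eq_fun (continuous_mfac θ).measurable measurable_const).compl
  have h2 : ∫⁻ u in vel θ '' univ, ENNReal.ofReal ((mfac θ u)⁻¹ ^ 5) * F (mom θ u)
      = ∫⁻ u, ENNReal.ofReal ((mfac θ u)⁻¹ ^ 5) * F (mom θ u) := by
    rw [← lintegral_indicator hm]
    refine lintegral_congr fun u => ?_
    by_cases hu : mfac θ u = 0
    · have : u ∉ vel θ '' univ := by rw [image_univ, range_vel]; simpa using hu
      simp [hu]
    · have : u ∈ vel θ '' univ := by rw [image_univ, range_vel]; simpa using hu
      rw [indicator_of_mem this]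
  rw [← h2, h, setLIntegral_univ]
  refine lintegral_congr fun p => ?_
  have hg := gam_pos θ p
  rw [det_dvel, mfac_vel, mom_vel, ← mul_assoc, ← ENNReal.ofReal_mul (abs_nonneg _),
    abs_of_pos (by positivity), ← mul_pow, inv_inv, inv_mul_cancel₀ hg.ne']
  simp

lemma integral_eq_integral_mom {E : Type*} [NormedAddCommGroup E] [NormedSpace ℝ E]
    (θ : ℝ) (F : R3 → E) :
    ∫ p, F p = ∫ u, ((mfac θ u)⁻¹ ^ 5) • F (mom θ u) := by
  have h := integral_image_eq_integral_abs_det_fderiv_smul volume (s := univ) MeasurableSet.univ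
    (fun p _ => (hasFDerivAt_vel θ p).hasFDerivWithinAt) (injective_vel θ).injOn
    (fun u => ((mfac θ u)⁻¹ ^ 5) • F (mom θ u))
  rw [setIntegral_eq_integral_of_forall_compl_eq_zero] at h
  · rw [h, setIntegral_univ]
    refine integral_congr_ae (Eventually.of_forall fun p => ?_)
    have hg := gam_pos θ p
    simp only
    rw [det_dvel, mfac_vel, mom_vel, smul_smul, abs_of_pos (by positivity), ← mul_pow, inv_inv,
      inv_mul_cancel₀ hg.ne', one_pow, one_smul]
  · intro u hu
    rw [image_univ, range_vel] at hu
    simp only [mem_ofPred_eq, not_not] at hu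
    simp [hu]

/-- Since ⟨p⟩ ≥ ⟨u⟩/(2m), the factor ⟨p⟩^{-(k+j)} supplies m^{k+j}: j powers absorb m^{-j}, and the
other k make the density vanish at the boundary of the admissible ball. The condition j ≠ 0 makes
the left side zero where m = 0. -/
lemma weight_mom_le (hθ : 0 ≤ θ) (hθ1 : θ ≤ 1) (σ : ℝ) {k j : ℕ} (hj : j ≠ 0) (y u : R3) :
    (mfac θ u)⁻¹ ^ j * weight σ (k + j) (y, mom θ u)
      ≤ 2 ^ (k + j) * mfac θ u ^ k * weight σ (k + j) (y, u) := by
  have hm := mfac_nonneg θ u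
  by_cases h : mfac θ u = 0
  · rw [h, inv_zero, zero_pow hj, zero_mul]
    have := weight_nonneg σ (k + j) (y, u)
    positivity
  · have h0 : 0 < mfac θ u := lt_of_le_of_ne hm (Ne.symm h)
    have h1 := inv_bracket_pow_le (k + j) (by positivity) (bracket_le_mul_bracket_mom hθ hθ1 h)
    have hy := bracket_pos y
    unfold weight
    calc _ ≤ (mfac θ u)⁻¹ ^ j * (bracket y ^ (-σ) *
          ((2 * mfac θ u) ^ (k + j) * (bracket u ^ (k + j))⁻¹)) := by gcongr
      _ = _ := by
        rw [mul_pow, pow_add (mfac θ u), inv_pow]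
        field_simp

/-- A function of momentum in terms of velocity, with the Jacobian. -/
def velDensity (θ : ℝ) (g : Phase → ℝ) (z : Phase) : ℝ :=
  (mfac θ z.2)⁻¹ ^ 5 * g (z.1, mom θ z.2)

lemma measurable_velDensity (θ : ℝ) {g : Phase → ℝ} (hg : Measurable g) :
    Measurable (velDensity θ g) :=
  (((continuous_mfac θ).measurable.comp measurable_snd).inv.pow_const 5).mul
    (hg.comp (measurable_fst.prodMk ((measurable_mom θ).comp measurable_snd)))

/-- In the velocity variable relativistic streaming is x - t u, so the dispersion estimate becomes
the classical one. Five of the eight powers of ⟨p⟩ pay for the Jacobian, and four powers of ⟨u⟩ are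
all that is kept. -/
lemma lintegral_weight_vel_le (hθ : 0 ≤ θ) (hθ1 : θ ≤ 1) (σ t : ℝ) (x : R3) :
    ∫⁻ p, ENNReal.ofReal (weight σ 8 (x - t • vel θ p, p))
      ≤ ENNReal.ofReal (2 ^ 8) * ∫⁻ u, ENNReal.ofReal (weight σ 4 (x - t • u, u)) := by
  rw [lintegral_eq_lintegral_mom θ, ← lintegral_const_mul' _ _ ENNReal.ofReal_ne_top]
  refine lintegral_mono fun u => ?_
  dsimp only
  rw [← ENNReal.ofReal_mul (by have := mfac_nonneg θ u; positivity),
    ← ENNReal.ofReal_mul (by norm_num)]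
  refine ENNReal.ofReal_le_ofReal ?_
  by_cases h : mfac θ u = 0
  · rw [h]
    have := weight_nonneg σ 4 (x - t • u, u)
    simp only [inv_zero, ne_eq, OfNat.ofNat_ne_zero, not_false_eq_true, zero_pow, zero_mul]
    positivity
  · rw [vel_mom h]
    refine (weight_mom_le hθ hθ1 σ (k := 3) (j := 5) (by norm_num) _ u).trans ?_
    have h1 : mfac θ u ^ 3 ≤ 1 := pow_le_one₀ (mfac_nonneg θ u) (mfac_le_one θ u)
    have h2 := weight_anti (σ := σ) (show 4 ≤ 3 + 5 by norm_num) (x - t • u, u)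
    have h3 := weight_nonneg σ (3 + 5) (x - t • u, u)
    calc _ ≤ 2 ^ (3 + 5) * 1 * weight σ 4 (x - t • u, u) := by gcongr
      _ = _ := by norm_num

end ChangeOfVariables

/-! ### Short-range kernels and the field estimate -/

/-- A vector field on `ℝ³` that is integrable near `0` and of size `|x|^{-(α+1)}` at infinity. -/
structure IsKernel (α A R : ℝ) (k : R3 → R3) : Prop where
  measurable : Measurable k
  pos : 0 < A
  radius_pos : 0 < R
  near : ∀ s, 1 ≤ s → ∫⁻ y in Metric.ball (0 : R3) (R * s), ‖k y‖ₑ ≤ ENNReal.ofReal (A * s ^ (2 - α))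
  far : ∀ s, 1 ≤ s → ∀ y, R * s ≤ ‖y‖ → ‖k y‖ ≤ A * s ^ (-(α + 1))

/-- Splitting a convolution with a kernel into the contributions of a ball and its complement. -/
lemma lintegral_mul_enorm_comp_sub_le {k : R3 → R3} (hk : Measurable k) {r : ℝ} {N B : ℝ≥0∞}
    (hN : ∫⁻ y in Metric.ball (0 : R3) r, ‖k y‖ₑ ≤ N) (hB : ∀ y, r ≤ ‖y‖ → ‖k y‖ₑ ≤ B)
    {W : Phase → ℝ≥0∞} (hW : Measurable W) {S I : ℝ≥0∞} (hS : ∀ x, ∫⁻ u, W (x, u) ≤ S)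
    (hI : ∫⁻ z, W z ≤ I) (x : R3) :
    ∫⁻ z : Phase, W z * ‖k (x - z.1)‖ₑ ≤ N * S + B * I := by
  have hk1 : Measurable fun y : R3 => ‖k (x - y)‖ₑ :=
    (hk.comp (measurable_const.sub measurable_id)).enorm
  rw [Measure.volume_eq_prod] at hI ⊢
  rw [lintegral_prod _ hW.aemeasurable] at hI
  rw [lintegral_prod (fun z : R3 × R3 => W z * ‖k (x - z.1)‖ₑ)
    (hW.mul (hk1.comp measurable_fst)).aemeasurable]
  have hm : Measurable fun y => ∫⁻ u, W (y, u) := hW.lintegral_prod_right'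
  have hn : Measurable ((Metric.ball (0 : R3) r).indicator fun y => ‖k y‖ₑ) :=
    hk.enorm.indicator measurableSet_ball
  have hn' : Measurable fun y => (Metric.ball (0 : R3) r).indicator (fun y => ‖k y‖ₑ) (x - y) :=
    hn.comp (measurable_const.sub measurable_id)
  calc ∫⁻ y : R3, ∫⁻ u, W (y, u) * ‖k (x - y)‖ₑ
      = ∫⁻ y : R3, (∫⁻ u, W (y, u)) * ‖k (x - y)‖ₑ := by
        refine lintegral_congr fun y => ?_
        exact lintegral_mul_const _ (hW.comp measurable_prodMk_left)
    _ ≤ ∫⁻ y : R3, ((Metric.ball (0 : R3) r).indicator (fun y => ‖k y‖ₑ) (x - y) * S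
          + B * ∫⁻ u, W (y, u)) := by
        refine lintegral_mono fun y => ?_
        by_cases hy : x - y ∈ Metric.ball (0 : R3) r
        · rw [indicator_of_mem hy, mul_comm]
          exact le_add_right (by gcongr; exact hS y)
        · rw [mul_comm]
          refine le_add_left ?_
          gcongr
          exact hB _ (by simpa using hy)
    _ = (∫⁻ y in Metric.ball (0 : R3) r, ‖k y‖ₑ) * S + B * ∫⁻ y : R3, ∫⁻ u, W (y, u) := by
        rw [lintegral_add_right _ (hm.const_mul B), lintegral_const_mul _ hm,
          lintegral_mul_const _ hn',
          lintegral_sub_left_eq_self ((Metric.ball (0 : R3) r).indicator fun y => ‖k y‖ₑ) x,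
          lintegral_indicator measurableSet_ball]
    _ ≤ _ := by gcongr

namespace IsKernel

variable {α A R : ℝ} {k : R3 → R3}

lemma lintegral_le (hk : IsKernel α A R k) {s : ℝ} (hs : 1 ≤ s) {W : Phase → ℝ≥0∞}
    (hW : Measurable W) {S I : ℝ} (hS0 : 0 ≤ S) (hI0 : 0 ≤ I)
    (hS : ∀ x, ∫⁻ u, W (x, u) ≤ ENNReal.ofReal S)
    (hI : ∫⁻ z, W z ≤ ENNReal.ofReal I) (x : R3) :
    ∫⁻ z : Phase, W z * ‖k (x - z.1)‖ₑ
      ≤ ENNReal.ofReal (A * s ^ (2 - α) * S + A * s ^ (-(α + 1)) * I) := by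
  have hA := hk.pos
  have h := lintegral_mul_enorm_comp_sub_le hk.measurable (hk.near s hs)
    (B := ENNReal.ofReal (A * s ^ (-(α + 1)))) (fun y hy => by
      rw [← ofReal_norm]
      exact ENNReal.ofReal_le_ofReal (hk.far s hs y hy)) hW hS hI x
  rwa [← ENNReal.ofReal_mul (by positivity), ← ENNReal.ofReal_mul (by positivity),
    ← ENNReal.ofReal_add (by positivity) (by positivity)] at h

/-- Time decay of a field generated by a weight with dispersing density. -/
lemma lintegral_le_of_dispersion (hk : IsKernel α A R k) (hα : α < 2) {W : Phase → ℝ≥0∞}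
    (hW : Measurable W) {C t : ℝ} (hC : 0 ≤ C)
    (hS : ∀ x, ∫⁻ u, W (x, u) ≤ ENNReal.ofReal (C * (1 + |t|) ^ (-3 : ℝ)))
    (hI : ∫⁻ z, W z ≤ ENNReal.ofReal C) (x : R3) :
    ∫⁻ z : Phase, W z * ‖k (x - z.1)‖ₑ
      ≤ ENNReal.ofReal (2 * A * C * (1 + |t|) ^ (-(α + 1))) := by
  have ht : 0 < 1 + |t| := by positivity
  -- With the splitting radius R(1+|t|), the inner part is (1+|t|)^{2-α} times the density bound
  -- (1+|t|)^{-3}, and the outer part is (1+|t|)^{-(α+1)} times the mass; the two rates coincide.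
  refine (hk.lintegral_le (s := 1 + |t|) (by linarith [abs_nonneg t]) hW (by positivity) hC hS hI
    x).trans_eq ?_
  have e : (1 + |t|) ^ (2 - α) * (1 + |t|) ^ (-3 : ℝ) = (1 + |t|) ^ (-(α + 1)) := by
    rw [← Real.rpow_add ht]; congr 1; ring
  congr 1
  rw [← e]
  ring

end IsKernel

end Vlasov

end

noncomputable section

namespace Vlasov

/-! ### Existence of a regular representative of the kernel -/

/-- By scaling, the integral over the ball of radius r is r^{3-a} times the one over the unit ball,
which is finite because a < 3. -/
lemma exists_integral_ball_rpow {a : ℝ} (ha : a < 3) : ∃ J : ℝ, 0 ≤ J ∧ ∀ r, 0 < r →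
    ∫⁻ y in Metric.ball (0 : R3) r, ENNReal.ofReal (‖y‖ ^ (-a)) ≤ ENNReal.ofReal (J * r ^ (3 - a)) := by
  have hm : Measurable fun y : R3 => ‖y‖ ^ (-a) := measurable_norm.pow_const _
  have hi : IntegrableOn (fun y : R3 => ‖y‖ ^ (-a)) (Metric.ball 0 1) := by
    refine integrableOn_ball_of_norm_le_rpow (C := 1) (α := a) (by simp) (by simpa using ha)
      (Eventually.of_forall fun y => ?_) hm.aestronglyMeasurable
    rw [Real.norm_of_nonneg (by positivity), one_mul]
  refine ⟨∫ y in Metric.ball (0 : R3) 1, ‖y‖ ^ (-a), integral_nonneg fun y => by positivity,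
    fun r hr => ?_⟩
  set f : R3 → ℝ≥0∞ := (Metric.ball (0 : R3) r).indicator fun y => ENNReal.ofReal (‖y‖ ^ (-a)) with hf
  have hfm : Measurable f := hm.ennreal_ofReal.indicator measurableSet_ball
  have h1 := lintegral_comp_smul_R3 f hfm hr.ne'
  have h2 : ∫⁻ y, f (r • y) = ENNReal.ofReal (r ^ (-a)) *
      ∫⁻ y in Metric.ball (0 : R3) 1, ENNReal.ofReal (‖y‖ ^ (-a)) := by
    rw [← lintegral_const_mul' _ _ ENNReal.ofReal_ne_top, ← lintegral_indicator measurableSet_ball]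
    refine lintegral_congr fun y => ?_
    have hmem : r • y ∈ Metric.ball (0 : R3) r ↔ y ∈ Metric.ball (0 : R3) 1 := by
      simp only [mem_ball_zero_iff, norm_smul, Real.norm_of_nonneg hr.le]
      exact mul_lt_iff_lt_one_right hr
    by_cases hy : y ∈ Metric.ball (0 : R3) 1
    · rw [indicator_of_mem hy, hf, indicator_of_mem (hmem.2 hy), norm_smul,
        Real.norm_of_nonneg hr.le, Real.mul_rpow hr.le (norm_nonneg _),
        ENNReal.ofReal_mul (by positivity)]
    · rw [indicator_of_notMem hy, hf, indicator_of_notMem (fun h => hy (hmem.1 h))]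
  have h3 : ∫⁻ y in Metric.ball (0 : R3) 1, ENNReal.ofReal (‖y‖ ^ (-a))
      = ENNReal.ofReal (∫ y in Metric.ball (0 : R3) 1, ‖y‖ ^ (-a)) :=
    (ofReal_integral_eq_lintegral_ofReal hi (Eventually.of_forall fun y => by positivity)).symm
  have h4 : ∫⁻ y, f y = ∫⁻ y in Metric.ball (0 : R3) r, ENNReal.ofReal (‖y‖ ^ (-a)) :=
    lintegral_indicator measurableSet_ball _
  rw [h2, h3, h4, abs_of_pos hr] at h1
  have hr3 : ENNReal.ofReal (r ^ 3) * ENNReal.ofReal (r ^ 3)⁻¹ = 1 := by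
    rw [← ENNReal.ofReal_mul (by positivity), mul_inv_cancel₀ (by positivity), ENNReal.ofReal_one]
  have h5 := congrArg (ENNReal.ofReal (r ^ 3) * ·) h1
  simp only [← mul_assoc, hr3, one_mul] at h5
  rw [← h5, ← ENNReal.ofReal_mul (by positivity), ← ENNReal.ofReal_mul (by positivity)]
  refine ENNReal.ofReal_le_ofReal (le_of_eq ?_)
  rw [show (3 - a) = (3 : ℕ) + -a by push_cast; ring, Real.rpow_add hr, Real.rpow_natCast]
  ring

/-- Inside the ball of radius R only integrability is known and contributes a constant, which is at
most a multiple of s^{2-α} because α < 2 and s ≥ 1. Between R and Rs the power bound integrates to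
order s^{3-(α+1)}. -/
lemma exists_isKernel {α : ℝ} (hα1 : 1 < α) (hα2 : α < 2) {k : R3 → R3} (hk : Measurable k)
    {K R : ℝ} (hK : 0 < K) (hR : 0 < R) (hloc : IntegrableOn k (Metric.ball 0 R))
    (hfar : ∀ x, R ≤ ‖x‖ → ‖k x‖ ≤ K * ‖x‖ ^ (-(α + 1))) : ∃ A, IsKernel α A R k := by
  obtain ⟨J, hJ0, hJ⟩ := exists_integral_ball_rpow (a := α + 1) (by linarith)
  have hN : ∫⁻ y in Metric.ball (0 : R3) R, ‖k y‖ₑ = ENNReal.ofReal (∫ y in Metric.ball (0 : R3) R, ‖k y‖) :=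
    (ofReal_integral_norm_eq_lintegral_enorm hloc).symm
  have hN0 : 0 ≤ ∫ y in Metric.ball (0 : R3) R, ‖k y‖ := integral_nonneg fun y => norm_nonneg _
  generalize (∫ y in Metric.ball (0 : R3) R, ‖k y‖) = N at hN hN0
  refine ⟨N + K * J * R ^ (2 - α) + K * R ^ (-(α + 1)), hk, by positivity, hR, fun s hs => ?_,
    fun s hs y hy => ?_⟩
  · have hs0 : 0 < s := by linarith
    calc ∫⁻ y in Metric.ball (0 : R3) (R * s), ‖k y‖ₑ
        ≤ ∫⁻ y in Metric.ball (0 : R3) (R * s), ((Metric.ball (0 : R3) R).indicator (fun y => ‖k y‖ₑ) y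
          + ENNReal.ofReal K * ENNReal.ofReal (‖y‖ ^ (-(α + 1)))) := by
          refine lintegral_mono fun y => ?_
          by_cases hy : y ∈ Metric.ball (0 : R3) R
          · rw [indicator_of_mem hy]
            exact le_add_right le_rfl
          · rw [← ENNReal.ofReal_mul hK.le, ← ofReal_norm]
            exact le_add_left (ENNReal.ofReal_le_ofReal (hfar y (by simpa using hy)))
      _ ≤ ENNReal.ofReal N + ENNReal.ofReal K * ENNReal.ofReal (J * (R * s) ^ (2 - α)) := by
          have hm : Measurable fun y : R3 => ENNReal.ofReal (‖y‖ ^ (-(α + 1))) :=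
            (measurable_norm.pow_const _).ennreal_ofReal
          rw [lintegral_add_right _ (hm.const_mul _), lintegral_const_mul _ hm]
          gcongr
          · refine (setLIntegral_le_lintegral _ _).trans_eq ?_
            rw [lintegral_indicator measurableSet_ball, hN]
          · have := hJ (R * s) (by positivity)
            rwa [show 3 - (α + 1) = 2 - α by ring] at this
      _ ≤ _ := by
          rw [← ENNReal.ofReal_mul hK.le, ← ENNReal.ofReal_add hN0 (by positivity)]
          refine ENNReal.ofReal_le_ofReal ?_
          rw [Real.mul_rpow hR.le hs0.le]
          have h1 : 1 ≤ s ^ (2 - α) := Real.one_le_rpow hs (by linarith)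
          have h2 : 0 ≤ K * R ^ (-(α + 1)) := by positivity
          have h3 : N ≤ N * s ^ (2 - α) := le_mul_of_one_le_right hN0 h1
          have h4 := mul_nonneg h2 (zero_le_one.trans h1)
          calc _ ≤ N * s ^ (2 - α) + K * (J * (R ^ (2 - α) * s ^ (2 - α)))
                + K * R ^ (-(α + 1)) * s ^ (2 - α) := by linarith
            _ = _ := by ring
  · have hs0 : 0 < s := by linarith
    have hy1 : R ≤ ‖y‖ := le_trans (by nlinarith) hy
    refine (hfar y hy1).trans ?_
    have h1 : ‖y‖ ^ (-(α + 1)) ≤ (R * s) ^ (-(α + 1)) :=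
      Real.rpow_le_rpow_of_nonpos (by positivity) hy (by linarith)
    rw [Real.mul_rpow hR.le hs0.le] at h1
    have h2 : 0 ≤ (N + K * J * R ^ (2 - α)) * s ^ (-(α + 1)) := by positivity
    calc _ ≤ K * (R ^ (-(α + 1)) * s ^ (-(α + 1))) := by gcongr
      _ ≤ (N + K * J * R ^ (2 - α)) * s ^ (-(α + 1))
          + K * (R ^ (-(α + 1)) * s ^ (-(α + 1))) := le_add_of_nonneg_left h2
      _ = _ := by ring

/-- A short-range gradient agrees almost everywhere with a kernel. -/
lemma IsShortRange.exists_isKernel {α : ℝ} (hα1 : 1 < α) (hα2 : α < 2) {w : R3 → ℝ}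
    {gradw : R3 → R3} (hw : IsShortRange α w gradw) :
    ∃ (k : R3 → R3) (A R : ℝ), IsKernel α A R k ∧ gradw =ᵐ[volume] k := by
  obtain ⟨K, hK, R, hR, hdec⟩ := hw.decay
  have hloc := hw.isWeakGradient.locallyIntegrable_grad
  have hmeas := hloc.aestronglyMeasurable
  set k0 := hmeas.mk gradw with hk0
  have hk0m : Measurable k0 := hmeas.stronglyMeasurable_mk.measurable
  have hk0ae : gradw =ᵐ[volume] k0 := hmeas.ae_eq_mk
  -- The decay is known only almost everywhere. Setting a measurable representative to zero where
  -- the bound fails makes it hold at every point.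
  set B : Set R3 := {x | R ≤ ‖x‖ → ‖k0 x‖ ≤ K * ‖x‖ ^ (-(α + 1))} with hB
  have hBm : MeasurableSet B := by
    have h1 : MeasurableSet {x : R3 | R ≤ ‖x‖} := measurableSet_le measurable_const measurable_norm
    have h2 : MeasurableSet {x : R3 | ‖k0 x‖ ≤ K * ‖x‖ ^ (-(α + 1))} :=
      measurableSet_le hk0m.norm ((measurable_norm.pow_const _).const_mul _)
    have h3 := h1.compl.union h2
    convert h3 using 1
    ext x
    simp [hB, imp_iff_not_or]
  have hae : gradw =ᵐ[volume] B.indicator k0 := by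
    filter_upwards [hk0ae, hdec] with x hx1 hx2
    have : x ∈ B := fun hx => by rw [← hx1]; exact (hx2 hx).2
    rw [indicator_of_mem this, hx1]
  obtain ⟨A, hA⟩ := Vlasov.exists_isKernel hα1 hα2 (hk0m.indicator hBm) hK hR
    (((hloc.integrableOn_isCompact (isCompact_closedBall 0 R)).mono_set
      Metric.ball_subset_closedBall).congr (ae_restrict_of_ae hae)) (fun x hx => by
        by_cases hxB : x ∈ B
        · rw [indicator_of_mem hxB]; exact hxB hx
        · rw [indicator_of_notMem hxB, norm_zero]; positivity)
  exact ⟨_, A, R, hA, hae⟩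

lemma ae_comp_sub_fst {k k' : R3 → R3} (h : k =ᵐ[volume] k') (x : R3) :
    ∀ᵐ z : Phase, k (x - z.1) = k' (x - z.1) := by
  have h1 : ∀ᵐ y : R3, k (x - y) = k' (x - y) :=
    (Measure.measurePreserving_sub_left volume x).quasiMeasurePreserving.ae h
  exact (Measure.quasiMeasurePreserving_fst (μ := (volume : Measure R3))
    (ν := (volume : Measure R3))).ae h1

/-- The field sees only the almost-everywhere class of ∇w, so the pointwise bounded representative
may replace it throughout. -/
lemma force_congr_kernel {k k' : R3 → R3} (h : k =ᵐ[volume] k') (β : ℝ) (f : Phase → ℝ) :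
    force k β f = force k' β f := by
  funext x
  unfold force
  congr 1
  refine integral_congr_ae ?_
  filter_upwards [ae_comp_sub_fst h x] with z hz
  rw [hz]

lemma IsSolution.congr_kernel {k k' : R3 → R3} (h : k =ᵐ[volume] k') {β : ℝ} {c : ℝ≥0∞}
    {f0 : Phase → ℝ} {f : ℝ → Phase → ℝ} (hf : IsSolution k β c f0 f) :
    IsSolution k' β c f0 f := by
  have e := fun g => force_congr_kernel h β g
  refine ⟨hf.initial, hf.nonneg, hf.contDiff, hf.integrable, fun t ht x => ?_, ?_, ?_, ?_, ?_⟩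
  · refine (hf.integrable_force t ht x).congr ?_
    filter_upwards [ae_comp_sub_fst h x] with z hz
    rw [hz]
  all_goals simp only [← e]
  · exact hf.continuous_force
  · exact hf.differentiable_force
  · exact hf.bounded_force
  · exact hf.equation

/-! ### Field estimates -/

section Field

variable {α A R σ θ β : ℝ} {k : R3 → R3}

/-- Integrability needs only the crude splitting at radius R. Any better bound N for the weight
alone is then inherited by every density it dominates. -/
lemma integrable_smul_kernel_of_le (hk : IsKernel α A R k) {W : Phase → ℝ} (hW : Measurable W)
    {S I : ℝ} (hS0 : 0 ≤ S) (hI0 : 0 ≤ I)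
    (hS : ∀ x, ∫⁻ u, ENNReal.ofReal (W (x, u)) ≤ ENNReal.ofReal S)
    (hI : ∫⁻ z, ENNReal.ofReal (W z) ≤ ENNReal.ofReal I)
    {h : Phase → ℝ} (hm : Measurable h) {δ : ℝ} (hδ : 0 ≤ δ)
    (hle : ∀ z, |h z| ≤ δ * W z) (x : R3) :
    Integrable (fun z : Phase => h z • k (x - z.1)) ∧
    ∀ N, 0 ≤ N → ∫⁻ z : Phase, ENNReal.ofReal (W z) * ‖k (x - z.1)‖ₑ ≤ ENNReal.ofReal N →
      ‖∫ z : Phase, h z • k (x - z.1)‖ ≤ δ * N := by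
  have hkm : Measurable fun z : Phase => k (x - z.1) :=
    hk.measurable.comp (measurable_const.sub measurable_fst)
  have key : ∀ N : ℝ, 0 ≤ N →
      ∫⁻ z : Phase, ENNReal.ofReal (W z) * ‖k (x - z.1)‖ₑ ≤ ENNReal.ofReal N →
      ∫⁻ z : Phase, ‖h z • k (x - z.1)‖ₑ ≤ ENNReal.ofReal (δ * N) := fun N hN hb => by
    calc _ ≤ ∫⁻ z : Phase, ENNReal.ofReal δ * (ENNReal.ofReal (W z) * ‖k (x - z.1)‖ₑ) := by
          refine lintegral_mono fun z => ?_
          rw [enorm_smul, ← mul_assoc, ← ENNReal.ofReal_mul hδ, ← ofReal_norm (h z)]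
          gcongr
          exact hle z
      _ ≤ _ := by
          rw [lintegral_const_mul' _ _ ENNReal.ofReal_ne_top, ENNReal.ofReal_mul hδ]
          gcongr
  have hb := hk.lintegral_le le_rfl hW.ennreal_ofReal hS0 hI0 hS hI x
  have hA := hk.pos
  refine ⟨⟨(hm.smul hkm).aestronglyMeasurable, ?_⟩, fun N hN hN' => ?_⟩
  · exact (key _ (by positivity) hb).trans_lt ENNReal.ofReal_lt_top
  · refine (norm_integral_le_lintegral_norm _).trans ?_
    refine ENNReal.toReal_le_of_le_ofReal (by positivity) ?_
    simpa only [ofReal_norm] using key N hN hN'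

/-- The field estimate in velocity variables: integrability and decay. -/
lemma exists_field_bound_vel (hα2 : α < 2) (hσ : 3 < σ) (hk : IsKernel α A R k) :
    ∃ C : ℝ, 0 < C ∧ ∀ (t : ℝ) (δ : ℝ), 0 ≤ δ → ∀ H : Phase → ℝ, Measurable H →
      (∀ z : Phase, |H z| ≤ δ * weight σ 4 (z.1 - t • z.2, z.2)) → ∀ x : R3,
      Integrable (fun z : Phase => H z • k (x - z.1)) ∧
      ‖∫ z : Phase, H z • k (x - z.1)‖ ≤ C * δ * (1 + |t|) ^ (-(α + 1)) := by
  obtain ⟨C1, hC1, h1⟩ := exists_shifted_weight_bound hσ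
  obtain ⟨C2, hC2, h2⟩ := exists_free_streaming_bound hσ
  have hA := hk.pos
  refine ⟨2 * A * (C1 + C2), by positivity, fun t δ hδ H hH hle x => ?_⟩
  have hsh : Measurable fun u : R3 => t • u := measurable_const_smul t
  obtain ⟨hS, hI⟩ := h1 _ hsh
  have hW : Measurable fun z : Phase => weight σ 4 (z.1 - t • z.2, z.2) :=
    (continuous_weight σ 4).measurable.comp
      ((measurable_fst.sub (hsh.comp measurable_snd)).prodMk measurable_snd)
  obtain ⟨hi, hb⟩ := integrable_smul_kernel_of_le hk hW hC1.le hC1.le hS hI hH hδ hle x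
  refine ⟨hi, ?_⟩
  have ht : 0 < 1 + |t| := by positivity
  refine (hb (2 * A * (C1 + C2) * (1 + |t|) ^ (-(α + 1))) (by positivity) ?_).trans_eq (by ring)
  refine hk.lintegral_le_of_dispersion hα2 hW.ennreal_ofReal (by positivity) (fun y => ?_)
    (hI.trans (ENNReal.ofReal_le_ofReal (by linarith))) x
  refine (h2 t y).trans (ENNReal.ofReal_le_ofReal ?_)
  gcongr
  linarith

lemma measurable_vel (θ : ℝ) : Measurable (vel θ) := (contDiff_vel θ).continuous.measurable

lemma continuous_vel (θ : ℝ) : Continuous (vel θ) := (contDiff_vel θ).continuous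

/-- The field estimate in momentum variables: integrability and decay. -/
lemma exists_field_bound (hα2 : α < 2) (hσ : 3 < σ) (hk : IsKernel α A R k) :
    ∃ C : ℝ, 0 < C ∧ ∀ θ : ℝ, 0 ≤ θ → θ ≤ 1 → ∀ (t : ℝ) (δ : ℝ), 0 ≤ δ →
      ∀ h : Phase → ℝ, Measurable h →
      (∀ z : Phase, |h z| ≤ δ * weight σ 8 (z.1 - t • vel θ z.2, z.2)) → ∀ x : R3,
      Integrable (fun z : Phase => h z • k (x - z.1)) ∧
      ‖∫ z : Phase, h z • k (x - z.1)‖ ≤ C * δ * (1 + |t|) ^ (-(α + 1)) := by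
  obtain ⟨C1, hC1, h1⟩ := exists_shifted_weight_bound hσ
  obtain ⟨C2, hC2, h2⟩ := exists_free_streaming_bound hσ
  have hA := hk.pos
  refine ⟨2 * A * (C1 + 2 ^ 8 * C2), by positivity, fun θ hθ hθ1 t δ hδ h hm hle x => ?_⟩
  have hsh : Measurable fun p : R3 => t • vel θ p := (measurable_vel θ).const_smul t
  have hW8 : Measurable fun z : Phase => weight σ 8 (z.1 - t • vel θ z.2, z.2) :=
    (continuous_weight σ 8).measurable.comp
      ((measurable_fst.sub (hsh.comp measurable_snd)).prodMk measurable_snd)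
  obtain ⟨hS, hI⟩ := h1 _ hsh
  have hmono : ∀ z, ENNReal.ofReal (weight σ 8 z) ≤ ENNReal.ofReal (weight σ 4 z) := fun z =>
    ENNReal.ofReal_le_ofReal (weight_anti (by norm_num) z)
  have hI' : ∫⁻ z : Phase, ENNReal.ofReal (weight σ 8 (z.1 - t • vel θ z.2, z.2))
      ≤ ENNReal.ofReal C1 := (lintegral_mono fun z => hmono _).trans hI
  obtain ⟨hi, hb⟩ := integrable_smul_kernel_of_le hk hW8 hC1.le hC1.le
    (fun y => (lintegral_mono fun z => hmono _).trans (hS y)) hI' hm hδ hle x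
  refine ⟨hi, ?_⟩
  have ht : 0 < 1 + |t| := by positivity
  refine (hb (2 * A * (C1 + 2 ^ 8 * C2) * (1 + |t|) ^ (-(α + 1))) (by positivity) ?_).trans_eq
    (by ring)
  refine hk.lintegral_le_of_dispersion hα2 hW8.ennreal_ofReal (by positivity) (fun y => ?_)
    (hI'.trans (ENNReal.ofReal_le_ofReal (by nlinarith))) x
  -- The only place where momentum and velocity differ is the local density; the total mass is
  -- conserved by any shear.
  refine (lintegral_weight_vel_le hθ hθ1 σ t y).trans ?_
  refine (mul_le_mul_right (h2 t y) _).trans ?_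
  rw [← ENNReal.ofReal_mul (by norm_num), ← mul_assoc]
  refine ENNReal.ofReal_le_ofReal ?_
  gcongr
  linarith

/-- The field in velocity variables. -/
lemma integral_smul_kernel_eq_velDensity (θ t : ℝ) {g : Phase → ℝ} (x : R3)
    (hi : Integrable (fun z : Phase => g (z.1 - t • vel θ z.2, z.2) • k (x - z.1)))
    (hi' : Integrable (fun z : Phase => velDensity θ g (z.1 - t • z.2, z.2) • k (x - z.1))) :
    ∫ z : Phase, g (z.1 - t • vel θ z.2, z.2) • k (x - z.1)
      = ∫ z : Phase, velDensity θ g (z.1 - t • z.2, z.2) • k (x - z.1) := by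
  rw [Measure.volume_eq_prod] at hi hi' ⊢
  rw [integral_prod _ hi, integral_prod _ hi']
  refine integral_congr_ae (Eventually.of_forall fun y => ?_)
  dsimp only
  rw [integral_eq_integral_mom θ]
  refine integral_congr_ae (Eventually.of_forall fun u => ?_)
  dsimp only [velDensity]
  by_cases h : mfac θ u = 0
  · simp [h]
  · rw [vel_mom h, smul_smul]

/-- Joint continuity of the field. -/
lemma continuous_field (hσ : 3 < σ) (hσ4 : σ ≤ 4) (hk : IsKernel α A R k) (θ : ℝ)
    {h : ℝ → Phase → ℝ} (hc : Continuous fun q : ℝ × Phase => h q.1 q.2) {δ : ℝ} (hδ : 0 ≤ δ)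
    (hle : ∀ t z, |h t z| ≤ δ * weight σ 8 (z.1 - t • vel θ z.2, z.2)) :
    Continuous fun q : ℝ × R3 => ∫ z : Phase, h q.1 z • k (q.2 - z.1) := by
  -- The kernel is only measurable, so the dependence on x is moved to the continuous density by a
  -- translation before dominated convergence is applied.
  have e : ∀ q : ℝ × R3, ∫ z : Phase, h q.1 z • k (q.2 - z.1)
      = ∫ z : Phase, h q.1 (q.2 - z.1, z.2) • k z.1 := fun q => by
    have hmp : MeasurePreserving (fun z : Phase => (q.2 - z.1, z.2)) :=
      (Measure.measurePreserving_sub_left volume q.2).prod (MeasurePreserving.id volume)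
    have hemb : MeasurableEmbedding (fun z : Phase => (q.2 - z.1, z.2)) := by
      refine MeasurableEquiv.measurableEmbedding
        ((MeasurableEquiv.subLeft q.2).prodCongr (MeasurableEquiv.refl R3))
    have := hmp.integral_comp hemb (fun z : Phase => h q.1 z • k (q.2 - z.1))
    rw [← this]
    simp
  simp only [e]
  rw [continuous_iff_continuousAt]
  rintro ⟨t0, x0⟩
  obtain ⟨C1, hC1, h1⟩ := exists_shifted_weight_bound hσ
  have hsh : Measurable fun p : R3 => t0 • vel θ p := (measurable_vel θ).const_smul t0
  obtain ⟨hS, hI⟩ := h1 _ hsh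
  have hsh' : Measurable fun z : Phase => (x0 - z.1 - t0 • vel θ z.2, z.2) :=
    ((measurable_const.sub measurable_fst).sub (hsh.comp measurable_snd)).prodMk measurable_snd
  refine continuousAt_of_dominated
    (bound := fun z : Phase => 3 ^ σ * δ * (weight σ 4 (x0 - z.1 - t0 • vel θ z.2, z.2) * ‖k z.1‖))
    (Eventually.of_forall fun q => ?_) ?_ ?_ (Eventually.of_forall fun z => ?_)
  · have hm1 : Measurable fun z : Phase => h q.1 (q.2 - z.1, z.2) :=
      hc.measurable.comp (measurable_const.prodMk
        ((measurable_const.sub measurable_fst).prodMk measurable_snd))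
    exact (hm1.smul (hk.measurable.comp measurable_fst)).aestronglyMeasurable
  · have hnear : ∀ᶠ q : ℝ × R3 in 𝓝 (t0, x0), |q.1 - t0| ≤ 1 ∧ ‖q.2 - x0‖ ≤ 1 := by
      filter_upwards [Metric.closedBall_mem_nhds (t0, x0) one_pos] with q hq
      rw [Metric.mem_closedBall, dist_eq_norm, Prod.norm_def] at hq
      exact ⟨(le_max_left _ _).trans hq, (le_max_right _ _).trans hq⟩
    filter_upwards [hnear] with q hq
    refine Eventually.of_forall fun z => ?_
    rw [norm_smul, Real.norm_eq_abs, ← mul_assoc]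
    gcongr
    refine (hle q.1 _).trans ?_
    rw [mul_comm (3 ^ σ), mul_assoc]
    gcongr
    dsimp only
    have hb := bracket_pos z.2
    have hb1 := one_le_bracket z.2
    -- For (t, x) within distance 1 of (t0, x0), free streaming shifts the position by at most 2⟨p⟩.
    -- This multiplies the spatial weight by at most (3⟨p⟩)^σ, and as σ ≤ 4 four of the eight
    -- momentum powers absorb ⟨p⟩^σ.
    have hd : ‖(x0 - z.1 - t0 • vel θ z.2) - (q.2 - z.1 - q.1 • vel θ z.2)‖ ≤ 2 * bracket z.2 := by
      have : (x0 - z.1 - t0 • vel θ z.2) - (q.2 - z.1 - q.1 • vel θ z.2)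
          = -(q.2 - x0) + (q.1 - t0) • vel θ z.2 := by module
      rw [this]
      refine (norm_add_le _ _).trans ?_
      rw [norm_neg, norm_smul, Real.norm_eq_abs]
      have h3 : ‖vel θ z.2‖ ≤ bracket z.2 := (norm_vel_le θ z.2).trans (norm_le_bracket z.2)
      nlinarith [mul_le_mul hq.1 h3 (norm_nonneg _) zero_le_one, hq.2]
    have h4 : bracket (x0 - z.1 - t0 • vel θ z.2)
        ≤ (3 * bracket z.2) * bracket (q.2 - z.1 - q.1 • vel θ z.2) :=
      (bracket_le_mul hd).trans (mul_le_mul_of_nonneg_right (by linarith) (bracket_pos _).le)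
    have h5 := bracket_rpow_neg_le (by linarith : 0 ≤ σ) (by positivity) h4
    unfold weight
    dsimp only
    have hb2 := bracket_pos (x0 - z.1 - t0 • vel θ z.2)
    have h6 : bracket z.2 ^ σ * (bracket z.2 ^ 8)⁻¹ ≤ (bracket z.2 ^ 4)⁻¹ := by
      rw [← div_eq_mul_inv, div_le_iff₀ (by positivity)]
      have h7 : bracket z.2 ^ σ ≤ bracket z.2 ^ 4 := by
        rw [← Real.rpow_natCast]
        exact Real.rpow_le_rpow_of_exponent_le hb1 (by exact_mod_cast hσ4)
      refine h7.trans_eq ?_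
      field_simp
    rw [Real.mul_rpow (by norm_num) hb.le] at h5
    calc _ ≤ (3 ^ σ * bracket z.2 ^ σ * bracket (x0 - z.1 - t0 • vel θ z.2) ^ (-σ))
          * (bracket z.2 ^ 8)⁻¹ := by gcongr
      _ = 3 ^ σ * bracket (x0 - z.1 - t0 • vel θ z.2) ^ (-σ)
          * (bracket z.2 ^ σ * (bracket z.2 ^ 8)⁻¹) := by ring
      _ ≤ 3 ^ σ * bracket (x0 - z.1 - t0 • vel θ z.2) ^ (-σ) * (bracket z.2 ^ 4)⁻¹ := by gcongr
      _ = _ := by ring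
  · refine Integrable.const_mul ?_ _
    have hW : Measurable fun z : Phase => weight σ 4 (z.1 - t0 • vel θ z.2, z.2) :=
      (continuous_weight σ 4).measurable.comp
        ((measurable_fst.sub (hsh.comp measurable_snd)).prodMk measurable_snd)
    have hi := (integrable_smul_kernel_of_le hk hW hC1.le hC1.le hS hI hW zero_le_one
      (fun z => by rw [one_mul, abs_of_nonneg (weight_nonneg _ _ _)]) x0).1.norm
    have hmp : MeasurePreserving (fun z : Phase => (x0 - z.1, z.2)) :=
      (Measure.measurePreserving_sub_left volume x0).prod (MeasurePreserving.id volume)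
    refine ((hmp.integrable_comp hi.aestronglyMeasurable).2 hi).congr
      (Eventually.of_forall fun z => ?_)
    simp [norm_smul, abs_of_nonneg (weight_nonneg _ _ _)]
  · have hc1 : Continuous fun q : ℝ × R3 => h q.1 (q.2 - z.1, z.2) :=
      hc.comp (continuous_fst.prodMk
        ((continuous_snd.sub continuous_const).prodMk continuous_const))
    exact (hc1.smul continuous_const).continuousAt

end Field

end Vlasov

end

noncomputable section

namespace Vlasov

/-! ### Grönwall's inequality with time-dependent coefficients -/

section ODE

variable {V : Type*} [NormedAddCommGroup V] [NormedSpace ℝ V]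

/-- The right-hand side, with an added term ε(s - a), is a strict barrier: where ‖f‖ meets it, the
barrier grows faster, since r ≤ r exp(L(s) - L(a)). Then ε tends to 0. -/
lemma gronwall_forward {f f' : ℝ → V} {a b : ℝ} (hf : ContinuousOn f (Icc a b))
    (hf' : ∀ s ∈ Ico a b, HasDerivWithinAt f (f' s) (Ici s) s) {l L r R : ℝ → ℝ}
    (hl : ∀ s, 0 ≤ l s) (hL : ∀ s, HasDerivAt L (l s) s) (hr : ∀ s, 0 ≤ r s)
    (hR : ∀ s, HasDerivAt R (r s) s) (hb : ∀ s ∈ Ico a b, ‖f' s‖ ≤ l s * ‖f s‖ + r s)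
    {t : ℝ} (ht : t ∈ Icc a b) : ‖f t‖ ≤ (‖f a‖ + (R t - R a)) * Real.exp (L t - L a) := by
  have hLm : Monotone L := monotone_of_hasDerivAt_nonneg hL hl
  have key : ∀ ε > 0, ‖f t‖ ≤ (‖f a‖ + (R t - R a) + ε * (t - a)) * Real.exp (L t - L a) := by
    intro ε hε
    have hB : ∀ s, HasDerivAt
        (fun s => (‖f a‖ + (R s - R a) + ε * (s - a)) * Real.exp (L s - L a))
        ((r s + ε) * Real.exp (L s - L a)
          + (‖f a‖ + (R s - R a) + ε * (s - a)) * (Real.exp (L s - L a) * l s)) s := fun s => by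
      have h1 : HasDerivAt (fun s => ‖f a‖ + (R s - R a) + ε * (s - a)) (r s + ε) s := by
        have := (((hR s).sub_const (R a)).const_add ‖f a‖).add
          (((hasDerivAt_id s).sub_const a).const_mul ε)
        exact this.congr_deriv (by simp)
      exact h1.mul ((hL s).sub_const (L a)).exp
    refine image_norm_le_of_norm_deriv_right_lt_deriv_boundary hf hf' (by simp) hB
      (fun s hs he => ?_) ht
    refine (hb s hs).trans_lt ?_
    rw [he]
    have h1 : 1 ≤ Real.exp (L s - L a) := Real.one_le_exp (sub_nonneg.2 (hLm hs.1))
    have h2 : 0 < (r s + ε) * Real.exp (L s - L a) - r s := by nlinarith [hr s]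
    linarith
  refine le_of_forall_pos_le_add fun η hη => ?_
  have hta : 0 ≤ t - a := sub_nonneg.2 ht.1
  set c := (t - a) * Real.exp (L t - L a) with hc
  have hc0 : 0 ≤ c := by positivity
  refine (key (η / (c + 1)) (by positivity)).trans ?_
  have h3 : η / (c + 1) * c ≤ η := by
    rw [div_mul_eq_mul_div, div_le_iff₀ (by positivity)]
    nlinarith
  calc _ = (‖f a‖ + (R t - R a)) * Real.exp (L t - L a) + η / (c + 1) * c := by rw [hc]; ring
    _ ≤ _ := by linarith

/-- Two-sided Grönwall inequality. -/
lemma gronwall_uIcc {f f' : ℝ → V} {a t : ℝ} (hf : ∀ s ∈ uIcc a t, HasDerivAt f (f' s) s)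
    {l L r R : ℝ → ℝ}
    (hl : ∀ s, 0 ≤ l s) (hL : ∀ s, HasDerivAt L (l s) s) (hr : ∀ s, 0 ≤ r s)
    (hR : ∀ s, HasDerivAt R (r s) s) (hb : ∀ s ∈ uIcc a t, ‖f' s‖ ≤ l s * ‖f s‖ + r s) :
    ‖f t‖ ≤ (‖f a‖ + |R t - R a|) * Real.exp |L t - L a| := by
  have hLm : Monotone L := monotone_of_hasDerivAt_nonneg hL hl
  have hRm : Monotone R := monotone_of_hasDerivAt_nonneg hR hr
  rcases le_total a t with h | h
  · rw [uIcc_of_le h] at hb hf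
    rw [abs_of_nonneg (sub_nonneg.2 (hLm h)), abs_of_nonneg (sub_nonneg.2 (hRm h))]
    exact gronwall_forward (fun s hs => (hf s hs).continuousAt.continuousWithinAt)
      (fun s hs => (hf s (Ico_subset_Icc_self hs)).hasDerivWithinAt) hl hL hr hR
      (fun s hs => hb s (Ico_subset_Icc_self hs)) (right_mem_Icc.2 h)
  · rw [uIcc_of_ge h] at hb hf
    rw [abs_of_nonpos (sub_nonpos.2 (hLm h)), abs_of_nonpos (sub_nonpos.2 (hRm h))]
    -- Backward in time, the forward inequality is applied to s ↦ f(-s), with primitives -L(-s) and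
    -- -R(-s).
    have hrefl : ∀ {g g' : ℝ → ℝ}, (∀ s, HasDerivAt g (g' s) s) →
        ∀ s, HasDerivAt (fun s => -g (-s)) (g' (-s)) s := fun hg s => by
      have := ((hg (-s)).comp s (hasDerivAt_neg s)).neg
      exact this.congr_deriv (by simp)
    have hmem : ∀ s ∈ Icc (-a) (-t), -s ∈ Icc t a := fun s hs =>
      ⟨by linarith [hs.2], by linarith [hs.1]⟩
    have hf2 : ∀ s ∈ Icc (-a) (-t), HasDerivAt (fun s => f (-s)) (-f' (-s)) s := fun s hs => by
      have := (hf (-s) (hmem s hs)).scomp s (hasDerivAt_neg s)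
      exact this.congr_deriv (by simp)
    have := gronwall_forward (f := fun s => f (-s)) (a := -a) (b := -t) (t := -t)
      (fun s hs => (hf2 s hs).continuousAt.continuousWithinAt)
      (fun s hs => (hf2 s (Ico_subset_Icc_self hs)).hasDerivWithinAt) (fun s => hl (-s)) (hrefl hL)
      (fun s => hr (-s)) (hrefl hR) (fun s hs => by
        rw [norm_neg]
        exact hb (-s) (hmem s (Ico_subset_Icc_self hs))) (right_mem_Icc.2 (by linarith))
    simp only [neg_neg] at this
    convert this using 3
    · ring
    · ring

lemma gronwall_two_sided {f f' : ℝ → V} {a t : ℝ} (hf : ∀ s, HasDerivAt f (f' s) s)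
    {l L r R : ℝ → ℝ}
    (hl : ∀ s, 0 ≤ l s) (hL : ∀ s, HasDerivAt L (l s) s) (hr : ∀ s, 0 ≤ r s)
    (hR : ∀ s, HasDerivAt R (r s) s) (hb : ∀ s ∈ uIcc a t, ‖f' s‖ ≤ l s * ‖f s‖ + r s) :
    ‖f t‖ ≤ (‖f a‖ + |R t - R a|) * Real.exp |L t - L a| :=
  gronwall_uIcc (fun s _ => hf s) hl hL hr hR hb

/-! ### Global flows of bounded Lipschitz vector fields -/

/-- A continuous time-dependent vector field, bounded by `B` and Lipschitz with constant `K`. -/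
structure IsBoundedLipschitz (K : NNReal) (B : ℝ) (b : ℝ → V → V) : Prop where
  continuous : Continuous fun q : ℝ × V => b q.1 q.2
  lipschitz : ∀ t, LipschitzWith K (b t)
  bound : ∀ t z, ‖b t z‖ ≤ B

variable [CompleteSpace V] {K : NNReal} {B : ℝ} {b : ℝ → V → V}

/-- A globally bounded field cannot leave the ball of radius BT during time T, so the
Picard–Lindelöf theorem applies on an interval of any length. -/
lemma IsBoundedLipschitz.exists_solution_Icc (hb : IsBoundedLipschitz K B b) (t₀ : ℝ) (z : V)
    {T : ℝ} (hT : 0 < T) : ∃ Z : ℝ → V, Z t₀ = z ∧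
      ∀ s ∈ Ioo (t₀ - T) (t₀ + T), HasDerivAt Z (b s (Z s)) s := by
  have hB : 0 ≤ B := (norm_nonneg _).trans (hb.bound 0 z)
  have hpl : IsPicardLindelof b (tmin := t₀ - T) (tmax := t₀ + T)
      ⟨t₀, by constructor <;> linarith⟩ z (⟨B, hB⟩ * ⟨T, hT.le⟩) 0 ⟨B, hB⟩ K := by
    refine ⟨fun t _ => (hb.lipschitz t).lipschitzOnWith, fun x _ => ?_, fun t _ x _ => hb.bound t x,
      ?_⟩
    · exact (hb.continuous.comp (continuous_id.prodMk continuous_const)).continuousOn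
    · simp only [add_sub_cancel_left, sub_sub_cancel, max_self, NNReal.coe_zero, sub_zero]
      exact le_rfl
  obtain ⟨Z, hZ0, hZ⟩ := hpl.exists_eq_forall_mem_Icc_hasDerivWithinAt₀
  exact ⟨Z, hZ0, fun s hs => (hZ s (Ioo_subset_Icc_self hs)).hasDerivAt (Icc_mem_nhds hs.1 hs.2)⟩

lemma IsBoundedLipschitz.exists_solution (hb : IsBoundedLipschitz K B b) (t₀ : ℝ) (z : V) :
    ∃ Z : ℝ → V, Z t₀ = z ∧ ∀ s, HasDerivAt Z (b s (Z s)) s := by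
  have hex := fun n : ℕ => hb.exists_solution_Icc t₀ z (T := n + 1) (by positivity)
  choose Z hZ0 hZ using hex
  have hmem : ∀ n : ℕ, t₀ ∈ Ioo (t₀ - (n + 1 : ℝ)) (t₀ + (n + 1)) := fun n => by
    have : (0 : ℝ) < n + 1 := by positivity
    constructor <;> linarith
  have hsub : ∀ {n m : ℕ}, n ≤ m →
      Ioo (t₀ - (n + 1 : ℝ)) (t₀ + (n + 1)) ⊆ Ioo (t₀ - (m + 1 : ℝ)) (t₀ + (m + 1)) := by
    intro n m h
    have : (n : ℝ) ≤ m := by exact_mod_cast h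
    exact Ioo_subset_Ioo (by linarith) (by linarith)
  have huniq : ∀ {n m : ℕ}, n ≤ m →
      EqOn (Z n) (Z m) (Ioo (t₀ - (n + 1 : ℝ)) (t₀ + (n + 1))) := fun {n m} h =>
    ODE_solution_unique_of_mem_Ioo (v := b) (s := fun _ => univ) (K := K)
      (fun t _ => (hb.lipschitz t).lipschitzOnWith) (hmem n)
      (fun t ht => ⟨hZ n t ht, mem_univ _⟩) (fun t ht => ⟨hZ m t (hsub h ht), mem_univ _⟩)
      ((hZ0 n).trans (hZ0 m).symm)
  -- The local solutions agree where both are defined. The one of index n lives on an interval of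
  -- radius n + 1, so each time s is interior to the domain of the solution chosen there.
  refine ⟨fun s => Z ⌈|s - t₀|⌉₊ s, hZ0 _, fun s => ?_⟩
  set N := ⌈|s - t₀|⌉₊ with hN
  have hs : s ∈ Ioo (t₀ - (N + 1 : ℝ)) (t₀ + (N + 1)) := by
    have h1 : |s - t₀| ≤ N := Nat.le_ceil _
    obtain ⟨h2, h3⟩ := abs_le.1 h1
    constructor <;> linarith
  have hin : ∀ u : ℝ, u ∈ Ioo (t₀ - ((⌈|u - t₀|⌉₊ : ℝ) + 1)) (t₀ + ((⌈|u - t₀|⌉₊ : ℝ) + 1)) := by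
    intro u
    have h1 : |u - t₀| ≤ ⌈|u - t₀|⌉₊ := Nat.le_ceil _
    obtain ⟨h2, h3⟩ := abs_le.1 h1
    constructor <;> linarith
  have heq : (fun u => Z ⌈|u - t₀|⌉₊ u) =ᶠ[𝓝 s] Z N := by
    filter_upwards [isOpen_Ioo.mem_nhds hs] with u hu
    rcases le_total ⌈|u - t₀|⌉₊ N with h | h
    · exact huniq h (hin u)
    · exact (huniq h hu).symm
  exact ((hZ N s hs).congr_of_eventuallyEq heq)

open Classical in
/-- The global flow of a vector field: `odeFlow b t z s` is the value at time `s` of the solution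
through `z` at time `t`. -/
def odeFlow (b : ℝ → V → V) (t : ℝ) (z : V) (s : ℝ) : V :=
  if h : ∃ Z : ℝ → V, Z t = z ∧ ∀ s, HasDerivAt Z (b s (Z s)) s then h.choose s else z

namespace IsBoundedLipschitz

lemma flow_self (hb : IsBoundedLipschitz K B b) (t : ℝ) (z : V) : odeFlow b t z t = z := by
  have h := hb.exists_solution t z
  rw [odeFlow, dif_pos h]
  exact h.choose_spec.1

lemma hasDerivAt_flow (hb : IsBoundedLipschitz K B b) (t : ℝ) (z : V) (s : ℝ) :
    HasDerivAt (odeFlow b t z) (b s (odeFlow b t z s)) s := by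
  have h := hb.exists_solution t z
  have e : odeFlow b t z = h.choose := by
    funext s
    rw [odeFlow, dif_pos h]
  rw [e]
  exact h.choose_spec.2 s

lemma eq_flow (hb : IsBoundedLipschitz K B b) {Z : ℝ → V} (hZ : ∀ s, HasDerivAt Z (b s (Z s)) s)
    (t : ℝ) : Z = odeFlow b t (Z t) :=
  ODE_solution_unique_univ (v := b) (s := fun _ => univ) (K := K) (t₀ := t)
    (fun t => (hb.lipschitz t).lipschitzOnWith) (fun s => ⟨hZ s, mem_univ _⟩)
    (fun s => ⟨hb.hasDerivAt_flow t (Z t) s, mem_univ _⟩) (hb.flow_self t (Z t)).symm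

lemma flow_flow (hb : IsBoundedLipschitz K B b) (t s r : ℝ) (z : V) :
    odeFlow b s (odeFlow b t z s) r = odeFlow b t z r :=
  (congrFun (hb.eq_flow (hb.hasDerivAt_flow t z) s) r).symm

lemma norm_flow_sub_le (hb : IsBoundedLipschitz K B b) (t s : ℝ) (z : V) :
    ‖odeFlow b t z s - z‖ ≤ B * |s - t| := by
  have h := convex_univ.norm_image_sub_le_of_norm_hasDerivWithin_le
    (fun r _ => (hb.hasDerivAt_flow t z r).hasDerivWithinAt) (fun r _ => hb.bound r _)
    (mem_univ t) (mem_univ s)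
  rwa [hb.flow_self, Real.norm_eq_abs] at h

lemma norm_flow_sub_flow_le (hb : IsBoundedLipschitz K B b) (t s : ℝ) (z z' : V) :
    ‖odeFlow b t z s - odeFlow b t z' s‖ ≤ ‖z - z'‖ * Real.exp (K * |s - t|) := by
  have h := gronwall_two_sided (f := fun s => odeFlow b t z s - odeFlow b t z' s) (a := t) (t := s)
    (l := fun _ => K) (L := fun s => K * s) (r := fun _ => 0) (R := fun _ => 0)
    (fun s => (hb.hasDerivAt_flow t z s).sub (hb.hasDerivAt_flow t z' s))
    (fun _ => K.2) (fun s => by simpa using (hasDerivAt_id s).const_mul (K : ℝ)) (fun _ => le_rfl)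
    (fun s => hasDerivAt_const s 0)
    (fun s _ => by rw [add_zero]; exact (hb.lipschitz s).norm_sub_le _ _)
  simp only [hb.flow_self, sub_self, abs_zero, add_zero, ← mul_sub, abs_mul, NNReal.abs_eq] at h
  exact h

lemma norm_flow_sub_flow_le' (hb : IsBoundedLipschitz K B b) (t t' s : ℝ) (z z' : V) :
    ‖odeFlow b t z s - odeFlow b t' z' s‖
      ≤ (‖z - z'‖ + B * |t - t'|) * Real.exp (K * |s - t|) := by
  rw [← hb.flow_flow t' t s z']
  refine (hb.norm_flow_sub_flow_le t s _ _).trans ?_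
  gcongr
  calc _ = ‖(z - z') - (odeFlow b t' z' t - z')‖ := by congr 1; abel
    _ ≤ _ := (norm_sub_le _ _).trans (by gcongr; exact hb.norm_flow_sub_le _ _ _)

lemma continuous_flow (hb : IsBoundedLipschitz K B b) (s : ℝ) :
    Continuous fun q : ℝ × V => odeFlow b q.1 q.2 s := by
  rw [continuous_iff_continuousAt]
  rintro ⟨t, z⟩
  rw [ContinuousAt, tendsto_iff_norm_sub_tendsto_zero]
  have hlim : Tendsto (fun q : ℝ × V => (‖q.2 - z‖ + B * |q.1 - t|) * Real.exp (K * |s - q.1|))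
      (𝓝 (t, z)) (𝓝 0) := by
    have : Continuous fun q : ℝ × V => (‖q.2 - z‖ + B * |q.1 - t|) * Real.exp (K * |s - q.1|) := by
      fun_prop
    have h := this.tendsto (t, z)
    simpa using h
  exact squeeze_zero (fun _ => norm_nonneg _) (fun q => hb.norm_flow_sub_flow_le' _ _ _ _ _) hlim

/-- A one-sided solution on `[0, ∞)` coincides with the flow. -/
lemma eq_flow_of_forward (hb : IsBoundedLipschitz K B b) {T : ℝ} {Z : ℝ → V}
    (hc : ContinuousOn Z (Icc 0 T))
    (hZ : ∀ s ∈ Ico 0 T, HasDerivWithinAt Z (b s (Z s)) (Ici s) s) {t : ℝ} (ht : t ∈ Icc 0 T) :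
    Z t = odeFlow b 0 (Z 0) t :=
  ODE_solution_unique hb.lipschitz hc hZ
    (fun s _ => (hb.hasDerivAt_flow 0 (Z 0) s).continuousAt.continuousWithinAt)
    (fun s _ => (hb.hasDerivAt_flow 0 (Z 0) s).hasDerivWithinAt) (hb.flow_self 0 (Z 0)).symm ht

end IsBoundedLipschitz

end ODE

end Vlasov

end

noncomputable section

namespace Vlasov

/-! ### The primitive of the decay rate -/

section Decay

variable {α : ℝ}

lemma continuous_decay (a : ℝ) : Continuous fun r : ℝ => (1 + |r|) ^ a :=
  (continuous_const.add continuous_abs).rpow_const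
    fun r => Or.inl (add_pos_of_pos_of_nonneg one_pos (abs_nonneg r)).ne'

/-- The primitive of `(1 + |t|)^{-α}`. -/
def decayPrim (α t : ℝ) : ℝ := ∫ r in (0 : ℝ)..t, (1 + |r|) ^ (-α)

/-- The total integral of `(1 + |t|)^{-α}`. -/
def totalDecay (α : ℝ) : ℝ := ∫ r : ℝ, (1 + |r|) ^ (-α)

lemma hasDerivAt_decayPrim (α s : ℝ) : HasDerivAt (decayPrim α) ((1 + |s|) ^ (-α)) s :=
  ((continuous_decay (-α)).integral_hasStrictDerivAt 0 s).hasDerivAt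

lemma totalDecay_nonneg (α : ℝ) : 0 ≤ totalDecay α := integral_nonneg fun r => by positivity

lemma integrable_decay (hα : 1 < α) : Integrable fun r : ℝ => (1 + |r|) ^ (-α) := by
  have := integrable_one_add_norm (E := ℝ) (μ := volume) (r := α) (by simpa using hα)
  simpa using this

lemma decayPrim_sub (α s t : ℝ) :
    decayPrim α t - decayPrim α s = ∫ r in s..t, (1 + |r|) ^ (-α) :=
  intervalIntegral.integral_interval_sub_left
    ((continuous_decay (-α)).intervalIntegrable _ _) ((continuous_decay (-α)).intervalIntegrable _ _)

lemma abs_decayPrim_sub_le (hα : 1 < α) (s t : ℝ) :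
    |decayPrim α t - decayPrim α s| ≤ totalDecay α := by
  rw [decayPrim_sub]
  rw [← Real.norm_eq_abs]
  refine intervalIntegral.norm_integral_le_integral_norm_uIoc.trans ?_
  simp only [Real.norm_eq_abs]
  have h1 : ∀ r : ℝ, |(1 + |r|) ^ (-α)| = (1 + |r|) ^ (-α) := fun r =>
    abs_of_nonneg (by positivity)
  simp only [h1]
  exact setIntegral_le_integral (integrable_decay hα) (Eventually.of_forall fun r => by positivity)

lemma exists_tendsto_decayPrim (hα : 1 < α) :
    ∃ l, Tendsto (decayPrim α) atTop (𝓝 l) :=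
  ⟨_, intervalIntegral_tendsto_integral_Ioi 0 (integrable_decay hα).integrableOn tendsto_id⟩

lemma decay_le_one {a : ℝ} (ha : 0 ≤ a) (t : ℝ) : (1 + |t|) ^ (-a) ≤ 1 :=
  Real.rpow_le_one_of_one_le_of_nonpos (by linarith [abs_nonneg t]) (by linarith)

lemma decay_mul (a t : ℝ) : (1 + |t|) * (1 + |t|) ^ (-(a + 1)) = (1 + |t|) ^ (-a) := by
  have h : 0 < 1 + |t| := by positivity
  nth_rw 1 [← Real.rpow_one (1 + |t|)]
  rw [← Real.rpow_add h]
  congr 1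
  ring

lemma decay_mono {a b : ℝ} (h : a ≤ b) (t : ℝ) : (1 + |t|) ^ (-b) ≤ (1 + |t|) ^ (-a) :=
  Real.rpow_le_rpow_of_exponent_le (by linarith [abs_nonneg t]) (by linarith)

end Decay

/-! ### The characteristic system in free-streaming coordinates -/

/-- A continuous force field, Lipschitz in space, with the decay rates of a dispersing solution. -/
structure IsField (α M : ℝ) (E : ℝ → R3 → R3) : Prop where
  continuous : Continuous fun q : ℝ × R3 => E q.1 q.2
  bound : ∀ t x, ‖E t x‖ ≤ M * (1 + |t|) ^ (-(α + 1))
  lip : ∀ t x y, ‖E t x - E t y‖ ≤ M * (1 + |t|) ^ (-(α + 2)) * ‖x - y‖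

/-- The vector field of the characteristic system in the coordinates `(x - t v(p), p)`. -/
def waveField (θ : ℝ) (E : ℝ → R3 → R3) (t : ℝ) (z : Phase) : Phase :=
  (-(t • dvel θ z.2 (E t (z.1 + t • vel θ z.2))), E t (z.1 + t • vel θ z.2))

/-- The two-parameter characteristic flow in the coordinates `(x - t v(p), p)`. -/
def waveFlow (θ : ℝ) (E : ℝ → R3 → R3) (t : ℝ) (z : Phase) (s : ℝ) : Phase :=
  odeFlow (waveField θ E) t z s

section WaveFlow

variable {α M θ : ℝ} {E : ℝ → R3 → R3}

lemma continuous_dvel (θ : ℝ) : Continuous (dvel θ) := by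
  have h := (contDiff_vel θ).continuous_fderiv (by simp)
  have e : fderiv ℝ (vel θ) = dvel θ := funext fun p => (hasFDerivAt_vel θ p).fderiv
  rwa [e] at h

lemma IsField.nonneg (hE : IsField α M E) : 0 ≤ M := by
  have := (norm_nonneg _).trans (hE.bound 0 0)
  simpa using this

lemma IsField.mono {M' : ℝ} (hE : IsField α M E) (h : M ≤ M') : IsField α M' E :=
  ⟨hE.continuous, fun t x => (hE.bound t x).trans (by gcongr),
    fun t x y => (hE.lip t x y).trans (by gcongr)⟩

lemma IsField.continuous_waveField (hE : IsField α M E) (θ : ℝ) :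
    Continuous fun q : ℝ × Phase => waveField θ E q.1 q.2 := by
  have h1 : Continuous fun q : ℝ × Phase => E q.1 (q.2.1 + q.1 • vel θ q.2.2) :=
    hE.continuous.comp (continuous_fst.prodMk
      ((continuous_fst.comp continuous_snd).add (continuous_fst.smul
        ((continuous_vel θ).comp (continuous_snd.comp continuous_snd)))))
  have h2 : Continuous fun q : ℝ × Phase => dvel θ q.2.2 :=
    (continuous_dvel θ).comp (continuous_snd.comp continuous_snd)
  exact ((continuous_fst.smul (h2.clm_apply h1)).neg).prodMk h1

lemma abs_le_one_add_abs (t : ℝ) : |t| ≤ 1 + |t| := by linarith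

/-- The factor t in the first component uses up one power of decay; what remains, (1+|t|)^{-α}, is
integrable for α > 1. -/
lemma IsField.norm_waveField_le (hE : IsField α M E) (hθ : 0 ≤ θ) (t : ℝ) (z : Phase) :
    ‖waveField θ E t z‖ ≤ 2 * M * (1 + |t|) ^ (-α) := by
  have hM := hE.nonneg
  have h1 := hE.bound t (z.1 + t • vel θ z.2)
  have h0 : 0 ≤ M * (1 + |t|) ^ (-α) := by positivity
  rw [waveField, norm_prod_le_iff, norm_neg, norm_smul, Real.norm_eq_abs]
  constructor
  · calc _ ≤ (1 + |t|) * (2 * (M * (1 + |t|) ^ (-(α + 1)))) := by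
          gcongr
          · exact abs_le_one_add_abs t
          · exact (ContinuousLinearMap.le_opNorm _ _).trans (by gcongr; exact norm_dvel_le hθ _)
      _ = 2 * M * ((1 + |t|) * (1 + |t|) ^ (-(α + 1))) := by ring
      _ = _ := by rw [decay_mul]
  · refine h1.trans ?_
    have := decay_mono (show α ≤ α + 1 by linarith) t
    nlinarith [mul_le_mul_of_nonneg_left this hM]

/-- Passing from free-streaming coordinates to positions expands distances by O(1+|t|), which the
additional power in the Lipschitz rate of the field compensates. -/
lemma IsField.norm_comp_sub_le (hE : IsField α M E) (hθ : 0 ≤ θ) (t : ℝ) (z z' : Phase) :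
    ‖E t (z.1 + t • vel θ z.2) - E t (z'.1 + t • vel θ z'.2)‖
      ≤ 2 * M * (1 + |t|) ^ (-(α + 1)) * ‖z - z'‖ := by
  have hM := hE.nonneg
  refine (hE.lip t _ _).trans ?_
  have h1 : ‖(z.1 + t • vel θ z.2) - (z'.1 + t • vel θ z'.2)‖ ≤ 2 * (1 + |t|) * ‖z - z'‖ := by
    have e : (z.1 + t • vel θ z.2) - (z'.1 + t • vel θ z'.2)
        = (z - z').1 + t • (vel θ z.2 - vel θ z'.2) := by
      rw [Prod.fst_sub]; module
    rw [e]
    refine (norm_add_le _ _).trans ?_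
    rw [norm_smul, Real.norm_eq_abs]
    have h2 := norm_fst_le (z - z')
    have h3 : ‖vel θ z.2 - vel θ z'.2‖ ≤ 2 * ‖z - z'‖ :=
      (norm_vel_sub_le hθ _ _).trans (by gcongr; exact norm_snd_le (z - z'))
    nlinarith [mul_le_mul_of_nonneg_left h3 (abs_nonneg t), norm_nonneg (z - z')]
  have e2 := decay_mul (α + 1) t
  rw [show α + 1 + 1 = α + 2 by ring] at e2
  calc _ ≤ M * (1 + |t|) ^ (-(α + 2)) * (2 * (1 + |t|) * ‖z - z'‖) := by gcongr
    _ = 2 * M * ((1 + |t|) * (1 + |t|) ^ (-(α + 2))) * ‖z - z'‖ := by ring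
    _ = _ := by rw [e2]

lemma IsField.norm_waveField_sub_le (hE : IsField α M E) (hθ : 0 ≤ θ) (hθ1 : θ ≤ 1) (t : ℝ)
    (z z' : Phase) :
    ‖waveField θ E t z - waveField θ E t z'‖ ≤ 10 * M * (1 + |t|) ^ (-α) * ‖z - z'‖ := by
  have hM := hE.nonneg
  have h1 := hE.norm_comp_sub_le hθ t z z'
  have h2 := hE.bound t (z'.1 + t • vel θ z'.2)
  simp only [waveField, Prod.mk_sub_mk]
  set a := E t (z.1 + t • vel θ z.2)
  set a' := E t (z'.1 + t • vel θ z'.2)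
  have hd := decay_mono (show α ≤ α + 1 by linarith) t
  rw [norm_prod_le_iff]
  constructor
  · have e : -(t • dvel θ z.2 a) - -(t • dvel θ z'.2 a')
        = -(t • (dvel θ z.2 (a - a') + (dvel θ z.2 - dvel θ z'.2) a')) := by
      rw [map_sub, sub_apply]
      module
    simp only
    rw [e, norm_neg, norm_smul, Real.norm_eq_abs]
    have h3 : ‖dvel θ z.2 (a - a')‖ ≤ 2 * (2 * M * (1 + |t|) ^ (-(α + 1)) * ‖z - z'‖) :=
      (ContinuousLinearMap.le_opNorm _ _).trans (by
        gcongr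
        exact norm_dvel_le hθ _)
    have h4 : ‖(dvel θ z.2 - dvel θ z'.2) a'‖ ≤ 6 * ‖z - z'‖ * (M * (1 + |t|) ^ (-(α + 1))) :=
      (ContinuousLinearMap.le_opNorm _ _).trans (by
        gcongr
        exact (norm_dvel_sub_le hθ hθ1 _ _).trans (by gcongr; exact norm_snd_le (z - z')))
    -- The constant is 10 = 2·2 + 6: the increment of E with |Dv| ≤ 2, plus the increment of Dv,
    -- which is 6-Lipschitz.
    calc _ ≤ (1 + |t|) * (2 * (2 * M * (1 + |t|) ^ (-(α + 1)) * ‖z - z'‖)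
          + 6 * ‖z - z'‖ * (M * (1 + |t|) ^ (-(α + 1)))) := by
          gcongr
          · exact abs_le_one_add_abs t
          · exact (norm_add_le _ _).trans (add_le_add h3 h4)
      _ = 10 * M * ((1 + |t|) * (1 + |t|) ^ (-(α + 1))) * ‖z - z'‖ := by ring
      _ = _ := by rw [decay_mul]
  · calc _ ≤ 2 * M * (1 + |t|) ^ (-(α + 1)) * ‖z - z'‖ := h1
      _ ≤ 10 * M * (1 + |t|) ^ (-α) * ‖z - z'‖ := by
        gcongr
        norm_num

lemma IsField.isBoundedLipschitz (hE : IsField α M E) (hα : 0 ≤ α) (hθ : 0 ≤ θ) (hθ1 : θ ≤ 1) :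
    IsBoundedLipschitz (10 * M).toNNReal (2 * M) (waveField θ E) := by
  have hM := hE.nonneg
  refine ⟨hE.continuous_waveField θ, fun t => LipschitzWith.of_dist_le_mul fun z z' => ?_,
    fun t z => ?_⟩
  · rw [dist_eq_norm, dist_eq_norm, Real.coe_toNNReal _ (by positivity)]
    exact (hE.norm_waveField_sub_le hθ hθ1 t z z').trans (mul_le_mul_of_nonneg_right
      (mul_le_of_le_one_right (by positivity) (decay_le_one hα t)) (norm_nonneg _))
  · exact (hE.norm_waveField_le hθ t z).trans
      (mul_le_of_le_one_right (by positivity) (decay_le_one hα t))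

/-- Comparison of a solution of the characteristic system with an approximate solution. -/
lemma IsField.norm_sub_le_of_approx (hE : IsField α M E) (hα : 1 < α) (hθ : 0 ≤ θ) (hθ1 : θ ≤ 1)
    {Z1 Z2 Z2' : ℝ → Phase} (h1 : ∀ s, HasDerivAt Z1 (waveField θ E s (Z1 s)) s)
    (h2 : ∀ s, HasDerivAt Z2 (Z2' s) s) {r R : ℝ → ℝ} (hr : ∀ s, 0 ≤ r s)
    (hR : ∀ s, HasDerivAt R (r s) s) {t s : ℝ}
    (hb : ∀ u ∈ uIcc t s, ‖waveField θ E u (Z2 u) - Z2' u‖ ≤ r u) :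
    ‖Z1 s - Z2 s‖ ≤ (‖Z1 t - Z2 t‖ + |R s - R t|) * Real.exp (10 * M * totalDecay α) := by
  have hM := hE.nonneg
  have h := gronwall_two_sided (f := fun s => Z1 s - Z2 s) (a := t) (t := s)
    (l := fun s => 10 * M * (1 + |s|) ^ (-α)) (L := fun s => 10 * M * decayPrim α s)
    (fun s => (h1 s).sub (h2 s)) (fun s => by positivity)
    (fun s => (hasDerivAt_decayPrim α s).const_mul _) hr hR (fun u hu => by
      calc _ = ‖(waveField θ E u (Z1 u) - waveField θ E u (Z2 u))
            + (waveField θ E u (Z2 u) - Z2' u)‖ := by congr 1; abel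
        _ ≤ _ := (norm_add_le _ _).trans
          (add_le_add (hE.norm_waveField_sub_le hθ hθ1 _ _ _) (hb u hu)))
  refine h.trans ?_
  gcongr
  rw [← mul_sub, abs_mul, abs_of_nonneg (by positivity)]
  gcongr
  exact abs_decayPrim_sub_le hα _ _

lemma IsField.hasDerivAt_waveFlow (hE : IsField α M E) (hα : 0 ≤ α) (hθ : 0 ≤ θ) (hθ1 : θ ≤ 1)
    (t : ℝ) (z : Phase) (s : ℝ) :
    HasDerivAt (waveFlow θ E t z) (waveField θ E s (waveFlow θ E t z s)) s :=
  (hE.isBoundedLipschitz hα hθ hθ1).hasDerivAt_flow t z s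

lemma IsField.waveFlow_self (hE : IsField α M E) (hα : 0 ≤ α) (hθ : 0 ≤ θ) (hθ1 : θ ≤ 1)
    (t : ℝ) (z : Phase) : waveFlow θ E t z t = z :=
  (hE.isBoundedLipschitz hα hθ hθ1).flow_self t z

lemma IsField.waveFlow_waveFlow (hE : IsField α M E) (hα : 0 ≤ α) (hθ : 0 ≤ θ) (hθ1 : θ ≤ 1)
    (t s r : ℝ) (z : Phase) : waveFlow θ E s (waveFlow θ E t z s) r = waveFlow θ E t z r :=
  (hE.isBoundedLipschitz hα hθ hθ1).flow_flow t s r z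

lemma IsField.continuous_waveFlow (hE : IsField α M E) (hα : 0 ≤ α) (hθ : 0 ≤ θ) (hθ1 : θ ≤ 1)
    (s : ℝ) : Continuous fun q : ℝ × Phase => waveFlow θ E q.1 q.2 s :=
  (hE.isBoundedLipschitz hα hθ hθ1).continuous_flow s

lemma IsField.norm_waveFlow_sub_le (hE : IsField α M E) (hα : 0 ≤ α) (hθ : 0 ≤ θ) (hθ1 : θ ≤ 1)
    (t s : ℝ) (z : Phase) :
    ‖waveFlow θ E t z s - z‖ ≤ 2 * M * |decayPrim α s - decayPrim α t| := by
  have hM := hE.nonneg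
  have h := gronwall_two_sided (f := fun s => waveFlow θ E t z s - z) (a := t) (t := s)
    (l := fun _ => 0) (L := fun _ => 0) (r := fun s => 2 * M * (1 + |s|) ^ (-α))
    (R := fun s => 2 * M * decayPrim α s)
    (fun s => (hE.hasDerivAt_waveFlow hα hθ hθ1 t z s).sub_const z) (fun _ => le_rfl)
    (fun s => hasDerivAt_const s 0) (fun s => by positivity)
    (fun s => (hasDerivAt_decayPrim α s).const_mul _) (fun s _ => by
      rw [zero_mul, zero_add]; exact hE.norm_waveField_le hθ _ _)
  rw [hE.waveFlow_self hα hθ hθ1, sub_self, norm_zero, zero_add, sub_self, abs_zero, Real.exp_zero,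
    mul_one, ← mul_sub, abs_mul, abs_of_nonneg (by positivity)] at h
  exact h

lemma IsField.norm_waveFlow_sub_le_totalDecay (hE : IsField α M E) (hα : 1 < α) (hθ : 0 ≤ θ)
    (hθ1 : θ ≤ 1) (t s : ℝ) (z : Phase) :
    ‖waveFlow θ E t z s - z‖ ≤ 2 * M * totalDecay α := by
  have hM := hE.nonneg
  exact (hE.norm_waveFlow_sub_le (by linarith) hθ hθ1 t s z).trans
    (by gcongr; exact abs_decayPrim_sub_le hα _ _)

lemma IsField.norm_waveFlow_sub_waveFlow_le (hE : IsField α M E) (hα : 1 < α) (hθ : 0 ≤ θ)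
    (hθ1 : θ ≤ 1) (t s : ℝ) (z z' : Phase) :
    ‖waveFlow θ E t z s - waveFlow θ E t z' s‖
      ≤ Real.exp (10 * M * totalDecay α) * ‖z - z'‖ := by
  have hα0 : 0 ≤ α := by linarith
  have h := hE.norm_sub_le_of_approx hα hθ hθ1 (t := t) (s := s)
    (hE.hasDerivAt_waveFlow hα0 hθ hθ1 t z) (hE.hasDerivAt_waveFlow hα0 hθ hθ1 t z')
    (fun _ => le_rfl) (fun s => hasDerivAt_const s (0 : ℝ)) (fun u _ => by simp)
  rw [hE.waveFlow_self hα0 hθ hθ1, hE.waveFlow_self hα0 hθ hθ1, sub_self, abs_zero, add_zero] at h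
  linarith

/-- The flow in free-streaming coordinates is a small Lipschitz perturbation of the identity. -/
lemma IsField.norm_waveFlow_sub_sub_le (hE : IsField α M E) (hα : 1 < α) (hθ : 0 ≤ θ)
    (hθ1 : θ ≤ 1) (t s : ℝ) (z z' : Phase) :
    ‖(waveFlow θ E t z s - waveFlow θ E t z' s) - (z - z')‖
      ≤ 10 * M * totalDecay α * Real.exp (10 * M * totalDecay α) * ‖z - z'‖ := by
  have hα0 : 0 ≤ α := by linarith
  have hM := hE.nonneg
  set e := Real.exp (10 * M * totalDecay α) with he
  have h := gronwall_two_sided (f := fun s => (waveFlow θ E t z s - waveFlow θ E t z' s) - (z - z'))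
    (a := t) (t := s) (l := fun _ => 0) (L := fun _ => 0)
    (r := fun s => 10 * M * e * ‖z - z'‖ * (1 + |s|) ^ (-α))
    (R := fun s => 10 * M * e * ‖z - z'‖ * decayPrim α s)
    (fun s => ((hE.hasDerivAt_waveFlow hα0 hθ hθ1 t z s).sub
      (hE.hasDerivAt_waveFlow hα0 hθ hθ1 t z' s)).sub_const (z - z')) (fun _ => le_rfl)
    (fun s => hasDerivAt_const s 0) (fun s => by positivity)
    (fun s => (hasDerivAt_decayPrim α s).const_mul _) (fun s _ => by
      rw [zero_mul, zero_add]
      refine (hE.norm_waveField_sub_le hθ hθ1 _ _ _).trans ?_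
      calc _ ≤ 10 * M * (1 + |s|) ^ (-α) * (e * ‖z - z'‖) := by
            gcongr
            exact hE.norm_waveFlow_sub_waveFlow_le hα hθ hθ1 t s z z'
        _ = _ := by ring)
  rw [hE.waveFlow_self hα0 hθ hθ1, hE.waveFlow_self hα0 hθ hθ1, sub_self, norm_zero, zero_add,
    sub_self, abs_zero, Real.exp_zero, mul_one, ← mul_sub, abs_mul,
    abs_of_nonneg (by positivity)] at h
  refine h.trans ?_
  calc _ ≤ 10 * M * e * ‖z - z'‖ * totalDecay α := by
        gcongr
        exact abs_decayPrim_sub_le hα _ _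
    _ = _ := by ring

/-- Dependence of the flow on the field. -/
lemma IsField.norm_waveFlow_sub_waveFlow_le_of_field {E' : ℝ → R3 → R3} (hE : IsField α M E)
    (hE' : IsField α M E') (hα : 1 < α) (hθ : 0 ≤ θ) (hθ1 : θ ≤ 1) {d D : ℝ → ℝ} {t s : ℝ}
    (hd0 : ∀ u, 0 ≤ d u) (hD : ∀ u, HasDerivAt D ((1 + |u|) * d u) u)
    (hd : ∀ u ∈ uIcc t s, ∀ x, ‖E u x - E' u x‖ ≤ d u) (z : Phase) :
    ‖waveFlow θ E t z s - waveFlow θ E' t z s‖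
      ≤ 2 * |D s - D t| * Real.exp (10 * M * totalDecay α) := by
  have hα0 : 0 ≤ α := by linarith
  have h := hE.norm_sub_le_of_approx hα hθ hθ1 (t := t) (s := s)
    (hE.hasDerivAt_waveFlow hα0 hθ hθ1 t z) (hE'.hasDerivAt_waveFlow hα0 hθ hθ1 t z)
    (r := fun u => 2 * ((1 + |u|) * d u)) (R := fun u => 2 * D u)
    (fun u => by have := hd0 u; positivity) (fun u => (hD u).const_mul 2) (fun u hu => by
      have h0 := hd0 u
      set q := waveFlow θ E' t z u
      have h1 := hd u hu (q.1 + u • vel θ q.2)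
      simp only [waveField, Prod.mk_sub_mk, norm_prod_le_iff]
      constructor
      · rw [neg_sub_neg, ← smul_sub, ← map_sub, norm_smul, Real.norm_eq_abs]
        calc _ ≤ (1 + |u|) * (2 * d u) := by
              gcongr
              · exact abs_le_one_add_abs u
              · refine (ContinuousLinearMap.le_opNorm _ _).trans ?_
                rw [norm_sub_rev]
                gcongr
                exact norm_dvel_le hθ _
          _ = _ := by ring
      · refine h1.trans ?_
        nlinarith [abs_nonneg u])
  rw [hE.waveFlow_self hα0 hθ hθ1, hE'.waveFlow_self hα0 hθ hθ1, sub_self, norm_zero, zero_add,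
    ← mul_sub, abs_mul, abs_two] at h
  exact h

/-- Dependence of the flow on the field and on the speed of light. -/
lemma IsField.norm_waveFlow_sub_waveFlow_zero_le {E' : ℝ → R3 → R3} (hE : IsField α M E)
    (hE' : IsField α M E') (hα : 1 < α) (hθ : 0 ≤ θ) (hθ1 : θ ≤ 1) {D : ℝ}
    (hD : 0 ≤ D) (hd : ∀ u x, ‖E u x - E' u x‖ ≤ D * (1 + |u|) ^ (-(α + 1))) (t s : ℝ) (z : Phase) :
    ‖waveFlow θ E t z s - waveFlow 0 E' t z s‖
      ≤ (2 * D + 6 * M * θ ^ 2 * ((1 + 2 * M * totalDecay α) * bracket z.2) ^ 3) * totalDecay α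
        * Real.exp (10 * M * totalDecay α) := by
  have hα0 : 0 ≤ α := by linarith
  have hM := hE.nonneg
  set B := (1 + 2 * M * totalDecay α) * bracket z.2 with hB
  have hb := bracket_pos z.2
  have hτ := totalDecay_nonneg α
  have hB0 : 0 < B := by positivity
  -- Momenta along the classical flow remain comparable with the initial one, so errors of order
  -- θ²|P|³ are controlled by θ²⟨p⟩³ at all times.
  have hP : ∀ u, bracket (waveFlow 0 E' t z u).2 ≤ B := fun u =>
    bracket_le_mul ((norm_snd_le (waveFlow 0 E' t z u - z)).trans
      (hE'.norm_waveFlow_sub_le_totalDecay hα le_rfl zero_le_one t u z))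
  have h := hE.norm_sub_le_of_approx hα hθ hθ1 (t := t) (s := s)
    (hE.hasDerivAt_waveFlow hα0 hθ hθ1 t z) (hE'.hasDerivAt_waveFlow hα0 le_rfl zero_le_one t z)
    (r := fun u => (2 * D + 6 * M * θ ^ 2 * B ^ 3) * (1 + |u|) ^ (-α))
    (R := fun u => (2 * D + 6 * M * θ ^ 2 * B ^ 3) * decayPrim α u)
    (fun u => by positivity) (fun u => (hasDerivAt_decayPrim α u).const_mul _) (fun u hu => by
      set q := waveFlow 0 E' t z u
      have hq : ‖q.2‖ ≤ B := (norm_le_bracket _).trans (hP u)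
      have hB1 : 1 ≤ B := (one_le_bracket _).trans (hP u)
      have e1 := decay_mul (α + 1) u
      rw [show α + 1 + 1 = α + 2 by ring] at e1
      have e2 := decay_mul α u
      set w1 := (1 + |u|) ^ (-(α + 1)) with hw1
      have hw10 : 0 ≤ w1 := by positivity
      -- The classical trajectory is inserted into the relativistic equation. Its field error
      -- consists of E - E' and of the displacement u(v_θ(q) - q); the growth of the latter is
      -- cancelled by the Lipschitz decay.
      have h1 : ‖E u (q.1 + u • vel θ q.2) - E' u (q.1 + u • vel 0 q.2)‖
          ≤ (D + M * θ ^ 2 * B ^ 3) * w1 := by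
        have h2 := hE.lip u (q.1 + u • vel θ q.2) (q.1 + u • vel 0 q.2)
        have h3 := hd u (q.1 + u • vel 0 q.2)
        have h4 : ‖(q.1 + u • vel θ q.2) - (q.1 + u • vel 0 q.2)‖
            ≤ (1 + |u|) * (θ ^ 2 * B ^ 3) := by
          rw [add_sub_add_left_eq_sub, ← smul_sub, norm_smul, Real.norm_eq_abs, vel_zero]
          have h5 := norm_vel_sub_self_le θ q.2
          gcongr
          · exact abs_le_one_add_abs u
          · exact h5.trans (by gcongr)
        calc _ = ‖(E u (q.1 + u • vel θ q.2) - E u (q.1 + u • vel 0 q.2))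
              + (E u (q.1 + u • vel 0 q.2) - E' u (q.1 + u • vel 0 q.2))‖ := by congr 1; abel
          _ ≤ M * (1 + |u|) ^ (-(α + 2)) * ((1 + |u|) * (θ ^ 2 * B ^ 3)) + D * w1 :=
            (norm_add_le _ _).trans (add_le_add (h2.trans (by gcongr)) h3)
          _ = M * ((1 + |u|) * (1 + |u|) ^ (-(α + 2))) * (θ ^ 2 * B ^ 3) + D * w1 := by ring
          _ = _ := by rw [e1]; ring
      have h6 := hE'.bound u (q.1 + u • vel 0 q.2)
      simp only [waveField, Prod.mk_sub_mk, norm_prod_le_iff]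
      set a := E u (q.1 + u • vel θ q.2)
      set a' := E' u (q.1 + u • vel 0 q.2)
      constructor
      · have e : -(u • dvel θ q.2 a) - -(u • dvel 0 q.2 a')
            = -(u • (dvel θ q.2 (a - a') + (dvel θ q.2 - ContinuousLinearMap.id ℝ R3) a'
              - (dvel 0 q.2 - ContinuousLinearMap.id ℝ R3) a')) := by
          simp only [map_sub, sub_apply]
          module
        have hz : dvel 0 q.2 - ContinuousLinearMap.id ℝ R3 = 0 := by
          have := norm_dvel_sub_id_le le_rfl q.2
          rw [zero_pow two_ne_zero, zero_mul, mul_zero] at this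
          exact norm_le_zero_iff.1 this
        rw [hz, zero_apply, sub_zero] at e
        rw [e, norm_neg, norm_smul, Real.norm_eq_abs]
        have h7 : ‖dvel θ q.2 (a - a')‖ ≤ 2 * ((D + M * θ ^ 2 * B ^ 3) * w1) :=
          (ContinuousLinearMap.le_opNorm _ _).trans (by gcongr; exact norm_dvel_le hθ _)
        have h8 : ‖(dvel θ q.2 - ContinuousLinearMap.id ℝ R3) a'‖
            ≤ 2 * (θ ^ 2 * B ^ 3) * (M * w1) := by
          refine (ContinuousLinearMap.le_opNorm _ _).trans ?_
          gcongr
          refine (norm_dvel_sub_id_le hθ q.2).trans ?_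
          gcongr
          calc ‖q.2‖ ^ 2 ≤ B ^ 2 := by gcongr
            _ ≤ B ^ 3 := pow_le_pow_right₀ hB1 (by norm_num)
        calc _ ≤ (1 + |u|) * (2 * ((D + M * θ ^ 2 * B ^ 3) * w1)
              + 2 * (θ ^ 2 * B ^ 3) * (M * w1)) := by
              gcongr
              · exact abs_le_one_add_abs u
              · exact (norm_add_le _ _).trans (add_le_add h7 h8)
          _ = (2 * D + 4 * M * θ ^ 2 * B ^ 3) * ((1 + |u|) * w1) := by ring
          _ ≤ (2 * D + 6 * M * θ ^ 2 * B ^ 3) * ((1 + |u|) * w1) := by gcongr; norm_num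
          _ = _ := by rw [e2]
      · refine h1.trans ?_
        have hle : w1 ≤ (1 + |u|) ^ (-α) := decay_mono (by linarith) u
        have : 0 ≤ M * θ ^ 2 * B ^ 3 := by positivity
        calc _ ≤ (2 * D + 6 * M * θ ^ 2 * B ^ 3) * w1 := by
              refine mul_le_mul_of_nonneg_right ?_ hw10
              linarith
          _ ≤ _ := by gcongr)
  rw [hE.waveFlow_self hα0 hθ hθ1, hE'.waveFlow_self hα0 le_rfl zero_le_one, sub_self, norm_zero,
    zero_add, ← mul_sub, abs_mul, abs_of_nonneg (by positivity)] at h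
  refine h.trans ?_
  gcongr
  exact abs_decayPrim_sub_le hα _ _

end WaveFlow

end Vlasov

end

noncomputable section

namespace Vlasov

/-! ### Estimates for densities in velocity variables -/

section VelDensity

variable {σ θ δ : ℝ} {g : Phase → ℝ}

lemma abs_velDensity_le {k : ℕ} (hθ : 0 ≤ θ) (hθ1 : θ ≤ 1)
    (hg : ∀ z, |g z| ≤ δ * weight σ (k + 5) z) (hδ : 0 ≤ δ) (y u : R3) :
    |velDensity θ g (y, u)| ≤ 2 ^ (k + 5) * δ * mfac θ u ^ k * weight σ (k + 5) (y, u) := by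
  have hm := mfac_nonneg θ u
  rw [velDensity, abs_mul, abs_of_nonneg (by positivity)]
  calc _ ≤ (mfac θ u)⁻¹ ^ 5 * (δ * weight σ (k + 5) (y, mom θ u)) := by
        gcongr
        exact hg _
    _ = δ * ((mfac θ u)⁻¹ ^ 5 * weight σ (k + 5) (y, mom θ u)) := by ring
    _ ≤ δ * (2 ^ (k + 5) * mfac θ u ^ k * weight σ (k + 5) (y, u)) :=
        mul_le_mul_of_nonneg_left (weight_mom_le hθ hθ1 σ (by norm_num) y u) hδ
    _ = _ := by ring

lemma norm_mul_weight_le (σ : ℝ) (k : ℕ) (z : Phase) :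
    ‖z.2‖ * weight σ (k + 1) z ≤ weight σ k z := by
  have h1 := bracket_pow_mul_weight σ 1 k z
  rw [pow_one, add_comm 1 k] at h1
  rw [← h1]
  exact mul_le_mul_of_nonneg_right (norm_le_bracket _) (weight_nonneg _ _ _)

lemma weight_add_le (hσ : 0 ≤ σ) (k : ℕ) (y u e : R3) (he : ‖e‖ ≤ 1) :
    weight σ k (y, u + e) ≤ 2 ^ k * weight σ k (y, u) := by
  have h := weight_le_of_bracket_le hσ k (z := (y, u + e)) (z' := (y, u)) one_pos two_pos
    (by simp) (by
      have := bracket_le_mul (A := 1) (x := u) (y := u + e) (by simpa using he)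
      norm_num at this
      exact this)
  simpa using h

lemma mfac_sq' (θ : ℝ) (u : R3) : mfac θ u ^ 2 = max 0 (1 - θ ^ 2 * ‖u‖ ^ 2) := by
  rcases le_total 0 (1 - θ ^ 2 * ‖u‖ ^ 2) with h | h
  · rw [max_eq_right h, mfac, Real.sq_sqrt h]
  · rw [max_eq_left h, mfac, Real.sqrt_eq_zero_of_nonpos h, zero_pow two_ne_zero]

lemma mul_norm_le_one_of_mfac_ne_zero (hθ : 0 ≤ θ) {u : R3} (h : mfac θ u ≠ 0) : θ * ‖u‖ ≤ 1 := by
  have h1 := mfac_sq h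
  have h2 : 0 ≤ mfac θ u ^ 2 := sq_nonneg _
  have h3 : 0 ≤ θ * ‖u‖ := by positivity
  nlinarith

lemma abs_sq_norm_sub_le (hθ : 0 ≤ θ) (hθ1 : θ ≤ 1) {u e : R3} (he : ‖e‖ ≤ 1)
    (hu : θ * ‖u‖ ≤ 2) :
    |θ ^ 2 * ‖u‖ ^ 2 - θ ^ 2 * ‖u + e‖ ^ 2| ≤ 5 * θ * ‖e‖ := by
  have h1 : |‖u‖ - ‖u + e‖| ≤ ‖e‖ := by
    refine (abs_norm_sub_norm_le u (u + e)).trans_eq ?_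
    rw [sub_add_cancel_left, norm_neg]
  have h2 : ‖u + e‖ ≤ ‖u‖ + 1 := (norm_add_le _ _).trans (by linarith)
  have h3 : θ ^ 2 * ‖u‖ ^ 2 - θ ^ 2 * ‖u + e‖ ^ 2
      = θ * (θ * (‖u‖ + ‖u + e‖)) * (‖u‖ - ‖u + e‖) := by ring
  have h4 : θ * (‖u‖ + ‖u + e‖) ≤ 5 := by nlinarith
  rw [h3, abs_mul, abs_of_nonneg (by positivity)]
  calc _ ≤ θ * 5 * ‖e‖ := by gcongr
    _ = _ := by ring

/-- The square of m is used because m itself behaves like a square root at the boundary of the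
admissible ball and is not Lipschitz there. If θ|u| > 2, both velocities are inadmissible and both
factors are zero. -/
lemma mfac_sq_sub_le (hθ : 0 ≤ θ) (hθ1 : θ ≤ 1) {u e : R3} (he : ‖e‖ ≤ 1) :
    |mfac θ u ^ 2 - mfac θ (u + e) ^ 2| ≤ 5 * θ * ‖e‖ := by
  rcases le_or_gt (θ * ‖u‖) 2 with hu | hu
  · rw [mfac_sq', mfac_sq', max_comm 0, max_comm 0]
    refine (abs_max_sub_max_le_abs _ _ _).trans ?_
    rw [sub_sub_sub_cancel_left, abs_sub_comm]
    exact abs_sq_norm_sub_le hθ hθ1 he hu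
  · have h1 : ‖u‖ - 1 ≤ ‖u + e‖ := by
      have := norm_sub_le (u + e) e
      rw [add_sub_cancel_right] at this
      linarith
    have h2 : 1 ≤ θ * ‖u + e‖ := by nlinarith
    have h3 : mfac θ u = 0 := Real.sqrt_eq_zero_of_nonpos (by nlinarith)
    have h4 : mfac θ (u + e) = 0 := Real.sqrt_eq_zero_of_nonpos (by nlinarith)
    rw [h3, h4]
    simp
    positivity

/-- The constant is 31 = 1 + 2 + 4 + 8 + 16. -/
lemma abs_pow_five_sub_le {a b : ℝ} (ha : 0 ≤ a) (hb : 0 ≤ b) (hab : b ≤ 2 * a) :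
    |a ^ 5 - b ^ 5| ≤ 31 * a ^ 4 * |a - b| := by
  have h : a ^ 5 - b ^ 5 = (a ^ 4 + a ^ 3 * b + a ^ 2 * b ^ 2 + a * b ^ 3 + b ^ 4) * (a - b) := by
    ring
  rw [h, abs_mul, abs_of_nonneg (by positivity)]
  gcongr
  calc _ ≤ a ^ 4 + a ^ 3 * (2 * a) + a ^ 2 * (2 * a) ^ 2 + a * (2 * a) ^ 3 + (2 * a) ^ 4 := by
        gcongr
    _ = _ := by ring

/-- The inverse Lorentz factors and the momenta of two close velocities. -/
lemma mom_sub_mom_le (hθ : 0 ≤ θ) (hθ1 : θ ≤ 1) {u e : R3} (he : ‖e‖ ≤ 1)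
    (hu : 32 * ‖e‖ < mfac θ u ^ 2) :
    0 < mfac θ u ∧ 0 < mfac θ (u + e) ∧ (mfac θ (u + e))⁻¹ ≤ 2 * (mfac θ u)⁻¹ ∧
    |(mfac θ u)⁻¹ - (mfac θ (u + e))⁻¹| ≤ 10 * θ * ‖e‖ * (mfac θ u)⁻¹ ^ 3 ∧
    ‖mom θ u - mom θ (u + e)‖ ≤ 12 * ‖e‖ * (mfac θ u)⁻¹ ^ 3 ∧
    ‖mom θ u - mom θ (u + e)‖ ≤ 1 / 2 * bracket (mom θ u) := by
  have hd := abs_le.1 (mfac_sq_sub_le hθ hθ1 he (u := u))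
  have hm1 := mfac_nonneg θ u
  have hm2 := mfac_nonneg θ (u + e)
  have hle1 := mfac_le_one θ u
  have he0 := norm_nonneg e
  have hte : θ * ‖e‖ ≤ ‖e‖ := by nlinarith
  have hne : mfac θ u ≠ 0 := by
    intro h; rw [h] at hu; norm_num at hu; linarith
  set m1 := mfac θ u with hm1d
  set m2 := mfac θ (u + e) with hm2d
  have p1 : 0 < m1 := lt_of_le_of_ne hm1 hne.symm
  -- A step e changes m² by at most 5|e|, less than a sixth of m² under the hypothesis, so the two
  -- Lorentz factors are within a factor 2 of each other.
  have hm2sq : m1 ^ 2 / 4 ≤ m2 ^ 2 := by nlinarith [hd.2]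
  have h2 : m1 / 2 ≤ m2 := by nlinarith
  have p2 : 0 < m2 := by linarith
  set a := m1⁻¹ with ha
  have pa : 0 < a := inv_pos.2 p1
  have ha1 : 1 ≤ a := (one_le_inv₀ p1).2 hle1
  have ham : a * m1 = 1 := inv_mul_cancel₀ hne
  have hb : m2⁻¹ ≤ 2 * a := by
    rw [ha, inv_le_iff_one_le_mul₀ p2]
    have : 1 = 2 * m1⁻¹ * (m1 / 2) := by field_simp
    calc 1 = 2 * m1⁻¹ * (m1 / 2) := this
      _ ≤ 2 * m1⁻¹ * m2 := by gcongr
  have hm : |m1 - m2| ≤ 5 * θ * ‖e‖ * a := by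
    have h3 : |m1 - m2| * (m1 + m2) ≤ 5 * θ * ‖e‖ := by
      rw [← abs_of_pos (add_pos p1 p2), ← abs_mul]
      refine (abs_le.2 ?_)
      constructor <;> nlinarith [hd.1, hd.2]
    have h4 : |m1 - m2| * m1 ≤ 5 * θ * ‖e‖ :=
      (mul_le_mul_of_nonneg_left (by linarith) (abs_nonneg _)).trans h3
    calc |m1 - m2| = |m1 - m2| * m1 * a := by rw [mul_assoc, mul_comm m1, ham, mul_one]
      _ ≤ _ := by gcongr
  have hinv : |a - m2⁻¹| ≤ 10 * θ * ‖e‖ * a ^ 3 := by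
    rw [ha, inv_sub_inv hne p2.ne', abs_div, abs_of_pos (mul_pos p1 p2), abs_sub_comm,
      div_eq_mul_inv, mul_inv, ← ha]
    calc _ ≤ (5 * θ * ‖e‖ * a) * (a * (2 * a)) := by gcongr
      _ = _ := by ring
  have hmom : ‖mom θ u - mom θ (u + e)‖ ≤ 12 * ‖e‖ * a ^ 3 := by
    have e1 : mom θ u - mom θ (u + e) = (a - m2⁻¹) • u - m2⁻¹ • e := by
      simp only [mom, ← hm1d, ← hm2d, ← ha]
      module
    rw [e1]
    refine (norm_sub_le _ _).trans ?_
    rw [norm_smul, norm_smul, Real.norm_eq_abs, Real.norm_of_nonneg (inv_nonneg.2 hm2)]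
    have h5 : θ * ‖u‖ ≤ 1 := mul_norm_le_one_of_mfac_ne_zero hθ hne
    have h6 : a ≤ a ^ 3 := le_self_pow₀ ha1 (by norm_num)
    calc _ ≤ 10 * θ * ‖e‖ * a ^ 3 * ‖u‖ + 2 * a * ‖e‖ := by gcongr
      _ = 10 * (θ * ‖u‖) * (‖e‖ * a ^ 3) + 2 * ‖e‖ * a := by ring
      _ ≤ 10 * 1 * (‖e‖ * a ^ 3) + 2 * ‖e‖ * a ^ 3 := by gcongr
      _ = _ := by ring
  refine ⟨p1, p2, hb, hinv, hmom, hmom.trans ?_⟩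
  have h7 : a ≤ bracket (mom θ u) := by
    rw [ha, hm1d, ← gam_mom hne]
    unfold gam bracket
    refine Real.sqrt_le_sqrt ?_
    have : θ ^ 2 ≤ 1 := by nlinarith
    nlinarith [sq_nonneg ‖mom θ u‖]
  -- The threshold 32 serves this bound: the momentum then moves by at most 12a/32 ≤ ⟨p⟩/2, the
  -- range in which the Lipschitz hypothesis on momentum densities is available.
  have h8 : ‖e‖ * a ^ 3 ≤ a / 32 := by
    have : ‖e‖ ≤ m1 ^ 2 / 32 := by linarith
    calc ‖e‖ * a ^ 3 ≤ m1 ^ 2 / 32 * a ^ 3 := by gcongr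
      _ = (a * m1) ^ 2 * a / 32 := by ring
      _ = _ := by rw [ham]; ring
  linarith

/-- A momentum density that is locally Lipschitz on the scale `⟨p⟩` is Lipschitz in velocity,
uniformly up to the boundary of the set of admissible velocities. -/
lemma exists_abs_velDensity_sub_le (hσ : 0 ≤ σ) : ∃ C : ℝ, 0 < C ∧ ∀ (θ : ℝ), 0 ≤ θ → θ ≤ 1 →
    ∀ (g : Phase → ℝ) (δ : ℝ), 0 ≤ δ → (∀ z, |g z| ≤ δ * weight σ 8 z) →
    (∀ y p p' : R3, ‖p - p'‖ ≤ 1 / 2 * bracket p →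
      |g (y, p) - g (y, p')| ≤ δ * weight σ 9 (y, p) * ‖p - p'‖) →
    ∀ y u e : R3, ‖e‖ ≤ 1 →
      |velDensity θ g (y, u + e) - velDensity θ g (y, u)| ≤ C * δ * ‖e‖ * weight σ 4 (y, u) := by
  refine ⟨2 ^ 8 * 37 * (1 + 2 ^ 8) + 32 * 12 * 2 ^ 9 + 310 * 2 ^ 8, by positivity,
    fun θ hθ hθ1 g δ hδ hg hg' y u e he => ?_⟩
  have hm1 := mfac_nonneg θ u
  have hm2 := mfac_nonneg θ (u + e)
  have hl1 := mfac_le_one θ u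
  have hl2 := mfac_le_one θ (u + e)
  have he0 := norm_nonneg e
  have hw4 := weight_nonneg σ 4 (y, u)
  have hw84 : weight σ 8 (y, u) ≤ weight σ 4 (y, u) := weight_anti (by norm_num) _
  have hw94 : weight σ 9 (y, u) ≤ weight σ 4 (y, u) := weight_anti (by norm_num) _
  have hw8 := weight_nonneg σ 8 (y, u)
  have hw9 := weight_nonneg σ 9 (y, u)
  -- Close to the boundary no difference is taken: each of the two values carries a factor m³ ≤ m² ≤
  -- 37|e|, where 37 = 32 + 5.
  rcases le_or_gt (mfac θ u ^ 2) (32 * ‖e‖) with hcase | hcase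
  · have hd := abs_le.1 (mfac_sq_sub_le hθ hθ1 he (u := u))
    have hte : θ * ‖e‖ ≤ ‖e‖ := by nlinarith
    have h1 := abs_velDensity_le (k := 3) hθ hθ1 hg hδ y u
    have h2 := abs_velDensity_le (k := 3) hθ hθ1 hg hδ y (u + e)
    have h3 := weight_add_le hσ 8 y u e he
    have q1 : mfac θ u ^ 3 ≤ 37 * ‖e‖ := by
      have : mfac θ u ^ 3 ≤ mfac θ u ^ 2 := pow_le_pow_of_le_one hm1 hl1 (by norm_num)
      linarith
    have q2 : mfac θ (u + e) ^ 3 ≤ 37 * ‖e‖ := by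
      have : mfac θ (u + e) ^ 3 ≤ mfac θ (u + e) ^ 2 := pow_le_pow_of_le_one hm2 hl2 (by norm_num)
      nlinarith [hd.1]
    norm_num only at h1 h2 h3
    calc _ ≤ |velDensity θ g (y, u + e)| + |velDensity θ g (y, u)| := abs_sub _ _
      _ ≤ 256 * δ * (37 * ‖e‖) * (256 * weight σ 4 (y, u))
          + 256 * δ * (37 * ‖e‖) * weight σ 4 (y, u) := by
          refine add_le_add (h2.trans ?_) (h1.trans ?_)
          · have := h3.trans (mul_le_mul_of_nonneg_left hw84 (by norm_num))
            have hw8' := weight_nonneg σ 8 (y, u + e)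
            gcongr
          · gcongr
      _ ≤ _ := by
          have : 0 ≤ δ * ‖e‖ * weight σ 4 (y, u) := by positivity
          nlinarith
  · obtain ⟨p1, p2, hb, hinv, hmom, hmom'⟩ := mom_sub_mom_le hθ hθ1 he hcase
    have h1 := hg' y (mom θ u) (mom θ (u + e)) hmom'
    have h2 := hg (y, mom θ u)
    have w9 := weight_mom_le hθ hθ1 σ (k := 1) (j := 8) (by norm_num) y u
    have w8 := weight_mom_le hθ hθ1 σ (k := 1) (j := 7) (by norm_num) y u
    norm_num only at w9 w8
    rw [pow_one] at w9 w8
    set a := (mfac θ u)⁻¹ with ha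
    set b := (mfac θ (u + e))⁻¹ with hbd
    have pa : 0 < a := inv_pos.2 p1
    have pb : 0 < b := inv_pos.2 p2
    have h5 := abs_pow_five_sub_le pa.le pb.le hb
    have hab : |a - b| ≤ 10 * ‖e‖ * a ^ 3 := hinv.trans (by
      gcongr
      nlinarith)
    -- Away from the boundary the increments of g and of the Jacobian are separated. With a = 1/m,
    -- the momentum moves by O(|e|a³): the first term costs a⁸ against ⟨p⟩^{-9}, the second a⁷
    -- against ⟨p⟩^{-8}, leaving one factor m in each.
    have e1 : velDensity θ g (y, u + e) - velDensity θ g (y, u)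
        = -(b ^ 5 * (g (y, mom θ u) - g (y, mom θ (u + e))))
          - (a ^ 5 - b ^ 5) * g (y, mom θ u) := by
      simp only [velDensity, ← ha, ← hbd]
      ring
    rw [e1]
    have wp9 := weight_nonneg σ 9 (y, mom θ u)
    have wp8 := weight_nonneg σ 8 (y, mom θ u)
    calc _ ≤ |-(b ^ 5 * (g (y, mom θ u) - g (y, mom θ (u + e))))|
          + |(a ^ 5 - b ^ 5) * g (y, mom θ u)| := abs_sub _ _
      _ ≤ (2 * a) ^ 5 * (δ * weight σ 9 (y, mom θ u) * (12 * ‖e‖ * a ^ 3))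
          + 31 * a ^ 4 * (10 * ‖e‖ * a ^ 3) * (δ * weight σ 8 (y, mom θ u)) := by
          rw [abs_neg, abs_mul, abs_mul, abs_of_pos (pow_pos pb 5)]
          refine add_le_add ?_ ?_
          · exact mul_le_mul (pow_le_pow_left₀ pb.le hb 5)
              (h1.trans (mul_le_mul_of_nonneg_left hmom (by positivity))) (abs_nonneg _)
              (by positivity)
          · exact mul_le_mul (h5.trans (mul_le_mul_of_nonneg_left hab (by positivity))) h2
              (abs_nonneg _) (by positivity)
      _ = 32 * 12 * δ * ‖e‖ * (a ^ 8 * weight σ 9 (y, mom θ u))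
          + 310 * δ * ‖e‖ * (a ^ 7 * weight σ 8 (y, mom θ u)) := by ring
      _ ≤ 32 * 12 * δ * ‖e‖ * (512 * 1 * weight σ 4 (y, u))
          + 310 * δ * ‖e‖ * (256 * 1 * weight σ 4 (y, u)) := by
          refine add_le_add (mul_le_mul_of_nonneg_left ?_ (by positivity))
            (mul_le_mul_of_nonneg_left ?_ (by positivity))
          · exact w9.trans (by gcongr)
          · exact w8.trans (by gcongr)
      _ ≤ _ := by
          have : 0 ≤ δ * ‖e‖ * weight σ 4 (y, u) := by positivity
          nlinarith

/-- The relativistic velocity density is an `O(θ²)` perturbation of the classical one. -/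
lemma exists_abs_velDensity_sub_zero_le : ∃ C : ℝ, 0 < C ∧ ∀ (σ θ : ℝ), 0 ≤ θ → θ ≤ 1 →
    ∀ (g : Phase → ℝ) (δ : ℝ), 0 ≤ δ → (∀ z, |g z| ≤ δ * weight σ 8 z) →
    (∀ y p p' : R3, ‖p - p'‖ ≤ 1 / 2 * bracket p →
      |g (y, p) - g (y, p')| ≤ δ * weight σ 9 (y, p) * ‖p - p'‖) →
    ∀ y u : R3, |velDensity θ g (y, u) - velDensity 0 g (y, u)|
      ≤ C * δ * θ ^ 2 * weight σ 4 (y, u) := by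
  refine ⟨2000, by positivity, fun σ θ hθ hθ1 g δ hδ hg hg' y u => ?_⟩
  have hm := mfac_nonneg θ u
  have hl := mfac_le_one θ u
  have hu0 := norm_nonneg u
  have hw4 := weight_nonneg σ 4 (y, u)
  have hw8 := weight_nonneg σ 8 (y, u)
  have hsw : θ ^ 2 * ‖u‖ ^ 2 * weight σ 8 (y, u) ≤ θ ^ 2 * weight σ 4 (y, u) := by
    rw [mul_assoc]
    gcongr
    have h1 := norm_mul_weight_le σ 7 (y, u)
    have h2 := norm_mul_weight_le σ 6 (y, u)
    have h3 : weight σ 6 (y, u) ≤ weight σ 4 (y, u) := weight_anti (by norm_num) _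
    dsimp only at h1 h2
    norm_num only at h1 h2
    calc _ = ‖u‖ * (‖u‖ * weight σ 8 (y, u)) := by ring
      _ ≤ ‖u‖ * weight σ 7 (y, u) := by gcongr
      _ ≤ _ := h2.trans h3
  have e0 : velDensity 0 g (y, u) = g (y, u) := by
    simp [velDensity, mfac_eq_one_of_zero, mom_zero]
  rw [e0]
  set s := θ ^ 2 * ‖u‖ ^ 2 with hs
  have hs0 : 0 ≤ s := by positivity
  rcases le_or_gt s (1 / 4) with hcase | hcase
  -- For θ²|u|² ≤ 1/4 the Lorentz factor is at most 2, and Jacobian and momentum differ from their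
  -- classical values by O(θ²|u|²). The two powers of |u| are traded for two powers of the weight.
  · have hmsq : mfac θ u ^ 2 = 1 - s := by
      rw [mfac_sq', max_eq_right (by linarith)]
    have hm2 : 1 / 2 ≤ mfac θ u := by nlinarith
    have p1 : 0 < mfac θ u := by linarith
    set a := (mfac θ u)⁻¹ with ha
    have ham : a * mfac θ u = 1 := inv_mul_cancel₀ p1.ne'
    have pa : 0 < a := inv_pos.2 p1
    have ha1 : 1 ≤ a := (one_le_inv₀ p1).2 hl
    have ha2 : a ≤ 2 := by nlinarith
    have ha3 : a - 1 ≤ 2 * s := by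
      have h1 : 1 - mfac θ u ≤ s := by nlinarith
      calc a - 1 = a * (1 - mfac θ u) := by rw [mul_sub, ham, mul_one]
        _ ≤ 2 * s := mul_le_mul ha2 h1 (by linarith) (by norm_num)
    have hpu : ‖u - mom θ u‖ ≤ 2 * s * ‖u‖ := by
      have : u - mom θ u = -((a - 1) • u) := by
        simp only [mom, ← ha]; module
      rw [this, norm_neg, norm_smul, Real.norm_of_nonneg (by linarith)]
      gcongr
    have h1 := hg' y u (mom θ u) (hpu.trans (by
      have := norm_le_bracket u
      nlinarith))
    have h2 := hg (y, u)
    have h5 : a ^ 5 - 1 ≤ 62 * s := by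
      have : a ^ 5 - 1 = (a ^ 4 + a ^ 3 + a ^ 2 + a + 1) * (a - 1) := by ring
      rw [this]
      have h6 : a ^ 4 + a ^ 3 + a ^ 2 + a + 1 ≤ 31 := by
        calc _ ≤ (2 : ℝ) ^ 4 + 2 ^ 3 + 2 ^ 2 + 2 + 1 := by gcongr
          _ = 31 := by norm_num
      calc _ ≤ 31 * (2 * s) := mul_le_mul h6 ha3 (by linarith) (by norm_num)
        _ = _ := by ring
    have h50 : 0 ≤ a ^ 5 - 1 := sub_nonneg.2 (one_le_pow₀ ha1)
    have e1 : velDensity θ g (y, u) - g (y, u)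
        = -(a ^ 5 * (g (y, u) - g (y, mom θ u))) + (a ^ 5 - 1) * g (y, u) := by
      simp only [velDensity, ← ha]
      ring
    have h8 := norm_mul_weight_le σ 8 (y, u)
    dsimp only at h8
    norm_num only at h8
    have hw9 := weight_nonneg σ 9 (y, u)
    rw [e1]
    calc _ ≤ |-(a ^ 5 * (g (y, u) - g (y, mom θ u)))| + |(a ^ 5 - 1) * g (y, u)| := abs_add_le _ _
      _ ≤ 2 ^ 5 * (δ * weight σ 9 (y, u) * (2 * s * ‖u‖))
          + 62 * s * (δ * weight σ 8 (y, u)) := by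
          rw [abs_neg, abs_mul, abs_mul, abs_of_pos (pow_pos pa 5), abs_of_nonneg h50]
          refine add_le_add ?_ ?_
          · exact mul_le_mul (pow_le_pow_left₀ pa.le ha2 5)
              (h1.trans (mul_le_mul_of_nonneg_left hpu (by positivity))) (abs_nonneg _)
              (by positivity)
          · exact mul_le_mul h5 h2 (abs_nonneg _) (by positivity)
      _ = 64 * δ * s * (‖u‖ * weight σ 9 (y, u)) + 62 * δ * (s * weight σ 8 (y, u)) := by ring
      _ ≤ 64 * δ * s * weight σ 8 (y, u) + 62 * δ * (s * weight σ 8 (y, u)) := by gcongr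
      _ = 126 * δ * (s * weight σ 8 (y, u)) := by ring
      _ ≤ 126 * δ * (θ ^ 2 * weight σ 4 (y, u)) := by gcongr
      _ ≤ _ := by
          have : 0 ≤ δ * θ ^ 2 * weight σ 4 (y, u) := by positivity
          nlinarith
  -- For θ²|u|² > 1/4 no cancellation is needed, because 1 ≤ 4θ²|u|² and each density is bounded by
  -- the weight.
  · have h1 := abs_velDensity_le (k := 3) hθ hθ1 hg hδ y u
    have h2 := hg (y, u)
    have h3 : mfac θ u ^ 3 ≤ 1 := pow_le_one₀ hm hl
    norm_num only at h1
    calc _ ≤ |velDensity θ g (y, u)| + |g (y, u)| := abs_sub _ _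
      _ ≤ 256 * δ * 1 * weight σ 8 (y, u) + δ * weight σ 8 (y, u) := by
          refine add_le_add (h1.trans ?_) h2
          gcongr
      _ = 257 * δ * (1 * weight σ 8 (y, u)) := by ring
      _ ≤ 257 * δ * (4 * s * weight σ 8 (y, u)) := by
          gcongr
          linarith
      _ = 1028 * δ * (s * weight σ 8 (y, u)) := by ring
      _ ≤ 1028 * δ * (θ ^ 2 * weight σ 4 (y, u)) := by gcongr
      _ ≤ _ := by
          have : 0 ≤ δ * θ ^ 2 * weight σ 4 (y, u) := by positivity
          nlinarith

end VelDensity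

end Vlasov

end

noncomputable section

namespace Vlasov

instance : (volume : Measure Phase).IsAddHaarMeasure :=
  inferInstanceAs ((volume : Measure R3).prod (volume : Measure R3)).IsAddHaarMeasure

/-! ### Transported data -/

/-- Pointwise form of the smallness condition on the initial datum. -/
structure IsDatum (σ η : ℝ) (f0 : Phase → ℝ) : Prop where
  contDiff : ContDiff ℝ 1 f0
  nonneg : ∀ z, 0 ≤ f0 z
  bound : ∀ z, |f0 z| ≤ η * weight σ 8 z
  grad : ∀ z, ‖fderiv ℝ f0 z‖ ≤ η * weight σ 9 z

/-- The datum transported by the characteristic flow, in free-streaming coordinates. -/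
def pull (θ : ℝ) (E : ℝ → R3 → R3) (f0 : Phase → ℝ) (t : ℝ) (z : Phase) : ℝ :=
  f0 (waveFlow θ E t z 0)

/-- The datum transported by the characteristic flow. -/
def distr (θ : ℝ) (E : ℝ → R3 → R3) (f0 : Phase → ℝ) (t : ℝ) (z : Phase) : ℝ :=
  pull θ E f0 t (z.1 - t • vel θ z.2, z.2)

/-- The force field generated by the transported datum. -/
def newField (k : R3 → R3) (β θ : ℝ) (f0 : Phase → ℝ) (E : ℝ → R3 → R3) (t : ℝ) (x : R3) : R3 :=
  force k β (distr θ E f0 t) x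

section Datum

variable {α M σ η θ β : ℝ} {E E' : ℝ → R3 → R3} {f0 : Phase → ℝ} {k : R3 → R3}

lemma IsDatum.nonneg_size (hf : IsDatum σ η f0) : 0 ≤ η := by
  have h1 := (abs_nonneg _).trans (hf.bound 0)
  exact nonneg_of_mul_nonneg_left h1 (weight_pos σ 8 0)

/-- Mean value inequality on the segment from z2 to z1, which stays within A of the segment from z'
to z; there the brackets are comparable with those of z. In momentum a displacement up to ⟨p⟩/2 is
allowed since only its size relative to ⟨p⟩ matters to the weight. -/
lemma IsDatum.abs_sub_le (hf : IsDatum σ η f0) (hσ : 0 ≤ σ) {A : ℝ} {z z' z1 z2 : Phase}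
    (h1 : ‖z.1 - z'.1‖ ≤ 1) (h2 : ‖z.2 - z'.2‖ ≤ 1 / 2 * bracket z.2) (hz1 : ‖z1 - z‖ ≤ A)
    (hz2 : ‖z2 - z'‖ ≤ A) :
    |f0 z1 - f0 z2|
      ≤ η * ((2 * (1 + A)) ^ σ * (2 * (1 + A)) ^ 9) * weight σ 9 z * ‖z1 - z2‖ := by
  have hA : 0 ≤ A := (norm_nonneg _).trans hz1
  have hη := hf.nonneg_size
  have hseg : ∀ q ∈ segment ℝ z2 z1, ‖fderiv ℝ f0 q‖
      ≤ η * ((2 * (1 + A)) ^ σ * (2 * (1 + A)) ^ 9) * weight σ 9 z := by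
    rintro q ⟨a, b, ha, hb, hab, rfl⟩
    refine (hf.grad _).trans ?_
    rw [mul_assoc]
    refine mul_le_mul_of_nonneg_left ?_ hη
    set q := a • z2 + b • z1
    set m := a • z' + b • z
    have hqm : ‖m - q‖ ≤ A := by
      have e : m - q = -(a • (z2 - z') + b • (z1 - z)) := by
        simp only [m, q]; module
      rw [e, norm_neg]
      refine (norm_add_le _ _).trans ?_
      rw [norm_smul, norm_smul, Real.norm_of_nonneg ha, Real.norm_of_nonneg hb]
      calc _ ≤ a * A + b * A := by gcongr
        _ = A := by rw [← add_mul, hab, one_mul]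
    have hmz1 : ‖z.1 - m.1‖ ≤ 1 := by
      have e : z.1 - m.1 = a • (z.1 - z'.1) := by
        have : b = 1 - a := by linarith
        simp only [m, Prod.fst_add, Prod.smul_fst, this]; module
      rw [e, norm_smul, Real.norm_of_nonneg ha]
      nlinarith [norm_nonneg (z.1 - z'.1)]
    have hmz2 : ‖z.2 - m.2‖ ≤ 1 / 2 * bracket z.2 := by
      have e : z.2 - m.2 = a • (z.2 - z'.2) := by
        have : b = 1 - a := by linarith
        simp only [m, Prod.snd_add, Prod.smul_snd, this]; module
      rw [e, norm_smul, Real.norm_of_nonneg ha]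
      nlinarith [norm_nonneg (z.2 - z'.2)]
    have hq1 := bracket_le_mul ((norm_fst_le (m - q)).trans hqm)
    have hq2 := bracket_le_mul ((norm_snd_le (m - q)).trans hqm)
    have hm1 := bracket_le_mul hmz1
    have hm2 := bracket_le_add z.2 m.2
    refine weight_le_of_bracket_le hσ 9 (by positivity) (by positivity) ?_ ?_
    · rw [mul_assoc]
      refine hm1.trans ?_
      norm_num only
      gcongr
    · rw [mul_assoc]
      have : bracket z.2 ≤ 2 * bracket m.2 := by linarith
      exact this.trans (by gcongr)
  have h := (convex_segment z2 z1).norm_image_sub_le_of_norm_hasFDerivWithin_le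
    (fun q _ => ((hf.contDiff.differentiable one_ne_zero) q).hasFDerivAt.hasFDerivWithinAt) hseg
    (left_mem_segment ℝ z2 z1) (right_mem_segment ℝ z2 z1)
  rwa [Real.norm_eq_abs] at h

/-- Weighted bounds for the transported datum. -/
lemma exists_pull_bounds (hα : 1 < α) (hM : 0 ≤ M) (hσ : 0 ≤ σ) : ∃ K : ℝ, 0 < K ∧
    ∀ (θ η : ℝ) (f0 : Phase → ℝ) (E : ℝ → R3 → R3), 0 ≤ θ → θ ≤ 1 → IsField α M E →
      IsDatum σ η f0 →
      (∀ t z, |pull θ E f0 t z| ≤ K * η * weight σ 8 z) ∧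
      (∀ t (z z' : Phase), ‖z.1 - z'.1‖ ≤ 1 → ‖z.2 - z'.2‖ ≤ 1 / 2 * bracket z.2 →
        |pull θ E f0 t z - pull θ E f0 t z'| ≤ K * η * weight σ 9 z * ‖z - z'‖) ∧
      (∀ (θ' : ℝ) (E' : ℝ → R3 → R3), 0 ≤ θ' → θ' ≤ 1 → IsField α M E' → ∀ t z,
        |pull θ E f0 t z - pull θ' E' f0 t z|
          ≤ K * η * weight σ 9 z * ‖waveFlow θ E t z 0 - waveFlow θ' E' t z 0‖) := by
  have hτ := totalDecay_nonneg α
  -- A bounds the displacement of every characteristic, D the resulting loss in the weights, and L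
  -- the Lipschitz constant of the flow.
  set A := 2 * M * totalDecay α with hA
  have hA0 : 0 ≤ A := by positivity
  set D := (2 * (1 + A)) ^ σ * (2 * (1 + A)) ^ 9 with hD
  have hD1 : 0 < D := by positivity
  set L := Real.exp (10 * M * totalDecay α) with hL
  have hL1 : 1 ≤ L := Real.one_le_exp (by positivity)
  have hDL : D ≤ D * L := le_mul_of_one_le_right hD1.le hL1
  refine ⟨D * L, by positivity, fun θ η f0 E hθ hθ1 hE hf => ⟨fun t z => ?_,
    fun t z z' h1 h2 => ?_, fun θ' E' hθ' hθ1' hE' t z => ?_⟩⟩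
  · have hη := hf.nonneg_size
    have h := weight_le_of_norm_le hσ 8 (z := waveFlow θ E t z 0) (z' := z) (A := A) (by
      rw [norm_sub_rev]; exact hE.norm_waveFlow_sub_le_totalDecay hα hθ hθ1 t 0 z)
    have hw := weight_nonneg σ 8 z
    have h3 : (1 + A) ^ σ * (1 + A) ^ 8 ≤ D := by
      have h2 : 1 + A ≤ 2 * (1 + A) := by linarith
      have h4 : 1 ≤ 2 * (1 + A) := by linarith
      calc _ ≤ (2 * (1 + A)) ^ σ * (2 * (1 + A)) ^ 8 := by gcongr
        _ ≤ _ := by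
          refine mul_le_mul_of_nonneg_left ?_ (by positivity)
          exact pow_le_pow_right₀ h4 (by norm_num)
    calc _ ≤ η * weight σ 8 (waveFlow θ E t z 0) := hf.bound _
      _ ≤ η * (D * L * weight σ 8 z) := by
          gcongr
          exact h.trans (mul_le_mul_of_nonneg_right (h3.trans hDL) hw)
      _ = _ := by ring
  · have hη := hf.nonneg_size
    have hw := weight_nonneg σ 9 z
    have h := hf.abs_sub_le hσ h1 h2 (hE.norm_waveFlow_sub_le_totalDecay hα hθ hθ1 t 0 z)
      (hE.norm_waveFlow_sub_le_totalDecay hα hθ hθ1 t 0 z')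
    refine h.trans ?_
    have h3 := hE.norm_waveFlow_sub_waveFlow_le hα hθ hθ1 t 0 z z'
    calc _ ≤ η * D * weight σ 9 z * (L * ‖z - z'‖) := by gcongr
      _ = _ := by ring
  · have hη := hf.nonneg_size
    have hw := weight_nonneg σ 9 z
    have hb := bracket_pos z.2
    have h := hf.abs_sub_le hσ (z := z) (z' := z) (by simp) (by simp; positivity)
      (hE.norm_waveFlow_sub_le_totalDecay hα hθ hθ1 t 0 z)
      (hE'.norm_waveFlow_sub_le_totalDecay hα hθ' hθ1' t 0 z)
    refine h.trans ?_
    calc _ ≤ η * (D * L) * weight σ 9 z * ‖waveFlow θ E t z 0 - waveFlow θ' E' t z 0‖ := by gcongr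
      _ = _ := by ring

lemma continuous_pull (hE : IsField α M E) (hα : 0 ≤ α) (hθ : 0 ≤ θ) (hθ1 : θ ≤ 1)
    (hf : Continuous f0) : Continuous fun q : ℝ × Phase => pull θ E f0 q.1 q.2 :=
  hf.comp (hE.continuous_waveFlow hα hθ hθ1 0)

lemma continuous_unstream (θ : ℝ) :
    Continuous fun q : ℝ × Phase => (q.2.1 - q.1 • vel θ q.2.2, q.2.2) :=
  ((continuous_fst.comp continuous_snd).sub (continuous_fst.smul ((continuous_vel θ).comp
    (continuous_snd.comp continuous_snd)))).prodMk (continuous_snd.comp continuous_snd)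

lemma continuous_distr (hE : IsField α M E) (hα : 0 ≤ α) (hθ : 0 ≤ θ) (hθ1 : θ ≤ 1)
    (hf : Continuous f0) : Continuous fun q : ℝ × Phase => distr θ E f0 q.1 q.2 :=
  (continuous_pull hE hα hθ hθ1 hf).comp (continuous_fst.prodMk (continuous_unstream θ))

lemma norm_smul_le_of_abs_le_one (hβ : |β| ≤ 1) (v : R3) : ‖β • v‖ ≤ ‖v‖ := by
  rw [norm_smul, Real.norm_eq_abs]
  exact mul_le_of_le_one_left (norm_nonneg _) hβ

lemma force_sub_force {h h' : Phase → ℝ} {x x' : R3}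
    (hi : Integrable fun z : Phase => h z • k (x - z.1))
    (hi' : Integrable fun z : Phase => h' z • k (x - z.1)) :
    force k β h x - force k β h' x = β • ∫ z : Phase, (h z - h' z) • k (x - z.1) := by
  unfold force
  rw [← smul_sub, ← integral_sub hi hi']
  simp only [sub_smul]

end Datum

/-! ### The field map -/

section FieldMap

variable {α M σ A R : ℝ} {k : R3 → R3}

lemma decay_add_two (α t : ℝ) :
    (1 + |t|) ^ (-(α + 2)) = (1 + |t|)⁻¹ * (1 + |t|) ^ (-(α + 1)) := by
  have h : 0 < 1 + |t| := by positivity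
  have := decay_mul (α + 1) t
  rw [show α + 1 + 1 = α + 2 by ring] at this
  rw [← this]
  field_simp

/-- Boundedness and decay of the field generated by a transported datum. -/
lemma exists_norm_newField_le (hα1 : 1 < α) (hα2 : α < 2) (hσ : 3 < σ)
    (hk : IsKernel α A R k) (hM : 0 ≤ M) : ∃ C : ℝ, 0 < C ∧
    ∀ (θ β η : ℝ) (f0 : Phase → ℝ) (E : ℝ → R3 → R3), 0 ≤ θ → θ ≤ 1 → |β| ≤ 1 →
      IsField α M E → IsDatum σ η f0 → ∀ t x,
      Integrable (fun z : Phase => distr θ E f0 t z • k (x - z.1)) ∧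
      ‖newField k β θ f0 E t x‖ ≤ C * η * (1 + |t|) ^ (-(α + 1)) := by
  obtain ⟨K, hK, hpull⟩ := exists_pull_bounds hα1 hM (by linarith : (0 : ℝ) ≤ σ)
  obtain ⟨C, hC, hfield⟩ := exists_field_bound hα2 hσ hk
  refine ⟨C * K, by positivity, fun θ β η f0 E hθ hθ1 hβ hE hf t x => ?_⟩
  obtain ⟨hb, -, -⟩ := hpull θ η f0 E hθ hθ1 hE hf
  have hη := hf.nonneg_size
  have hm : Measurable (distr θ E f0 t) :=
    ((continuous_distr hE (by linarith) hθ hθ1 hf.contDiff.continuous).comp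
      (continuous_const.prodMk continuous_id)).measurable
  obtain ⟨hi, hle⟩ := hfield θ hθ hθ1 t (K * η) (by positivity) (distr θ E f0 t) hm
    (fun z => hb t _) x
  refine ⟨hi, (norm_smul_le_of_abs_le_one hβ _).trans (hle.trans_eq (by ring))⟩

/-- Spatial Lipschitz bound, with improved decay, for the field of a transported datum. -/
lemma exists_norm_newField_sub_le (hα1 : 1 < α) (hα2 : α < 2) (hσ : 3 < σ)
    (hk : IsKernel α A R k) (hM : 0 ≤ M) : ∃ C : ℝ, 0 < C ∧
    ∀ (θ β η : ℝ) (f0 : Phase → ℝ) (E : ℝ → R3 → R3), 0 ≤ θ → θ ≤ 1 → |β| ≤ 1 →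
      IsField α M E → IsDatum σ η f0 → ∀ t x h,
      ‖newField k β θ f0 E t (x + h) - newField k β θ f0 E t x‖
        ≤ C * η * (1 + |t|) ^ (-(α + 2)) * ‖h‖ := by
  have hσ0 : 0 ≤ σ := by linarith
  obtain ⟨K, hK, hpull⟩ := exists_pull_bounds hα1 hM hσ0
  obtain ⟨C1, hC1, hfield⟩ := exists_field_bound hα2 hσ hk
  obtain ⟨C2, hC2, hfieldv⟩ := exists_field_bound_vel hα2 hσ hk
  obtain ⟨C3, hC3, hnew⟩ := exists_norm_newField_le hα1 hα2 hσ hk hM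
  obtain ⟨C4, hC4, hvel⟩ := exists_abs_velDensity_sub_le hσ0
  refine ⟨4 * C3 + 2 * C2 * C4 * K + 2 * C1 * K, by positivity,
    fun θ β η f0 E hθ hθ1 hβ hE hf t x h => ?_⟩
  obtain ⟨hb, hlip, -⟩ := hpull θ η f0 E hθ hθ1 hE hf
  have hη := hf.nonneg_size
  have hα0 : 0 ≤ α := by linarith
  have ht : 0 < 1 + |t| := by positivity
  set w := (1 + |t|) ^ (-(α + 1)) with hw
  have hw0 : 0 < w := by positivity
  rw [decay_add_two, ← hw]
  have hn := norm_nonneg h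
  suffices hmain : ‖newField k β θ f0 E t (x + h) - newField k β θ f0 E t x‖ * (1 + |t|)
      ≤ (4 * C3 + 2 * C2 * C4 * K + 2 * C1 * K) * η * w * ‖h‖ by
    have e : (4 * C3 + 2 * C2 * C4 * K + 2 * C1 * K) * η * ((1 + |t|)⁻¹ * w) * ‖h‖
        = ((4 * C3 + 2 * C2 * C4 * K + 2 * C1 * K) * η * w * ‖h‖) / (1 + |t|) := by
      field_simp
    rw [e, le_div_iff₀ ht]
    exact hmain
  have hI1 := hnew θ β η f0 E hθ hθ1 hβ hE hf t (x + h)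
  have hI0 := hnew θ β η f0 E hθ hθ1 hβ hE hf t x
  -- For an increment at least of order 1+|t| the sup bound on the field already implies the claim.
  have hfar : 1 + |t| ≤ 2 * ‖h‖ →
      ‖newField k β θ f0 E t (x + h) - newField k β θ f0 E t x‖ * (1 + |t|)
        ≤ (4 * C3 + 2 * C2 * C4 * K + 2 * C1 * K) * η * w * ‖h‖ := fun hh => by
    calc _ ≤ (C3 * η * w + C3 * η * w) * (2 * ‖h‖) := by
          gcongr
          exact (norm_sub_le _ _).trans (add_le_add hI1.2 hI0.2)
      _ = (4 * C3) * η * w * ‖h‖ := by ring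
      _ ≤ _ := by
          gcongr
          have h1 : 0 ≤ 2 * C2 * C4 * K := by positivity
          have h2 : 0 ≤ 2 * C1 * K := by positivity
          linarith
  have hgc : Continuous (pull θ E f0 t) :=
    (continuous_pull hE hα0 hθ hθ1 hf.contDiff.continuous).comp
      (continuous_const.prodMk continuous_id)
  rcases le_or_gt 1 |t| with ht1 | ht1
  · rcases le_or_gt |t| ‖h‖ with hh | hh
    · exact hfar (by linarith)
    · have ht0 : t ≠ 0 := by rintro rfl; simp at ht1; linarith
      have htp : 0 < |t| := abs_pos.2 ht0
      -- As t e = h, translating (y, u) by (h, e) leaves y - t u unchanged. The increment h of the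
      -- field thus becomes an increment h/t of the velocity in the density, and this gains the
      -- factor 1/|t|.
      set e : R3 := t⁻¹ • h with he
      have hen : ‖e‖ = ‖h‖ / |t| := by
        rw [he, norm_smul, norm_inv, Real.norm_eq_abs, inv_mul_eq_div]
      have he1 : ‖e‖ ≤ 1 := by rw [hen, div_le_one htp]; exact hh.le
      have hte : t • e = h := by rw [he, smul_inv_smul₀ ht0]
      set G := velDensity θ (pull θ E f0 t) with hG
      have hGm : Measurable G := measurable_velDensity θ hgc.measurable
      have hG8 : ∀ y u, |G (y, u)| ≤ 2 ^ 8 * (K * η) * weight σ 4 (y, u) := fun y u => by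
        refine (abs_velDensity_le (k := 3) hθ hθ1 (hb t) (by positivity) y u).trans ?_
        have h1 : mfac θ u ^ 3 ≤ 1 := pow_le_one₀ (mfac_nonneg θ u) (mfac_le_one θ u)
        have h2 := weight_anti (σ := σ) (show 4 ≤ 3 + 5 by norm_num) (y, u)
        have h3 := weight_nonneg σ (3 + 5) (y, u)
        calc _ ≤ 2 ^ (3 + 5) * (K * η) * 1 * weight σ 4 (y, u) := by gcongr
          _ = _ := by norm_num
      have hstr : Measurable fun z : Phase => (z.1 - t • z.2, z.2) :=
        (measurable_fst.sub (measurable_snd.const_smul t)).prodMk measurable_snd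
      have hstr' : Measurable fun z : Phase => (z.1 - t • z.2, z.2 + e) :=
        (measurable_fst.sub (measurable_snd.const_smul t)).prodMk (measurable_snd.add_const e)
      have hGi : ∀ x, Integrable (fun z : Phase => G (z.1 - t • z.2, z.2) • k (x - z.1)) :=
        fun x => (hfieldv t (2 ^ 8 * (K * η)) (by positivity) _ (hGm.comp hstr)
          (fun z => hG8 _ _) x).1
      have heq : ∀ x, ∫ z : Phase, distr θ E f0 t z • k (x - z.1)
          = ∫ z : Phase, G (z.1 - t • z.2, z.2) • k (x - z.1) := fun x =>
        integral_smul_kernel_eq_velDensity θ t x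
          (hnew θ β η f0 E hθ hθ1 hβ hE hf t x).1 (hGi x)
      have hshift : ∀ z : Phase, G ((z + (h, e)).1 - t • (z + (h, e)).2, (z + (h, e)).2)
          • k (x + h - (z + (h, e)).1) = G (z.1 - t • z.2, z.2 + e) • k (x - z.1) := fun z => by
        have e1 : (z + (h, e)).1 - t • (z + (h, e)).2 = z.1 - t • z.2 := by
          simp only [Prod.fst_add, Prod.snd_add, smul_add, hte]; abel
        have e2 : x + h - (z + (h, e)).1 = x - z.1 := by
          simp only [Prod.fst_add]; abel
        rw [e1, e2, Prod.snd_add]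
      have hi2 : Integrable fun z : Phase => G (z.1 - t • z.2, z.2 + e) • k (x - z.1) := by
        have := (hGi (x + h)).comp_add_right (h, e)
        refine this.congr (Eventually.of_forall fun z => ?_)
        exact hshift z
      have heq2 : ∫ z : Phase, distr θ E f0 t z • k (x + h - z.1)
          = ∫ z : Phase, G (z.1 - t • z.2, z.2 + e) • k (x - z.1) := by
        rw [heq, ← integral_add_right_eq_self _ (h, e)]
        exact integral_congr_ae (Eventually.of_forall hshift)
      have hdiff : newField k β θ f0 E t (x + h) - newField k β θ f0 E t x
          = β • ∫ z : Phase, (G (z.1 - t • z.2, z.2 + e) - G (z.1 - t • z.2, z.2))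
            • k (x - z.1) := by
        unfold newField force
        rw [heq2, heq, ← smul_sub, ← integral_sub hi2 (hGi x)]
        simp only [sub_smul]
      have hG9 := hvel θ hθ hθ1 (pull θ E f0 t) (K * η) (by positivity) (hb t)
        (fun y p p' hp => by
          have := hlip t (y, p) (y, p') (by simp) hp
          rwa [Prod.mk_sub_mk, sub_self, Prod.norm_mk, norm_zero,
            max_eq_right (norm_nonneg _)] at this)
      have hfin := (hfieldv t (C4 * (K * η) * ‖e‖) (by positivity) _
        ((hGm.comp hstr').sub (hGm.comp hstr)) (fun z => hG9 _ _ _ he1) x).2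
      have h1t : (1 + |t|) * ‖e‖ ≤ 2 * ‖h‖ := by
        rw [hen, mul_div_assoc', div_le_iff₀ htp]
        nlinarith
      rw [hdiff]
      calc _ ≤ (C2 * (C4 * (K * η) * ‖e‖) * w) * (1 + |t|) := by
            gcongr
            exact (norm_smul_le_of_abs_le_one hβ _).trans hfin
        _ = C2 * C4 * K * η * w * ((1 + |t|) * ‖e‖) := by ring
        _ ≤ C2 * C4 * K * η * w * (2 * ‖h‖) := by gcongr
        _ = 2 * C2 * C4 * K * η * w * ‖h‖ := by ring
        _ ≤ _ := by
            gcongr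
            have h2 : 0 ≤ 2 * C1 * K := by positivity
            linarith
  · rcases le_or_gt 1 ‖h‖ with hh | hh
    · exact hfar (by linarith)
    -- For |t| < 1 no decay has to be gained, and the increment is put on the position variable of
    -- the density.
    · have hdm : Measurable (distr θ E f0 t) :=
        ((continuous_distr hE hα0 hθ hθ1 hf.contDiff.continuous).comp
          (continuous_const.prodMk continuous_id)).measurable
      have hshift : ∀ z : Phase, distr θ E f0 t (z + (h, 0)) • k (x + h - (z + (h, 0)).1)
          = distr θ E f0 t (z + (h, 0)) • k (x - z.1) := fun z => by
        have e2 : x + h - (z + (h, 0)).1 = x - z.1 := by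
          simp only [Prod.fst_add]; abel
        rw [e2]
      have hi2 : Integrable fun z : Phase => distr θ E f0 t (z + (h, 0)) • k (x - z.1) :=
        (hI1.1.comp_add_right (h, 0)).congr (Eventually.of_forall hshift)
      have hdiff : newField k β θ f0 E t (x + h) - newField k β θ f0 E t x
          = β • ∫ z : Phase, (distr θ E f0 t (z + (h, 0)) - distr θ E f0 t z) • k (x - z.1) := by
        unfold newField force
        rw [← integral_add_right_eq_self _ ((h, 0) : Phase),
          integral_congr_ae (Eventually.of_forall hshift), ← smul_sub, ← integral_sub hi2 hI0.1]
        simp only [sub_smul]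
      have hfin := (hfield θ hθ hθ1 t (K * η * ‖h‖) (by positivity)
        (fun z => distr θ E f0 t (z + (h, 0)) - distr θ E f0 t z)
        ((hdm.comp (measurable_id.add_const _)).sub hdm) (fun z => by
          have h1 := hlip t (z.1 - t • vel θ z.2, z.2) (z.1 + h - t • vel θ z.2, z.2)
            (by
              have : z.1 - t • vel θ z.2 - (z.1 + h - t • vel θ z.2) = -h := by abel
              rw [this, norm_neg]; exact hh.le) (by
              have := bracket_pos z.2
              simp; positivity)
          have e1 : ((z.1 - t • vel θ z.2, z.2) : Phase) - (z.1 + h - t • vel θ z.2, z.2)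
              = (-h, 0) := by
            ext1
            · simp
            · simp
          rw [e1, Prod.norm_mk, norm_neg, norm_zero, max_eq_left (norm_nonneg _), abs_sub_comm]
            at h1
          have h2 := weight_anti (σ := σ) (show 8 ≤ 9 by norm_num) (z.1 - t • vel θ z.2, z.2)
          have h3 : distr θ E f0 t (z + (h, 0))
              = pull θ E f0 t (z.1 + h - t • vel θ z.2, z.2) := by
            simp [distr]
          rw [h3]
          calc _ ≤ K * η * weight σ 9 (z.1 - t • vel θ z.2, z.2) * ‖h‖ := h1
            _ ≤ K * η * weight σ 8 (z.1 - t • vel θ z.2, z.2) * ‖h‖ := by gcongr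
            _ = _ := by ring) x).2
      rw [hdiff]
      calc _ ≤ (C1 * (K * η * ‖h‖) * w) * 2 := by
            gcongr
            · exact (norm_smul_le_of_abs_le_one hβ _).trans hfin
            · linarith
        _ = 2 * C1 * K * η * w * ‖h‖ := by ring
        _ ≤ _ := by
            gcongr
            have h2 : 0 ≤ 2 * C2 * C4 * K := by positivity
            linarith

/-- The field map preserves the class of dispersing fields. -/
lemma exists_isField_newField (hα1 : 1 < α) (hα2 : α < 2) (hσ : 3 < σ) (hσ4 : σ ≤ 4)
    (hk : IsKernel α A R k) (hM : 0 ≤ M) : ∃ C : ℝ, 0 < C ∧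
    ∀ (θ β η : ℝ) (f0 : Phase → ℝ) (E : ℝ → R3 → R3), 0 ≤ θ → θ ≤ 1 → |β| ≤ 1 →
      IsField α M E → IsDatum σ η f0 → IsField α (C * η) (newField k β θ f0 E) := by
  obtain ⟨C1, hC1, h1⟩ := exists_norm_newField_le hα1 hα2 hσ hk hM
  obtain ⟨C2, hC2, h2⟩ := exists_norm_newField_sub_le hα1 hα2 hσ hk hM
  obtain ⟨K, hK, hpull⟩ := exists_pull_bounds hα1 hM (by linarith : (0 : ℝ) ≤ σ)
  refine ⟨C1 + C2, by positivity, fun θ β η f0 E hθ hθ1 hβ hE hf => ⟨?_, fun t x => ?_,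
    fun t x y => ?_⟩⟩
  · have hη := hf.nonneg_size
    have hb := (hpull θ η f0 E hθ hθ1 hE hf).1
    have hc := continuous_field (h := distr θ E f0) (δ := K * η) hσ hσ4 hk θ
      (continuous_distr hE (by linarith) hθ hθ1 hf.contDiff.continuous) (by positivity)
      (fun t z => hb t _)
    exact hc.const_smul β
  · have hη := hf.nonneg_size
    refine (h1 θ β η f0 E hθ hθ1 hβ hE hf t x).2.trans ?_
    gcongr
    linarith
  · have hη := hf.nonneg_size
    have h := h2 θ β η f0 E hθ hθ1 hβ hE hf t y (x - y)
    rw [add_sub_cancel] at h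
    refine h.trans ?_
    gcongr
    linarith

/-- Dependence of the generated field on the generating field. -/
lemma exists_norm_newField_sub_newField_le (hα1 : 1 < α) (hα2 : α < 2) (hσ : 3 < σ)
    (hk : IsKernel α A R k) (hM : 0 ≤ M) : ∃ C : ℝ, 0 < C ∧
    ∀ (θ β η : ℝ) (f0 : Phase → ℝ) (E E' : ℝ → R3 → R3), 0 ≤ θ → θ ≤ 1 → |β| ≤ 1 →
      IsField α M E → IsField α M E' → IsDatum σ η f0 → ∀ (t D : ℝ), 0 ≤ D →
      (∀ z, ‖waveFlow θ E t z 0 - waveFlow θ E' t z 0‖ ≤ D) → ∀ x,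
      ‖newField k β θ f0 E t x - newField k β θ f0 E' t x‖
        ≤ C * η * D * (1 + |t|) ^ (-(α + 1)) := by
  obtain ⟨K, hK, hpull⟩ := exists_pull_bounds hα1 hM (by linarith : (0 : ℝ) ≤ σ)
  obtain ⟨C1, hC1, hfield⟩ := exists_field_bound hα2 hσ hk
  obtain ⟨C3, hC3, hnew⟩ := exists_norm_newField_le hα1 hα2 hσ hk hM
  refine ⟨C1 * K, by positivity, fun θ β η f0 E E' hθ hθ1 hβ hE hE' hf t D hD hΩ x => ?_⟩
  have hη := hf.nonneg_size
  have hα0 : 0 ≤ α := by linarith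
  have hdiff := (hpull θ η f0 E hθ hθ1 hE hf).2.2 θ E' hθ hθ1 hE' t
  have hm : ∀ {E}, IsField α M E → Measurable (distr θ E f0 t) := fun hE =>
    ((continuous_distr hE hα0 hθ hθ1 hf.contDiff.continuous).comp
      (continuous_const.prodMk continuous_id)).measurable
  unfold newField
  rw [force_sub_force (x' := x) (hnew θ β η f0 E hθ hθ1 hβ hE hf t x).1
    (hnew θ β η f0 E' hθ hθ1 hβ hE' hf t x).1]
  refine (norm_smul_le_of_abs_le_one hβ _).trans ?_
  refine ((hfield θ hθ hθ1 t (K * η * D) (by positivity) _ ((hm hE).sub (hm hE'))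
    (fun z => ?_) x).2).trans_eq (by ring)
  refine (hdiff _).trans ?_
  have h2 := weight_anti (σ := σ) (show 8 ≤ 9 by norm_num) (z.1 - t • vel θ z.2, z.2)
  have h9 := weight_nonneg σ 9 (z.1 - t • vel θ z.2, z.2)
  have h8 := weight_nonneg σ 8 (z.1 - t • vel θ z.2, z.2)
  calc _ ≤ K * η * weight σ 8 (z.1 - t • vel θ z.2, z.2) * D := by
        gcongr
        exact hΩ _
    _ = _ := by ring

/-- Dependence of the generated field on the speed of light. -/
lemma exists_norm_newField_sub_newField_zero_le (hα1 : 1 < α) (hα2 : α < 2) (hσ : 3 < σ)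
    (hk : IsKernel α A R k) (hM : 0 ≤ M) : ∃ C : ℝ, 0 < C ∧
    ∀ (θ β η : ℝ) (f0 : Phase → ℝ) (E E' : ℝ → R3 → R3), 0 ≤ θ → θ ≤ 1 → |β| ≤ 1 →
      IsField α M E → IsField α M E' → IsDatum σ η f0 → ∀ (t D : ℝ), 0 ≤ D →
      (∀ z : Phase, ‖waveFlow θ E t z 0 - waveFlow 0 E' t z 0‖ ≤ D * bracket z.2 ^ 3) → ∀ x,
      ‖newField k β θ f0 E t x - newField k β 0 f0 E' t x‖
        ≤ C * η * (D + θ ^ 2) * (1 + |t|) ^ (-(α + 1)) := by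
  obtain ⟨K, hK, hpull⟩ := exists_pull_bounds hα1 hM (by linarith : (0 : ℝ) ≤ σ)
  obtain ⟨C1, hC1, hfield⟩ := exists_field_bound_vel hα2 hσ hk
  obtain ⟨C3, hC3, hnew⟩ := exists_norm_newField_le hα1 hα2 hσ hk hM
  obtain ⟨C4, hC4, hvel⟩ := exists_abs_velDensity_sub_zero_le
  refine ⟨C1 * (2 ^ 6 * K + C4 * K), by positivity,
    fun θ β η f0 E E' hθ hθ1 hβ hE hE' hf t D hD hΩ x => ?_⟩
  have hη := hf.nonneg_size
  have hα0 : 0 ≤ α := by linarith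
  obtain ⟨hb, -, hdiff⟩ := hpull θ η f0 E hθ hθ1 hE hf
  obtain ⟨hb', hlip', -⟩ := hpull 0 η f0 E' le_rfl zero_le_one hE' hf
  have hstr : Measurable fun z : Phase => (z.1 - t • z.2, z.2) :=
    (measurable_fst.sub (measurable_snd.const_smul t)).prodMk measurable_snd
  have hgm : ∀ {θ E}, 0 ≤ θ → θ ≤ 1 → IsField α M E → Measurable (pull θ E f0 t) :=
    fun hθ hθ1 hE => ((continuous_pull hE hα0 hθ hθ1 hf.contDiff.continuous).comp
      (continuous_const.prodMk continuous_id)).measurable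
  have hG8 : ∀ {θ E}, 0 ≤ θ → θ ≤ 1 → (∀ z, |pull θ E f0 t z| ≤ K * η * weight σ 8 z) →
      ∀ y u, |velDensity θ (pull θ E f0 t) (y, u)| ≤ 2 ^ 8 * (K * η) * weight σ 4 (y, u) :=
    fun {θ E} hθ hθ1 hb y u => by
      refine (abs_velDensity_le (k := 3) hθ hθ1 hb (by positivity) y u).trans ?_
      have h1 : mfac θ u ^ 3 ≤ 1 := pow_le_one₀ (mfac_nonneg θ u) (mfac_le_one θ u)
      have h2 := weight_anti (σ := σ) (show 4 ≤ 3 + 5 by norm_num) (y, u)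
      have h3 := weight_nonneg σ (3 + 5) (y, u)
      calc _ ≤ 2 ^ (3 + 5) * (K * η) * 1 * weight σ 4 (y, u) := by gcongr
        _ = _ := by norm_num
  have hGm := measurable_velDensity θ (hgm hθ hθ1 hE)
  have hGm' := measurable_velDensity 0 (hgm le_rfl zero_le_one hE')
  have hGi : Integrable fun z : Phase =>
      velDensity θ (pull θ E f0 t) (z.1 - t • z.2, z.2) • k (x - z.1) :=
    (hfield t (2 ^ 8 * (K * η)) (by positivity) _ (hGm.comp hstr)
    (fun z => hG8 hθ hθ1 (hb t) _ _) x).1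
  have hGi' : Integrable fun z : Phase =>
      velDensity 0 (pull 0 E' f0 t) (z.1 - t • z.2, z.2) • k (x - z.1) :=
    (hfield t (2 ^ 8 * (K * η)) (by positivity) _ (hGm'.comp hstr)
    (fun z => hG8 le_rfl zero_le_one (hb' t) _ _) x).1
  have heq := integral_smul_kernel_eq_velDensity θ t x (hnew θ β η f0 E hθ hθ1 hβ hE hf t x).1 hGi
  have heq' := integral_smul_kernel_eq_velDensity 0 t x
    (hnew 0 β η f0 E' le_rfl zero_le_one hβ hE' hf t x).1 hGi'
  have hsub : newField k β θ f0 E t x - newField k β 0 f0 E' t x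
      = β • ∫ z : Phase, (velDensity θ (pull θ E f0 t) (z.1 - t • z.2, z.2)
        - velDensity 0 (pull 0 E' f0 t) (z.1 - t • z.2, z.2)) • k (x - z.1) := by
    simp only [sub_smul]
    rw [integral_sub hGi hGi', smul_sub]
    unfold newField force distr
    rw [heq, heq']
  rw [hsub]
  refine (norm_smul_le_of_abs_le_one hβ _).trans ?_
  refine ((hfield t ((2 ^ 6 * K + C4 * K) * η * (D + θ ^ 2)) (by positivity) _
    ((hGm.comp hstr).sub (hGm'.comp hstr)) (fun z => ?_) x).2).trans_eq (by ring)
  set y := z.1 - t • z.2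
  set u := z.2
  -- The comparison goes through the classical transported datum with the relativistic Jacobian.
  -- Changing the flow costs ⟨p⟩³ and reduces nine powers to six, still one more than the Jacobian
  -- needs; changing θ afterwards costs θ².
  have h6 : ∀ z, |pull θ E f0 t z - pull 0 E' f0 t z| ≤ K * η * D * weight σ 6 z := fun z => by
    have hw9 := weight_nonneg σ 9 z
    have e := bracket_pow_mul_weight σ 3 6 z
    norm_num only at e
    calc _ ≤ K * η * weight σ 9 z * (D * bracket z.2 ^ 3) :=
          (hdiff 0 E' le_rfl zero_le_one hE' t z).trans (by gcongr; exact hΩ z)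
      _ = K * η * D * (bracket z.2 ^ 3 * weight σ 9 z) := by ring
      _ = _ := by rw [e]
  have a1 : |velDensity θ (pull θ E f0 t) (y, u) - velDensity θ (pull 0 E' f0 t) (y, u)|
      ≤ 2 ^ 6 * (K * η * D) * weight σ 4 (y, u) := by
    have h := abs_velDensity_le (k := 1) (g := fun z => pull θ E f0 t z - pull 0 E' f0 t z) hθ hθ1
      h6 (by positivity) y u
    have e : velDensity θ (fun z => pull θ E f0 t z - pull 0 E' f0 t z) (y, u)
        = velDensity θ (pull θ E f0 t) (y, u) - velDensity θ (pull 0 E' f0 t) (y, u) := by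
      simp only [velDensity]; ring
    rw [e] at h
    have h1 : mfac θ u ^ 1 ≤ 1 := pow_le_one₀ (mfac_nonneg θ u) (mfac_le_one θ u)
    have h2 := weight_anti (σ := σ) (show 4 ≤ 1 + 5 by norm_num) (y, u)
    have h3 := weight_nonneg σ (1 + 5) (y, u)
    refine h.trans ?_
    calc _ ≤ 2 ^ (1 + 5) * (K * η * D) * 1 * weight σ 4 (y, u) := by gcongr
      _ = _ := by norm_num
  have a2 := hvel σ θ hθ hθ1 (pull 0 E' f0 t) (K * η) (by positivity) (hb' t)
    (fun y p p' hp => by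
      have := hlip' t (y, p) (y, p') (by simp) hp
      rwa [Prod.mk_sub_mk, sub_self, Prod.norm_mk, norm_zero,
        max_eq_right (norm_nonneg _)] at this) y u
  calc _ ≤ |velDensity θ (pull θ E f0 t) (y, u) - velDensity θ (pull 0 E' f0 t) (y, u)|
        + |velDensity θ (pull 0 E' f0 t) (y, u) - velDensity 0 (pull 0 E' f0 t) (y, u)| :=
        abs_sub_le _ _ _
    _ ≤ 2 ^ 6 * (K * η * D) * weight σ 4 (y, u)
        + C4 * (K * η) * θ ^ 2 * weight σ 4 (y, u) := add_le_add a1 a2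
    _ ≤ _ := by
        have hw := weight_nonneg σ 4 (y, u)
        have q1 : 0 ≤ K * η * θ ^ 2 * weight σ 4 (y, u) := by positivity
        have q2 : 0 ≤ C4 * (K * η * D) * weight σ 4 (y, u) := by positivity
        nlinarith

end FieldMap

end Vlasov

end

noncomputable section

namespace Vlasov

/-! ### Differentiability of flows -/

section FlowRegularity

/-- Strict differentiability at x makes f - f'(x) Lipschitz with an arbitrarily small constant near
x, and this constant bounds ‖f'(y) - f'(x)‖ for y near x. -/
lemma contDiff_one_of_hasStrictFDerivAt {V W : Type*} [NormedAddCommGroup V] [NormedSpace ℝ V]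
    [NormedAddCommGroup W] [NormedSpace ℝ W] {f : V → W} {f' : V → V →L[ℝ] W}
    (hf : ∀ x, HasStrictFDerivAt f (f' x) x) : ContDiff ℝ 1 f := by
  refine contDiff_one_iff_hasFDerivAt.2 ⟨f', ?_, fun x => (hf x).hasFDerivAt⟩
  rw [continuous_iff_continuousAt]
  refine fun x => Metric.continuousAt_iff'.2 fun ε hε => ?_
  have hc : (0 : ℝ) < ε / 2 := by positivity
  obtain ⟨s, hs, hlip⟩ := (hf x).approximates_deriv_on_nhds
    (c := ⟨ε / 2, hc.le⟩) (Or.inr hc)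
  filter_upwards [eventually_mem_nhds_iff.2 hs] with y hy
  rw [dist_eq_norm]
  have h1 : HasFDerivAt (fun z => f z - f' x z) (f' y - f' x) y :=
    (hf y).hasFDerivAt.sub (f' x).hasFDerivAt
  have h2 := h1.le_of_lip' hc.le (by
    filter_upwards [hy] with z hz
    have := hlip z hz y (mem_of_mem_nhds hy)
    rw [map_sub] at this
    rw [show f z - f' x z - (f y - f' x y) = f z - f y - (f' x z - f' x y) by abel]
    exact this)
  linarith

variable {V : Type*} [NormedAddCommGroup V] [NormedSpace ℝ V] [CompleteSpace V] {K : NNReal}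
  {B : ℝ} {b : ℝ → V → V} {D : ℝ → V → V →L[ℝ] V}

/-- Short-time solution of the linearized equation. -/
lemma exists_linear_solution {L : ℝ → V →L[ℝ] V} (hL : Continuous L) (hK : ∀ s, ‖L s‖ ≤ K)
    (t : ℝ) : ∃ A : ℝ → V →L[ℝ] V, A t = ContinuousLinearMap.id ℝ V ∧
      ∀ s, |s - t| < (2 * (K : ℝ) + 1)⁻¹ → HasDerivAt A ((L s).comp (A s)) s := by
  -- On the unit ball about the identity ‖A‖ ≤ 2, so the linear field is at most 2K, and a time with
  -- 2KT ≤ 1 keeps the solution in that ball. The summand 1 covers K = 0.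
  set T : ℝ := (2 * (K : ℝ) + 1)⁻¹ with hT
  have hT0 : 0 < T := by positivity
  have hpl : IsPicardLindelof (fun s (A : V →L[ℝ] V) => (L s).comp A) (tmin := t - T)
      (tmax := t + T) ⟨t, by constructor <;> linarith⟩ (ContinuousLinearMap.id ℝ V) 1 0
      (2 * K) K := by
    refine ⟨fun s _ => ?_, fun A _ => ?_, fun s _ A hA => ?_, ?_⟩
    · refine (LipschitzWith.of_dist_le_mul fun A A' => ?_).lipschitzOnWith
      rw [dist_eq_norm, dist_eq_norm, ← ContinuousLinearMap.comp_sub]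
      exact (ContinuousLinearMap.opNorm_comp_le _ _).trans (by gcongr; exact hK s)
    · exact (hL.clm_comp continuous_const).continuousOn
    · rw [mem_closedBall_iff_norm] at hA
      have h1 : ‖A‖ ≤ 2 := by
        have h2 := norm_sub_norm_le A (ContinuousLinearMap.id ℝ V)
        have h3 := ContinuousLinearMap.norm_id_le (𝕜 := ℝ) (E := V)
        simp only [NNReal.coe_one] at hA
        linarith
      refine (ContinuousLinearMap.opNorm_comp_le _ _).trans ?_
      push_cast
      calc _ ≤ (K : ℝ) * 2 := by gcongr; exact hK s
        _ = _ := by ring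
    · simp only [add_sub_cancel_left, sub_sub_cancel, max_self, NNReal.coe_zero, sub_zero]
      push_cast
      rw [hT, ← div_eq_mul_inv, div_le_one (by positivity)]
      linarith
  obtain ⟨A, hA0, hA⟩ := hpl.exists_eq_forall_mem_Icc_hasDerivWithinAt₀
  refine ⟨A, hA0, fun s hs => ?_⟩
  obtain ⟨h1, h2⟩ := abs_lt.1 hs
  exact (hA s ⟨by linarith, by linarith⟩).hasDerivAt (Icc_mem_nhds (by linarith) (by linarith))

namespace IsBoundedLipschitz

/-- The difference of two nearby trajectories solves the equation linearized along the central one,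
up to an error that is small relative to their distance: D is uniformly close to its values along
the compact central trajectory. Grönwall's inequality compares it with the linear solution. -/
lemma hasStrictFDerivAt_flow_of_short (hb : IsBoundedLipschitz K B b)
    (hD : ∀ t z, HasFDerivAt (b t) (D t z) z) (hDc : Continuous fun q : ℝ × V => D q.1 q.2)
    {t s : ℝ} (hts : |s - t| < (2 * (K : ℝ) + 1)⁻¹) (z₀ : V) :
    ∃ A : V →L[ℝ] V, HasStrictFDerivAt (fun z => odeFlow b t z s) A z₀ := by
  set Z₀ := odeFlow b t z₀ with hZ₀
  have hZc : Continuous Z₀ :=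
    continuous_iff_continuousAt.2 fun u => (hb.hasDerivAt_flow t z₀ u).continuousAt
  have hDK : ∀ u z, ‖D u z‖ ≤ K := fun u z => (hD u z).le_of_lipschitz (hb.lipschitz u)
  obtain ⟨A, hA0, hA⟩ := exists_linear_solution (L := fun u => D u (Z₀ u))
    (hDc.comp (continuous_id.prodMk hZc)) (fun u => hDK u _) t
  have huT : ∀ u ∈ uIcc t s, |u - t| ≤ |s - t| := fun u hu => abs_sub_left_of_mem_uIcc hu
  set e := Real.exp (K * |s - t|) with he
  have he1 : 0 < e := Real.exp_pos _
  refine ⟨A s, .of_isLittleO <| Asymptotics.isLittleO_iff.2 fun c hc => ?_⟩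
  -- One factor e is the expansion of the distance of the trajectories, the other is Grönwall's
  -- factor, and |s - t| is the length of the interval on which the error accumulates.
  set ε := c / (e * (|s - t| + 1) * e) with hε
  have hε0 : 0 < ε := by positivity
  have hunif : ∀ᶠ y in 𝓝 (0 : V), ∀ u ∈ uIcc t s, ‖D u (Z₀ u + y) - D u (Z₀ u)‖ < ε := by
    refine isCompact_uIcc.eventually_forall_of_forall_eventually fun u _ => ?_
    have hcont : Continuous fun q : V × ℝ => ‖D q.2 (Z₀ q.2 + q.1) - D q.2 (Z₀ q.2)‖ :=
      ((hDc.comp (continuous_snd.prodMk ((hZc.comp continuous_snd).add continuous_fst))).sub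
        (hDc.comp (continuous_snd.prodMk (hZc.comp continuous_snd)))).norm
    have := hcont.tendsto (0, u)
    simp only [add_zero, sub_self, norm_zero] at this
    exact this.eventually (gt_mem_nhds hε0)
  obtain ⟨r, hr, hball⟩ := Metric.eventually_nhds_iff.1 hunif
  have hclose : ∀ᶠ z in 𝓝 z₀, ‖z - z₀‖ * e < r := by
    have hcont : Continuous fun z : V => ‖z - z₀‖ * e := by fun_prop
    have := hcont.tendsto z₀
    simp only [sub_self, norm_zero, zero_mul] at this
    exact this.eventually (gt_mem_nhds hr)
  rw [nhds_prod_eq]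
  filter_upwards [hclose.prod_mk hclose] with ⟨z, z'⟩ ⟨hz, hz'⟩
  simp only at hz hz' ⊢
  have hflow : ∀ (x y : V), ∀ u ∈ uIcc t s,
      ‖odeFlow b t x u - odeFlow b t y u‖ ≤ ‖x - y‖ * e := fun x y u hu => by
    refine (hb.norm_flow_sub_flow_le t u x y).trans ?_
    have := mul_le_mul_of_nonneg_left (huT u hu) K.2
    exact mul_le_mul_of_nonneg_left (Real.exp_le_exp.2 this) (norm_nonneg _)
  have hg := gronwall_uIcc (a := t) (t := s)
    (f := fun u => odeFlow b t z u - odeFlow b t z' u - A u (z - z'))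
    (f' := fun u => b u (odeFlow b t z u) - b u (odeFlow b t z' u)
      - D u (Z₀ u) (A u (z - z'))) (l := fun _ => K) (L := fun u => K * u)
    (r := fun _ => ε * (‖z - z'‖ * e)) (R := fun u => ε * (‖z - z'‖ * e) * u)
    (fun u hu => ((hb.hasDerivAt_flow t z u).sub (hb.hasDerivAt_flow t z' u)).sub
      (by
        have := (hA u ((huT u hu).trans_lt hts)).clm_apply (hasDerivAt_const u (z - z'))
        simpa using this))
    (fun _ => K.2) (fun u => by simpa using (hasDerivAt_id u).const_mul (K : ℝ))
    (fun _ => by positivity)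
    (fun u => by simpa using (hasDerivAt_id u).const_mul (ε * (‖z - z'‖ * e)))
    (fun u hu => by
      have hx : ∀ x, ‖x - z₀‖ * e < r → odeFlow b t x u ∈ Metric.ball (Z₀ u) r := fun x hx => by
        rw [mem_ball_iff_norm]
        exact (hflow x z₀ u hu).trans_lt hx
      have hmv := (convex_ball (Z₀ u) r).norm_image_sub_le_of_norm_hasFDerivWithin_le'
        (f := b u) (f' := D u) (φ := D u (Z₀ u)) (C := ε)
        (fun y _ => (hD u y).hasFDerivWithinAt) (fun y hy => by
          have := hball (y := y - Z₀ u) (by rwa [dist_zero_right, ← mem_ball_iff_norm]) u hu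
          rw [add_sub_cancel] at this
          exact this.le) (hx z' hz') (hx z hz)
      set F := odeFlow b t z u - odeFlow b t z' u - A u (z - z')
      have hFe : b u (odeFlow b t z u) - b u (odeFlow b t z' u) - D u (Z₀ u) (A u (z - z'))
          = (b u (odeFlow b t z u) - b u (odeFlow b t z' u)
            - D u (Z₀ u) (odeFlow b t z u - odeFlow b t z' u)) + D u (Z₀ u) F := by
        simp only [F, map_sub]; abel
      rw [hFe]
      refine (norm_add_le _ _).trans ?_
      rw [add_comm]
      refine add_le_add ((ContinuousLinearMap.le_opNorm _ _).trans ?_) (hmv.trans ?_)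
      · gcongr; exact hDK u _
      · gcongr; exact hflow z z' u hu)
  simp only [hb.flow_self, hA0, ContinuousLinearMap.id_apply, sub_self, norm_zero, zero_add,
    ← mul_sub, abs_mul, NNReal.abs_eq] at hg
  rw [← he, abs_of_nonneg hε0.le, abs_of_nonneg (norm_nonneg _), abs_of_pos he1] at hg
  refine hg.trans ?_
  calc ε * (‖z - z'‖ * e) * |s - t| * e = ε * (e * |s - t| * e) * ‖z - z'‖ := by ring
    _ ≤ ε * (e * (|s - t| + 1) * e) * ‖z - z'‖ := by gcongr; linarith
    _ = c * ‖z - z'‖ := by rw [hε, div_mul_cancel₀ _ (by positivity)]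

/-- The flow of a `C¹` vector field is strictly differentiable in the initial point. -/
lemma exists_hasStrictFDerivAt_flow (hb : IsBoundedLipschitz K B b)
    (hD : ∀ t z, HasFDerivAt (b t) (D t z) z) (hDc : Continuous fun q : ℝ × V => D q.1 q.2)
    (t s : ℝ) (z₀ : V) :
    ∃ A : V →L[ℝ] V, HasStrictFDerivAt (fun z => odeFlow b t z s) A z₀ := by
  set h : ℝ := (2 * (K : ℝ) + 1)⁻¹ / 2 with hh
  have hh0 : 0 < h := by positivity
  have hhlt : h < (2 * (K : ℝ) + 1)⁻¹ := half_lt_self (by positivity)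
  have main : ∀ (n : ℕ) (t : ℝ) (z₀ : V), |s - t| ≤ n * h →
      ∃ A : V →L[ℝ] V, HasStrictFDerivAt (fun z => odeFlow b t z s) A z₀ := by
    intro n
    induction n with
    | zero =>
      intro t z₀ ht
      refine hb.hasStrictFDerivAt_flow_of_short hD hDc (ht.trans_lt ?_) z₀
      simp; positivity
    | succ n ih =>
      intro t z₀ ht
      -- One short step to r is followed by n remaining ones; the chain rule and the group property
      -- combine them.
      set r := t + (s - t) / (n + 1) with hr
      have hn : (0 : ℝ) < n + 1 := by positivity
      have h1 : |r - t| < (2 * (K : ℝ) + 1)⁻¹ := by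
        rw [hr, add_sub_cancel_left, abs_div, abs_of_pos hn]
        refine lt_of_le_of_lt ?_ hhlt
        rw [div_le_iff₀ hn]
        push_cast at ht
        linarith
      have h2 : |s - r| ≤ n * h := by
        have e : s - r = (s - t) * (n / (n + 1)) := by
          rw [hr]; field_simp; ring
        rw [e, abs_mul, abs_of_nonneg (by positivity : (0 : ℝ) ≤ n / (n + 1)), mul_div_assoc',
          div_le_iff₀ hn]
        push_cast at ht
        nlinarith [(Nat.cast_nonneg n : (0 : ℝ) ≤ n)]
      obtain ⟨A, hA⟩ := hb.hasStrictFDerivAt_flow_of_short hD hDc h1 z₀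
      obtain ⟨A', hA'⟩ := ih r (odeFlow b t z₀ r) h2
      refine ⟨A'.comp A, ?_⟩
      have := hA'.comp z₀ hA
      refine this.congr_of_eventuallyEq (Eventually.of_forall fun z => ?_)
      exact hb.flow_flow t r s z
  obtain ⟨n, hn⟩ := exists_nat_ge (|s - t| / h)
  exact main n t z₀ (by rwa [div_le_iff₀ hh0] at hn)

/-- Joint differentiability in time and point is needed only here, where initial and final time
agree. Starting later by τ changes the value at time t₀ by -τ b(t₀, z₀) to first order. -/
lemma hasStrictFDerivAt_flow_self (hb : IsBoundedLipschitz K B b) (t₀ : ℝ) (z₀ : V) :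
    HasStrictFDerivAt (fun q : ℝ × V => odeFlow b q.1 q.2 t₀)
      (ContinuousLinearMap.snd ℝ ℝ V
        - (ContinuousLinearMap.fst ℝ ℝ V).smulRight (b t₀ z₀)) (t₀, z₀) := by
  have hB : 0 ≤ B := (norm_nonneg _).trans (hb.bound 0 z₀)
  refine .of_isLittleO <| Asymptotics.isLittleO_iff.2 fun c hc => ?_
  set ε := c / 2 with hε
  have hε0 : 0 < ε := by positivity
  have hb0 : ∀ᶠ q : ℝ × V in 𝓝 (t₀, z₀), ‖b q.1 q.2 - b t₀ z₀‖ < ε := by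
    have := ((hb.continuous.sub (continuous_const (y := b t₀ z₀))).norm).tendsto (t₀, z₀)
    simp only [Pi.sub_apply, sub_self, norm_zero] at this
    exact this.eventually (gt_mem_nhds hε0)
  obtain ⟨r, hr, hball⟩ := Metric.eventually_nhds_iff.1 hb0
  have hev1 : ∀ᶠ q : ℝ × V in 𝓝 (t₀, z₀),
      ‖q.2 - z₀‖ + (2 * B + 1) * |q.1 - t₀| < r / 2 := by
    have hcont : Continuous fun q : ℝ × V => ‖q.2 - z₀‖ + (2 * B + 1) * |q.1 - t₀| := by fun_prop
    have := hcont.tendsto (t₀, z₀)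
    simp only [sub_self, norm_zero, abs_zero, mul_zero, add_zero] at this
    exact this.eventually (gt_mem_nhds (by positivity))
  have hev2 : ∀ᶠ q : ℝ × V in 𝓝 (t₀, z₀),
      (1 + B) * (K * Real.exp (K * |q.1 - t₀|) * |q.1 - t₀|) < ε := by
    have hcont : Continuous fun q : ℝ × V =>
      (1 + B) * (K * Real.exp (K * |q.1 - t₀|) * |q.1 - t₀|) := by fun_prop
    have := hcont.tendsto (t₀, z₀)
    simp only [sub_self, abs_zero, mul_zero] at this
    exact this.eventually (gt_mem_nhds hε0)
  rw [nhds_prod_eq]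
  filter_upwards [hev1.prod_mk hev1, hev2.prod_mk hev2] with ⟨⟨t₁, z₁⟩, ⟨t₂, z₂⟩⟩ ⟨h1, h2⟩ ⟨_, h3⟩
  -- Carrying the first datum to the second initial time separates the two effects: a short
  -- trajectory from z₁ to y, approximated by a straight one, and the flow over the short time from
  -- t₂ to t₀, close to the identity.
  set y := odeFlow b t₁ z₁ t₂ with hy
  have hstep : ‖y - z₁ - (t₂ - t₁) • b t₀ z₀‖ ≤ ε * |t₂ - t₁| := by
    have hderiv : ∀ u ∈ uIcc t₁ t₂, HasDerivWithinAt
        (fun u => odeFlow b t₁ z₁ u - u • b t₀ z₀)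
        (b u (odeFlow b t₁ z₁ u) - b t₀ z₀) (uIcc t₁ t₂) u := fun u _ => by
      have := (hb.hasDerivAt_flow t₁ z₁ u).sub ((hasDerivAt_id u).smul_const (b t₀ z₀))
      simp only [one_smul] at this
      exact this.hasDerivWithinAt
    have h := (convex_uIcc t₁ t₂).norm_image_sub_le_of_norm_hasDerivWithin_le hderiv
      (C := ε) (fun u hu => by
        refine (hball (y := (u, odeFlow b t₁ z₁ u)) ?_).le
        have hu1 : |u - t₀| ≤ |t₁ - t₀| + |t₂ - t₀| := by
          rcases mem_uIcc.1 hu with ⟨a1, a2⟩ | ⟨a1, a2⟩ <;>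
          · rw [abs_le]
            constructor <;> linarith [neg_abs_le (t₁ - t₀), neg_abs_le (t₂ - t₀),
              le_abs_self (t₁ - t₀), le_abs_self (t₂ - t₀), abs_nonneg (t₁ - t₀),
              abs_nonneg (t₂ - t₀)]
        have hu2 : |u - t₁| ≤ |t₁ - t₀| + |t₂ - t₀| := by
          refine (abs_sub_left_of_mem_uIcc hu).trans ?_
          rw [show t₂ - t₁ = (t₂ - t₀) - (t₁ - t₀) by ring]
          exact (abs_sub _ _).trans (by linarith)
        have hfl := hb.norm_flow_sub_le t₁ u z₁
        have hn : ‖odeFlow b t₁ z₁ u - z₀‖ ≤ B * |u - t₁| + ‖z₁ - z₀‖ := by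
          calc _ = ‖(odeFlow b t₁ z₁ u - z₁) + (z₁ - z₀)‖ := by congr 1; abel
            _ ≤ _ := (norm_add_le _ _).trans (by gcongr)
        have hBu := mul_le_mul_of_nonneg_left hu2 hB
        have p1 := abs_nonneg (t₁ - t₀)
        have p2 := abs_nonneg (t₂ - t₀)
        have p3 := norm_nonneg (z₁ - z₀)
        have p4 := norm_nonneg (z₂ - z₀)
        have p5 := mul_nonneg hB p1
        have p6 := mul_nonneg hB p2
        rw [dist_eq_norm, Prod.mk_sub_mk, Prod.norm_mk, Real.norm_eq_abs]
        exact max_lt (by nlinarith) (by nlinarith)) left_mem_uIcc right_mem_uIcc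
    rw [hb.flow_self, Real.norm_eq_abs] at h
    convert h using 2
    rw [sub_smul]; abel
  have hlin : ‖(odeFlow b t₂ y t₀ - odeFlow b t₂ z₂ t₀) - (y - z₂)‖
      ≤ K * Real.exp (K * |t₂ - t₀|) * |t₂ - t₀| * ‖y - z₂‖ := by
    have h := (convex_uIcc t₂ t₀).norm_image_sub_le_of_norm_hasDerivWithin_le
      (f := fun u => odeFlow b t₂ y u - odeFlow b t₂ z₂ u)
      (fun u _ => ((hb.hasDerivAt_flow t₂ y u).sub
        (hb.hasDerivAt_flow t₂ z₂ u)).hasDerivWithinAt)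
      (C := K * (‖y - z₂‖ * Real.exp (K * |t₂ - t₀|))) (fun u hu => by
        refine ((hb.lipschitz u).norm_sub_le _ _).trans ?_
        gcongr
        refine (hb.norm_flow_sub_flow_le t₂ u y z₂).trans ?_
        rw [abs_sub_comm t₂ t₀]
        have := mul_le_mul_of_nonneg_left (abs_sub_left_of_mem_uIcc hu) K.2
        exact mul_le_mul_of_nonneg_left (Real.exp_le_exp.2 this) (norm_nonneg _)) left_mem_uIcc right_mem_uIcc
    simp only [hb.flow_self, Real.norm_eq_abs] at h
    rw [abs_sub_comm t₀ t₂] at h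
    exact h.trans_eq (by ring)
  have hyz : ‖y - z₂‖ ≤ ‖z₁ - z₂‖ + B * |t₂ - t₁| := by
    calc _ = ‖(y - z₁) + (z₁ - z₂)‖ := by congr 1; abel
      _ ≤ _ := (norm_add_le _ _).trans (by linarith [hb.norm_flow_sub_le t₁ t₂ z₁])
  have he : odeFlow b t₁ z₁ t₀ - odeFlow b t₂ z₂ t₀
      - (ContinuousLinearMap.snd ℝ ℝ V
        - (ContinuousLinearMap.fst ℝ ℝ V).smulRight (b t₀ z₀)) ((t₁, z₁) - (t₂, z₂))
      = ((odeFlow b t₂ y t₀ - odeFlow b t₂ z₂ t₀) - (y - z₂))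
        + (y - z₁ - (t₂ - t₁) • b t₀ z₀) := by
    rw [hy, hb.flow_flow]
    simp only [Prod.mk_sub_mk, sub_apply, ContinuousLinearMap.coe_snd',
      ContinuousLinearMap.smulRight_apply, ContinuousLinearMap.coe_fst']
    module
  rw [he]
  have hn1 : ‖z₁ - z₂‖ ≤ ‖((t₁, z₁) : ℝ × V) - (t₂, z₂)‖ := norm_snd_le (((t₁, z₁) : ℝ × V) - (t₂, z₂))
  have hn2 : |t₂ - t₁| ≤ ‖((t₁, z₁) : ℝ × V) - (t₂, z₂)‖ := by
    rw [abs_sub_comm]; exact norm_fst_le (((t₁, z₁) : ℝ × V) - (t₂, z₂))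
  set N := ‖((t₁, z₁) : ℝ × V) - (t₂, z₂)‖
  have hN0 : 0 ≤ N := norm_nonneg _
  set κ := K * Real.exp (K * |t₂ - t₀|) * |t₂ - t₀| with hκ
  have hκ0 : 0 ≤ κ := by positivity
  calc _ ≤ κ * ‖y - z₂‖ + ε * |t₂ - t₁| := (norm_add_le _ _).trans (add_le_add hlin hstep)
    _ ≤ κ * (N + B * N) + ε * N := by gcongr; exact hyz.trans (by gcongr)
    _ = (1 + B) * κ * N + ε * N := by ring
    _ ≤ ε * N + ε * N := by gcongr
    _ = c * N := by rw [hε]; ring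

/-- The flow of a `C¹` vector field depends in a `C¹` way on the initial time and point. -/
lemma contDiff_flow (hb : IsBoundedLipschitz K B b)
    (hD : ∀ t z, HasFDerivAt (b t) (D t z) z) (hDc : Continuous fun q : ℝ × V => D q.1 q.2)
    (s : ℝ) : ContDiff ℝ 1 fun q : ℝ × V => odeFlow b q.1 q.2 s := by
  have hex : ∀ q : ℝ × V, ∃ A : ℝ × V →L[ℝ] V,
      HasStrictFDerivAt (fun q : ℝ × V => odeFlow b q.1 q.2 s) A q := by
    rintro ⟨t₀, z₀⟩
    obtain ⟨A, hA⟩ := hb.exists_hasStrictFDerivAt_flow hD hDc t₀ s z₀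
    have h1 := hb.hasStrictFDerivAt_flow_self t₀ z₀
    have hA' : HasStrictFDerivAt (fun z => odeFlow b t₀ z s) A
        ((fun q : ℝ × V => odeFlow b q.1 q.2 t₀) (t₀, z₀)) := by
      simpa only [hb.flow_self] using hA
    -- By the group property the flow to s is the flow to the fixed time t₀ followed by the flow
    -- from t₀ to s, and the latter depends on the point only.
    refine ⟨_, (hA'.comp (t₀, z₀) h1).congr_of_eventuallyEq
      (Eventually.of_forall fun q => ?_)⟩
    exact hb.flow_flow q.1 t₀ s q.2
  choose A hA using hex
  exact contDiff_one_of_hasStrictFDerivAt hA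

end IsBoundedLipschitz

end FlowRegularity

end Vlasov

end

noncomputable section

namespace Vlasov

/-! ### Solutions and scattering for a self-consistent field -/

/-- A force field that is `C¹` in space, with jointly continuous derivative. -/
structure IsSmoothField (E : ℝ → R3 → R3) : Prop where
  differentiable : ∀ t, Differentiable ℝ (E t)
  continuous_fderiv : Continuous fun q : ℝ × R3 => fderiv ℝ (E q.1) q.2

lemma contDiff_dvel (θ : ℝ) : ContDiff ℝ ∞ (dvel θ) := by
  have e : fderiv ℝ (vel θ) = dvel θ := funext fun p => (hasFDerivAt_vel θ p).fderiv
  rw [← e]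
  exact (contDiff_vel θ).fderiv_right (by simp)

section SelfConsistent

variable {α M θ : ℝ} {E : ℝ → R3 → R3} {f0 : Phase → ℝ}

lemma exists_hasFDerivAt_waveField (hE : IsField α M E) (hE1 : IsSmoothField E) (θ : ℝ) :
    ∃ D : ℝ → Phase → Phase →L[ℝ] Phase, (∀ t z, HasFDerivAt (waveField θ E t) (D t z) z) ∧
      Continuous fun q : ℝ × Phase => D q.1 q.2 := by
  set y : ℝ × Phase → R3 := fun q => q.2.1 + q.1 • vel θ q.2.2 with hy
  have hyc : Continuous y := (continuous_fst.comp continuous_snd).add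
    (continuous_fst.smul ((continuous_vel θ).comp (continuous_snd.comp continuous_snd)))
  set DG : ℝ × Phase → Phase →L[ℝ] R3 := fun q => (fderiv ℝ (E q.1) (y q)).comp
    (ContinuousLinearMap.fst ℝ R3 R3 + q.1 • (dvel θ q.2.2).comp (ContinuousLinearMap.snd ℝ R3 R3))
    with hDG
  have hdc : Continuous fun q : ℝ × Phase => dvel θ q.2.2 :=
    (continuous_dvel θ).comp (continuous_snd.comp continuous_snd)
  have hd2c : Continuous fun q : ℝ × Phase => (fderiv ℝ (dvel θ) q.2.2).comp
      (ContinuousLinearMap.snd ℝ R3 R3) :=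
    (((contDiff_dvel θ).continuous_fderiv (by simp)).comp
      (continuous_snd.comp continuous_snd)).clm_comp continuous_const
  have hGc : Continuous fun q : ℝ × Phase => E q.1 (y q) :=
    hE.continuous.comp (continuous_fst.prodMk hyc)
  have hDGc : Continuous DG := (hE1.continuous_fderiv.comp (continuous_fst.prodMk hyc)).clm_comp
    (continuous_const.add (continuous_fst.smul (hdc.clm_comp continuous_const)))
  refine ⟨fun t z => (-(t • ((dvel θ z.2).comp (DG (t, z)) + ((fderiv ℝ (dvel θ) z.2).comp
    (ContinuousLinearMap.snd ℝ R3 R3)).flip (E t (y (t, z)))))).prod (DG (t, z)),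
    fun t z => ?_, ?_⟩
  · have hyd : HasFDerivAt (fun z => y (t, z)) (ContinuousLinearMap.fst ℝ R3 R3
        + t • (dvel θ z.2).comp (ContinuousLinearMap.snd ℝ R3 R3)) z :=
      hasFDerivAt_fst.add (((hasFDerivAt_vel θ z.2).comp z hasFDerivAt_snd).const_smul t)
    have hG : HasFDerivAt (fun z => E t (y (t, z))) (DG (t, z)) z :=
      ((hE1.differentiable t) (y (t, z))).hasFDerivAt.comp z hyd
    have hd : HasFDerivAt (fun z : Phase => dvel θ z.2) ((fderiv ℝ (dvel θ) z.2).comp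
        (ContinuousLinearMap.snd ℝ R3 R3)) z :=
      (((contDiff_dvel θ).differentiable (by simp)) z.2).hasFDerivAt.comp z hasFDerivAt_snd
    exact (((hd.clm_apply hG).const_smul t).neg).prodMk hG
  · have hflip := (ContinuousLinearMap.flipₗᵢ ℝ Phase R3 R3).continuous.comp hd2c
    have h1 := ((continuous_fst.smul ((hdc.clm_comp hDGc).add (hflip.clm_apply hGc))).neg)
    have hp : Continuous fun L : (Phase →L[ℝ] R3) × (Phase →L[ℝ] R3) => L.1.prod L.2 :=
      (ContinuousLinearMap.prodₗᵢ ℝ).continuous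
    exact hp.comp (h1.prodMk hDGc)

lemma contDiff_waveFlow (hE : IsField α M E) (hE1 : IsSmoothField E) (hα : 0 ≤ α) (hθ : 0 ≤ θ)
    (hθ1 : θ ≤ 1) (s : ℝ) : ContDiff ℝ 1 fun q : ℝ × Phase => waveFlow θ E q.1 q.2 s := by
  obtain ⟨D, hD, hDc⟩ := exists_hasFDerivAt_waveField hE hE1 θ
  exact (hE.isBoundedLipschitz hα hθ hθ1).contDiff_flow hD hDc s

lemma contDiff_unstream (θ : ℝ) :
    ContDiff ℝ 1 fun q : ℝ × Phase => ((q.2.1 - q.1 • vel θ q.2.2, q.2.2) : Phase) := by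
  have h : ContDiff ℝ 1 fun q : ℝ × Phase => vel θ q.2.2 :=
    ((contDiff_vel θ).of_le (by simp)).comp (contDiff_snd.comp contDiff_snd)
  exact ((contDiff_fst.comp contDiff_snd).sub (contDiff_fst.smul h)).prodMk
    (contDiff_snd.comp contDiff_snd)

lemma contDiff_distr (hE : IsField α M E) (hE1 : IsSmoothField E) (hα : 0 ≤ α) (hθ : 0 ≤ θ)
    (hθ1 : θ ≤ 1) (hf : ContDiff ℝ 1 f0) :
    ContDiff ℝ 1 fun q : ℝ × Phase => distr θ E f0 q.1 q.2 :=
  hf.comp ((contDiff_waveFlow hE hE1 hα hθ hθ1 0).comp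
    (contDiff_fst.prodMk (contDiff_unstream θ)))

lemma freeFlow_eq (c : ℝ≥0∞) (t : ℝ) (z : Phase) :
    freeFlow c t z = (z.1 + t • vel (invSpeed c) z.2, z.2) := rfl

lemma distr_freeFlow (c : ℝ≥0∞) (E : ℝ → R3 → R3) (f0 : Phase → ℝ) (t : ℝ) (z : Phase) :
    distr (invSpeed c) E f0 t (freeFlow c t z) = pull (invSpeed c) E f0 t z := by
  simp [distr, freeFlow_eq]

lemma freeFlow_neg_freeFlow (c : ℝ≥0∞) (t : ℝ) (z : Phase) :
    freeFlow c (-t) (freeFlow c t z) = z := by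
  simp [freeFlow_eq]

lemma freeFlow_freeFlow_neg (c : ℝ≥0∞) (t : ℝ) (z : Phase) :
    freeFlow c t (freeFlow c (-t) z) = z := by
  simp [freeFlow_eq]

/-- Free streaming turns the flow of `waveField` into characteristics. -/
lemma hasDerivAt_freeFlow {c : ℝ≥0∞} {Z : ℝ → Phase} {s : ℝ}
    (hZ : HasDerivAt Z (waveField (invSpeed c) E s (Z s)) s) :
    HasDerivAt (fun s => freeFlow c s (Z s))
      (velocity c (freeFlow c s (Z s)).2, E s (freeFlow c s (Z s)).1) s := by
  have h1 : HasDerivAt (fun s => (Z s).1) (waveField (invSpeed c) E s (Z s)).1 s := hZ.fst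
  have h2 : HasDerivAt (fun s => (Z s).2) (waveField (invSpeed c) E s (Z s)).2 s := hZ.snd
  have hv := (hasFDerivAt_vel (invSpeed c) (Z s).2).comp_hasDerivAt s h2
  have h := (h1.add ((hasDerivAt_id s).smul hv)).prodMk h2
  refine h.congr_deriv ?_
  simp only [freeFlow_eq, waveField, velocity_eq_vel, id, one_smul, Function.comp]
  ext1
  · simp
  · rfl

lemma IsField.distr_freeFlow_waveFlow {c : ℝ≥0∞} (hE : IsField α M E) (hα : 0 ≤ α)
    (hθ : 0 ≤ invSpeed c) (hθ1 : invSpeed c ≤ 1) (t s : ℝ) (z : Phase) :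
    distr (invSpeed c) E f0 s (freeFlow c s (waveFlow (invSpeed c) E t z s))
      = pull (invSpeed c) E f0 t z := by
  rw [distr_freeFlow, pull, pull, hE.waveFlow_waveFlow hα hθ hθ1]

/-- The transported datum solves the Vlasov equation. -/
lemma hasDerivAt_distr {c : ℝ≥0∞} (hE : IsField α M E) (hE1 : IsSmoothField E) (hα : 0 ≤ α)
    (hθ : 0 ≤ invSpeed c) (hθ1 : invSpeed c ≤ 1) (hf : ContDiff ℝ 1 f0) (t : ℝ) (z : Phase) :
    HasDerivAt (fun s => distr (invSpeed c) E f0 s z)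
      (-(fderiv ℝ (distr (invSpeed c) E f0 t) z (velocity c z.2, E t z.1))) t := by
  set F : ℝ × Phase → ℝ := fun q => distr (invSpeed c) E f0 q.1 q.2 with hF
  have hd : HasFDerivAt F (fderiv ℝ F (t, z)) (t, z) :=
    ((contDiff_distr hE hE1 hα hθ hθ1 hf).differentiable one_ne_zero (t, z)).hasFDerivAt
  have h1 : HasDerivAt (fun s => F (s, z)) (fderiv ℝ F (t, z) (1, 0)) t :=
    HasFDerivAt.comp_hasDerivAt (f := fun s : ℝ => (s, z)) t hd
      ((hasDerivAt_id t).prodMk (hasDerivAt_const t z))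
  have h2 : HasFDerivAt (fun y => F (t, y))
      ((fderiv ℝ F (t, z)).comp (ContinuousLinearMap.inr ℝ ℝ Phase)) z :=
    hd.comp z (hasFDerivAt_prodMk_right t z)
  set y := freeFlow c (-t) z with hy
  have hchar := hasDerivAt_freeFlow (c := c) (hE.hasDerivAt_waveFlow hα hθ hθ1 t y t)
  rw [hE.waveFlow_self hα hθ hθ1, hy, freeFlow_freeFlow_neg] at hchar
  have h3 : HasDerivAt (fun s => F (s, freeFlow c s (waveFlow (invSpeed c) E t y s)))
      (fderiv ℝ F (t, z) (1, (velocity c z.2, E t z.1))) t := by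
    refine HasFDerivAt.comp_hasDerivAt (l := F) (l' := fderiv ℝ F (t, z))
      (f := fun s => (s, freeFlow c s (waveFlow (invSpeed c) E t y s))) t ?_
      ((hasDerivAt_id t).prodMk hchar)
    simp only [hE.waveFlow_self hα hθ hθ1]
    rwa [hy, freeFlow_freeFlow_neg]
  -- The transported datum is constant along this characteristic, so its derivative in the direction
  -- (1, v, E) is zero; splitting off (1, 0) is the equation.
  have h4 : (fun s => F (s, freeFlow c s (waveFlow (invSpeed c) E t y s)))
      = fun _ => pull (invSpeed c) E f0 t y :=
    funext fun s => hE.distr_freeFlow_waveFlow hα hθ hθ1 t s y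
  rw [h4] at h3
  have h5 := h3.unique (hasDerivAt_const t _)
  have h6 : fderiv ℝ (distr (invSpeed c) E f0 t) z
      = (fderiv ℝ F (t, z)).comp (ContinuousLinearMap.inr ℝ ℝ Phase) := h2.fderiv
  refine h1.congr_deriv ?_
  rw [h6, ContinuousLinearMap.comp_apply, ContinuousLinearMap.inr_apply, eq_neg_iff_add_eq_zero,
    ← map_add]
  refine Eq.trans ?_ h5
  congr 1
  simp

lemma measurePreserving_stream (θ t : ℝ) :
    MeasurePreserving (fun z : Phase => ((z.1 + t • vel θ z.2, z.2) : Phase)) := by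
  have h := MeasurePreserving.skew_product (μa := (volume : Measure R3)) (μc := (volume : Measure R3))
    (μd := volume) (MeasurePreserving.id volume) (g := fun p x : R3 => x + t • vel θ p)
    ((measurable_snd.add (((measurable_vel θ).comp measurable_fst).const_smul t)))
    (Eventually.of_forall fun p => (measurePreserving_add_right volume (t • vel θ p)).map_eq)
  have hs : MeasurePreserving (Prod.swap : R3 × R3 → R3 × R3)
      ((volume : Measure R3).prod volume) ((volume : Measure R3).prod volume) :=
    Measure.measurePreserving_swap
  exact (hs.comp h).comp hs

lemma integrable_distr {σ η K : ℝ} (hE : IsField α M E) (hα : 0 ≤ α) (hθ : 0 ≤ θ) (hθ1 : θ ≤ 1)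
    (hσ : 3 < σ) (hf : IsDatum σ η f0) (hb : ∀ t z, |pull θ E f0 t z| ≤ K * η * weight σ 8 z)
    (t : ℝ) : Integrable (distr θ E f0 t) := by
  have hi : Integrable (pull θ E f0 t) := by
    refine ((integrable_weight hσ (k := 8) (by norm_num)).const_mul (K * η)).mono'
      (((continuous_pull hE hα hθ hθ1 hf.contDiff.continuous).comp
        (continuous_const.prodMk continuous_id)).aestronglyMeasurable)
      (Eventually.of_forall fun z => hb t z)
  have h := (measurePreserving_stream θ (-t)).integrable_comp_of_integrable hi
  refine h.congr (Eventually.of_forall fun z => ?_)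
  simp [distr, Function.comp, sub_eq_add_neg]

/-- A self-consistent dispersing field yields a solution. -/
lemma isSolution_distr {σ η A R β : ℝ} {c : ℝ≥0∞} {k : R3 → R3} (hα1 : 1 < α) (hα2 : α < 2)
    (hσ : 3 < σ) (hk : IsKernel α A R k) (hβ : |β| ≤ 1) (hθ : 0 ≤ invSpeed c)
    (hθ1 : invSpeed c ≤ 1) (hE : IsField α M E) (hE1 : IsSmoothField E) (hf : IsDatum σ η f0)
    (hself : newField k β (invSpeed c) f0 E = E) :
    IsSolution k β c f0 (distr (invSpeed c) E f0) := by
  have hα0 : 0 ≤ α := by linarith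
  have hM := hE.nonneg
  obtain ⟨K, hK, hpull⟩ := exists_pull_bounds hα1 hM (by linarith : (0 : ℝ) ≤ σ)
  obtain ⟨C, hC, hnew⟩ := exists_norm_newField_le hα1 hα2 hσ hk hM
  have hself' : ∀ t, force k β (distr (invSpeed c) E f0 t) = E t := fun t => congrFun hself t
  refine ⟨?_, fun t _ z => hf.nonneg _, (contDiff_distr hE hE1 hα0 hθ hθ1 hf.contDiff).contDiffOn,
    fun t _ => integrable_distr hE hα0 hθ hθ1 hσ hf (hpull _ η f0 E hθ hθ1 hE hf).1 t,
    fun t _ x => (hnew _ β η f0 E hθ hθ1 hβ hE hf t x).1, ?_, ?_, ?_, ?_⟩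
  · funext z
    simp only [distr, pull, hE.waveFlow_self hα0 hθ hθ1, zero_smul, sub_zero]
  · simp only [hself']
    exact hE.continuous.continuousOn
  · intro t _
    rw [hself']
    exact hE1.differentiable t
  · refine fun T => ⟨M, fun t _ _ x => ?_⟩
    rw [hself']
    refine ⟨(hE.bound t x).trans (mul_le_of_le_one_right hM (decay_le_one (by linarith) t)), ?_⟩
    refine norm_fderiv_le_of_lip' ℝ hM (Eventually.of_forall fun y => (hE.lip t y x).trans ?_)
    exact mul_le_mul_of_nonneg_right
      (mul_le_of_le_one_right hM (decay_le_one (by linarith) t)) (norm_nonneg _)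
  · intro t _ x p
    rw [hself']
    exact (hasDerivAt_distr hE hE1 hα0 hθ hθ1 hf.contDiff t (x, p)).hasDerivWithinAt

/-- Limits of families that are Cauchy at a uniform rate. -/
lemma exists_limit_of_rate {X : Type*} [TopologicalSpace X] {F : ℝ → X → Phase} {C : ℝ}
    {L : ℝ → ℝ} {l : ℝ} (hC : 0 ≤ C) (hF : ∀ s t x, ‖F s x - F t x‖ ≤ C * |L s - L t|)
    (hL : Tendsto L atTop (𝓝 l)) (hc : ∀ t, Continuous (F t)) :
    ∃ G : X → Phase, Continuous G ∧ ∀ x, Tendsto (fun t => F t x) atTop (𝓝 (G x)) := by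
  have hcauchy : ∀ x, CauchySeq fun t => F t x := fun x => by
    have hLc := hL.cauchySeq
    rw [Metric.cauchySeq_iff] at hLc ⊢
    intro ε hε
    obtain ⟨N, hN⟩ := hLc (ε / (C + 1)) (by positivity)
    refine ⟨N, fun s hs t ht => ?_⟩
    rw [dist_eq_norm]
    have h1 := hN s hs t ht
    rw [Real.dist_eq, lt_div_iff₀ (by positivity)] at h1
    refine (hF s t x).trans_lt ?_
    nlinarith [abs_nonneg (L s - L t)]
  choose G hG using fun x => cauchySeq_tendsto_of_complete (hcauchy x)
  refine ⟨G, ?_, hG⟩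
  have hunif : TendstoUniformly F G atTop := by
    rw [Metric.tendstoUniformly_iff]
    intro ε hε
    have hb : ∀ t x, ‖G x - F t x‖ ≤ C * |l - L t| := fun t x =>
      le_of_tendsto_of_tendsto ((hG x).sub_const _).norm ((hL.sub_const _).abs.const_mul C)
        (Eventually.of_forall fun s => hF s t x)
    have hlim : Tendsto (fun t => C * |l - L t|) atTop (𝓝 0) := by
      have := ((hL.const_sub l).abs).const_mul C
      simpa using this
    filter_upwards [hlim.eventually (gt_mem_nhds hε)] with t ht x
    rw [dist_eq_norm]
    exact (hb t x).trans_lt ht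
  exact hunif.continuous (Frequently.of_forall hc)

lemma IsField.norm_waveFlow_sub_waveFlow_time_le (hE : IsField α M E) (hα : 1 < α) (hθ : 0 ≤ θ)
    (hθ1 : θ ≤ 1) (s t r : ℝ) (z : Phase) :
    ‖waveFlow θ E s z r - waveFlow θ E t z r‖
      ≤ Real.exp (10 * M * totalDecay α) * (2 * M) * |decayPrim α s - decayPrim α t| := by
  have hα0 : 0 ≤ α := by linarith
  rw [← hE.waveFlow_waveFlow hα0 hθ hθ1 s t r z]
  refine (hE.norm_waveFlow_sub_waveFlow_le hα hθ hθ1 t r _ _).trans ?_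
  rw [mul_assoc (Real.exp _), abs_sub_comm]
  exact mul_le_mul_of_nonneg_left (hE.norm_waveFlow_sub_le hα0 hθ hθ1 s t z) (Real.exp_pos _).le

/-- The displacement between two times is bounded, uniformly in the point, by an increment of a
convergent primitive: the flow is uniformly Cauchy in time. -/
lemma IsField.exists_wave (hE : IsField α M E) (hα : 1 < α) (hθ : 0 ≤ θ) (hθ1 : θ ≤ 1) :
    ∃ W : Phase → Phase, Continuous W ∧
      ∀ z, Tendsto (fun t => waveFlow θ E 0 z t) atTop (𝓝 (W z)) := by
  have hα0 : 0 ≤ α := by linarith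
  have hM := hE.nonneg
  obtain ⟨l, hl⟩ := exists_tendsto_decayPrim hα
  refine exists_limit_of_rate (F := fun t z => waveFlow θ E 0 z t) (C := 2 * M) (by positivity)
    (fun s t z => ?_) hl (fun t => ?_)
  · rw [← hE.waveFlow_waveFlow hα0 hθ hθ1 0 t s z]
    exact hE.norm_waveFlow_sub_le hα0 hθ hθ1 t s _
  · exact continuous_iff_continuousAt.2 fun z => Metric.continuousAt_iff.2 fun ε hε =>
      ⟨ε / Real.exp (10 * M * totalDecay α), by positivity, fun {y} hy => by
        rw [dist_eq_norm, lt_div_iff₀ (Real.exp_pos _)] at hy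
        rw [dist_eq_norm]
        refine (hE.norm_waveFlow_sub_waveFlow_le hα hθ hθ1 0 t y z).trans_lt ?_
        rwa [mul_comm]⟩

/-- Here the starting time varies, so the small displacement occurs at the beginning of the
trajectory and has to be propagated by the uniform Lipschitz constant of the flow. -/
lemma IsField.exists_inverse_wave (hE : IsField α M E) (hα : 1 < α) (hθ : 0 ≤ θ) (hθ1 : θ ≤ 1) :
    ∃ W : Phase → Phase, Continuous W ∧
      ∀ z, Tendsto (fun t => waveFlow θ E t z 0) atTop (𝓝 (W z)) := by
  have hα0 : 0 ≤ α := by linarith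
  have hM := hE.nonneg
  obtain ⟨l, hl⟩ := exists_tendsto_decayPrim hα
  refine exists_limit_of_rate (F := fun t z => waveFlow θ E t z 0)
    (C := Real.exp (10 * M * totalDecay α) * (2 * M)) (by positivity)
    (fun s t z => hE.norm_waveFlow_sub_waveFlow_time_le hα hθ hθ1 s t 0 z) hl (fun t => ?_)
  exact (hE.continuous_waveFlow hα0 hθ hθ1 0).comp (continuous_const.prodMk continuous_id)

/-- A self-consistent dispersing field yields a scattering solution. -/
lemma exists_isScattering {σ η A R β : ℝ} {c : ℝ≥0∞} {k : R3 → R3} (hα1 : 1 < α) (hα2 : α < 2)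
    (hσ : 3 < σ) (hk : IsKernel α A R k) (hβ : |β| ≤ 1) (hθ : 0 ≤ invSpeed c)
    (hθ1 : invSpeed c ≤ 1) (hE : IsField α M E) (hE1 : IsSmoothField E) (hf : IsDatum σ η f0)
    (hself : newField k β (invSpeed c) f0 E = E) :
    ∃ Φ Wp fp, IsScattering k β c f0 (distr (invSpeed c) E f0) Φ Wp fp := by
  have hα0 : 0 ≤ α := by linarith
  have hM := hE.nonneg
  obtain ⟨K, hK, hpull⟩ := exists_pull_bounds hα1 hM (by linarith : (0 : ℝ) ≤ σ)
  have hb := (hpull _ η f0 E hθ hθ1 hE hf).1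
  have hself' : ∀ t, force k β (distr (invSpeed c) E f0 t) = E t := fun t => congrFun hself t
  obtain ⟨W, hWc, hW⟩ := hE.exists_wave hα1 hθ hθ1
  obtain ⟨V, hVc, hV⟩ := hE.exists_inverse_wave hα1 hθ hθ1
  -- Along free streaming the solution equals the datum at the backward image of z, so the
  -- scattering state is f⁰ composed with the inverse wave operator V.
  have hlim : ∀ z, Tendsto (fun t => pull (invSpeed c) E f0 t z) atTop (𝓝 (f0 (V z))) :=
    fun z => (hf.contDiff.continuous.tendsto _).comp (hV z)
  have hle : ∀ z, |f0 (V z)| ≤ K * η * weight σ 8 z := fun z =>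
    le_of_tendsto (hlim z).abs (Eventually.of_forall fun t => hb t z)
  have hwi := (integrable_weight hσ (k := 8) (by norm_num)).const_mul (K * η)
  refine ⟨fun t z => freeFlow c t (waveFlow (invSpeed c) E 0 z t), W, fun z => f0 (V z),
    isSolution_distr hα1 hα2 hσ hk hβ hθ hθ1 hE hE1 hf hself, ⟨fun z => ?_, fun t _ z => ?_⟩,
    hWc, fun z => ?_, fun z => hf.nonneg _, ?_, fun z => ?_, ?_⟩
  · simp [hE.waveFlow_self hα0 hθ hθ1, freeFlow_eq]
  · rw [hself']
    exact (hasDerivAt_freeFlow (hE.hasDerivAt_waveFlow hα0 hθ hθ1 0 z t)).hasDerivWithinAt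
  · simp only [waveOp, freeFlow_neg_freeFlow]
    exact hW z
  · exact hwi.mono' (hf.contDiff.continuous.comp hVc).aestronglyMeasurable
      (Eventually.of_forall hle)
  · simp only [distr_freeFlow]
    exact hlim z
  · simp only [distr_freeFlow]
    have hpm : ∀ t, AEStronglyMeasurable (pull (invSpeed c) E f0 t) volume := fun t =>
      ((continuous_pull hE hα0 hθ hθ1 hf.contDiff.continuous).comp
        (continuous_const.prodMk continuous_id)).aestronglyMeasurable
    have h := tendsto_integral_filter_of_dominated_convergence
      (F := fun t z => |pull (invSpeed c) E f0 t z - f0 (V z)|) (f := fun _ => (0 : ℝ))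
      (l := atTop) (μ := volume) (fun z : Phase => 2 * (K * η * weight σ 8 z))
      (Eventually.of_forall fun t =>
        ((hpm t).sub (hf.contDiff.continuous.comp hVc).aestronglyMeasurable).norm)
      (Eventually.of_forall fun t => Eventually.of_forall fun z => by
        rw [Real.norm_eq_abs, abs_abs]
        exact (abs_sub _ _).trans (by linarith [hb t z, hle z]))
      (hwi.const_mul 2)
      (Eventually.of_forall fun z => by
        have := ((hlim z).sub_const (f0 (V z))).abs
        simpa using this)
    simpa using h

end SelfConsistent

end Vlasov

end

noncomputable section

namespace Vlasov

/-! ### Differentiability of the generated field -/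

/-- If E - F is locally Lipschitz in space with constant ε for smooth F, the derivatives of two such
approximations differ by the sum of their ε. They are uniformly Cauchy, and their limit is the
derivative of E. Differentiating the approximations thus suffices, although the kernel has no
derivative to use. -/
lemma isSmoothField_of_approx {E : ℝ → R3 → R3}
    (h : ∀ ε > 0, ∃ F : ℝ → R3 → R3, IsSmoothField F ∧ ∀ t x a, ‖a‖ ≤ 1 →
      ‖(E t (x + a) - F t (x + a)) - (E t x - F t x)‖ ≤ ε * ‖a‖) : IsSmoothField E := by
  choose! F hF hFE using h
  have hpos : ∀ n : ℕ, (0 : ℝ) < 1 / ((n : ℝ) + 1) := fun n => by positivity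
  set G : ℕ → ℝ → R3 → R3 := fun n => F (1 / ((n : ℝ) + 1)) with hG
  have hGs : ∀ n, IsSmoothField (G n) := fun n => hF _ (hpos n)
  have hGE : ∀ n t x a, ‖a‖ ≤ 1 →
      ‖(E t (x + a) - G n t (x + a)) - (E t x - G n t x)‖ ≤ 1 / ((n : ℝ) + 1) * ‖a‖ :=
    fun n => hFE _ (hpos n)
  have hlim : Tendsto (fun n : ℕ => 1 / ((n : ℝ) + 1)) atTop (𝓝 0) :=
    tendsto_one_div_add_atTop_nhds_zero_nat
  have hdiff : ∀ n m t x, ‖fderiv ℝ (G n t) x - fderiv ℝ (G m t) x‖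
      ≤ 1 / ((n : ℝ) + 1) + 1 / ((m : ℝ) + 1) := fun n m t x => by
    have hd : HasFDerivAt (fun y => G n t y - G m t y)
        (fderiv ℝ (G n t) x - fderiv ℝ (G m t) x) x :=
      ((hGs n).differentiable t x).hasFDerivAt.sub ((hGs m).differentiable t x).hasFDerivAt
    refine hd.le_of_lip' (add_pos (hpos n) (hpos m)).le ?_
    filter_upwards [Metric.closedBall_mem_nhds x one_pos] with y hy
    rw [mem_closedBall_iff_norm] at hy
    have h1 := hGE n t x (y - x) hy
    have h2 := hGE m t x (y - x) hy
    rw [add_sub_cancel] at h1 h2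
    have e : G n t y - G m t y - (G n t x - G m t x)
        = ((E t y - G m t y) - (E t x - G m t x)) - ((E t y - G n t y) - (E t x - G n t x)) := by
      abel
    rw [e]
    exact (norm_sub_le _ _).trans (by linarith)
  have hcauchy : ∀ q : ℝ × R3, CauchySeq fun n => fderiv ℝ (G n q.1) q.2 := fun q => by
    rw [Metric.cauchySeq_iff']
    intro ε hε
    obtain ⟨N, hN⟩ := (hlim.eventually (gt_mem_nhds (half_pos hε))).exists_forall_of_atTop
    refine ⟨N, fun n hn => ?_⟩
    rw [dist_eq_norm]
    refine (hdiff n N q.1 q.2).trans_lt ?_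
    linarith [hN n hn, hN N le_rfl]
  choose D hD using fun q => cauchySeq_tendsto_of_complete (hcauchy q)
  have hDle : ∀ n q, ‖D q - fderiv ℝ (G n q.1) q.2‖ ≤ 1 / ((n : ℝ) + 1) := fun n q => by
    refine le_of_tendsto_of_tendsto ((hD q).sub_const _).norm
      ((hlim.add_const (1 / ((n : ℝ) + 1)))) (Eventually.of_forall fun m => hdiff m n q.1 q.2)
      |>.trans_eq (zero_add _)
  have hDc : Continuous D := by
    have hunif : TendstoUniformly (fun n (q : ℝ × R3) => fderiv ℝ (G n q.1) q.2) D atTop := by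
      rw [Metric.tendstoUniformly_iff]
      intro ε hε
      filter_upwards [hlim.eventually (gt_mem_nhds hε)] with n hn q
      rw [dist_eq_norm]
      exact (hDle n q).trans_lt hn
    exact hunif.continuous (Frequently.of_forall fun n => (hGs n).continuous_fderiv)
  have hED : ∀ t x, HasFDerivAt (E t) (D (t, x)) x := fun t x => by
    rw [hasFDerivAt_iff_isLittleO_nhds_zero, Asymptotics.isLittleO_iff]
    intro c hc
    obtain ⟨n, hn⟩ := (hlim.eventually (gt_mem_nhds (show 0 < c / 3 by positivity))).exists
    have h1 := hasFDerivAt_iff_isLittleO_nhds_zero.1 ((hGs n).differentiable t x).hasFDerivAt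
    have h2 := Asymptotics.isLittleO_iff.1 h1 (show 0 < c / 3 by positivity)
    filter_upwards [h2, Metric.closedBall_mem_nhds (0 : R3) one_pos] with a ha ha1
    rw [mem_closedBall_zero_iff] at ha1
    have e : E t (x + a) - E t x - D (t, x) a
        = ((E t (x + a) - G n t (x + a)) - (E t x - G n t x))
          + (G n t (x + a) - G n t x - fderiv ℝ (G n t) x a)
          - (D (t, x) - fderiv ℝ (G n t) x) a := by
      rw [sub_apply]; abel
    rw [e]
    have h3 := hGE n t x a ha1
    have h4 := (D (t, x) - fderiv ℝ (G n t) x).le_of_opNorm_le (hDle n (t, x)) a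
    have hna := norm_nonneg a
    refine (norm_sub_le _ _).trans ((add_le_add_left (norm_add_le _ _) _).trans ?_)
    nlinarith
  refine ⟨fun t x => (hED t x).differentiableAt, ?_⟩
  have e : (fun q : ℝ × R3 => fderiv ℝ (E q.1) q.2) = D := funext fun q => (hED q.1 q.2).fderiv
  rwa [e]

/-- In free-streaming coordinates the density has a bound independent of time and the dependence on
x sits in the smooth kernel, so differentiation under the integral is dominated. -/
lemma isSmoothField_integral_smooth {g : ℝ → Phase → ℝ}
    (hg : Continuous fun q : ℝ × Phase => g q.1 q.2) {W : Phase → ℝ} (hW : Integrable W)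
    (hle : ∀ t z, |g t z| ≤ W z) {φ : R3 → R3} (hφ : ContDiff ℝ ∞ φ) (hφc : HasCompactSupport φ)
    (θ : ℝ) : IsSmoothField fun t x => ∫ z : Phase, g t z • φ (x - (z.1 + t • vel θ z.2)) := by
  obtain ⟨C0, hC0⟩ := hφ.continuous.bounded_above_of_compact_support hφc
  have hφ' : Continuous (fderiv ℝ φ) := hφ.continuous_fderiv (by simp)
  obtain ⟨C1, hC1⟩ := hφ'.bounded_above_of_compact_support (hφc.fderiv ℝ)
  have hgt : ∀ t, Continuous (g t) := fun t => hg.comp (continuous_const.prodMk continuous_id)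
  have hy : Continuous fun q : (ℝ × R3) × Phase => q.1.2 - (q.2.1 + q.1.1 • vel θ q.2.2) :=
    (continuous_snd.comp continuous_fst).sub ((continuous_fst.comp continuous_snd).add
      ((continuous_fst.comp continuous_fst).smul ((continuous_vel θ).comp
        (continuous_snd.comp continuous_snd))))
  have hyz : ∀ t x, Continuous fun z : Phase => x - (z.1 + t • vel θ z.2) := fun t x =>
    hy.comp ((continuous_const (y := (t, x))).prodMk continuous_id)
  have hb0 : ∀ t x (z : Phase), ‖g t z • φ (x - (z.1 + t • vel θ z.2))‖ ≤ W z * C0 :=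
    fun t x z => by
      rw [norm_smul]
      exact mul_le_mul (hle t z) (hC0 _) (norm_nonneg _) ((abs_nonneg _).trans (hle t z))
  have hb1 : ∀ t x (z : Phase), ‖g t z • fderiv ℝ φ (x - (z.1 + t • vel θ z.2))‖ ≤ W z * C1 :=
    fun t x z => by
      rw [norm_smul]
      exact mul_le_mul (hle t z) (hC1 _) (norm_nonneg _) ((abs_nonneg _).trans (hle t z))
  have hder : ∀ t x, HasFDerivAt (fun x => ∫ z : Phase, g t z • φ (x - (z.1 + t • vel θ z.2)))
      (∫ z : Phase, g t z • fderiv ℝ φ (x - (z.1 + t • vel θ z.2))) x := fun t x => by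
    have hm : ∀ x, AEStronglyMeasurable
        (fun z : Phase => g t z • φ (x - (z.1 + t • vel θ z.2))) volume := fun x =>
      ((hgt t).smul (hφ.continuous.comp (hyz t x))).aestronglyMeasurable
    refine hasFDerivAt_integral_of_dominated_of_fderiv_le (s := univ)
      (bound := fun z => W z * C1) univ_mem (Eventually.of_forall hm)
      ((hW.mul_const C0).mono' (hm x) (Eventually.of_forall (hb0 t x)))
      ((hgt t).smul (hφ'.comp (hyz t x))).aestronglyMeasurable
      (Eventually.of_forall fun z y _ => hb1 t y z) (hW.mul_const C1)
      (Eventually.of_forall fun z y _ => ?_)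
    have hd := ((hφ.differentiable (by simp)) (y - (z.1 + t • vel θ z.2))).hasFDerivAt.comp y
      ((hasFDerivAt_id y).sub_const (z.1 + t • vel θ z.2))
    exact hd.const_smul (g t z)
  refine ⟨fun t x => (hder t x).differentiableAt, ?_⟩
  have e : (fun q : ℝ × R3 =>
      fderiv ℝ (fun x => ∫ z : Phase, g q.1 z • φ (x - (z.1 + q.1 • vel θ z.2))) q.2)
      = fun q => ∫ z : Phase, g q.1 z • fderiv ℝ φ (q.2 - (z.1 + q.1 • vel θ z.2)) :=
    funext fun q => (hder q.1 q.2).fderiv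
  rw [e]
  refine continuous_of_dominated (bound := fun z => W z * C1) (fun q =>
    ((hgt q.1).smul (hφ'.comp (hyz q.1 q.2))).aestronglyMeasurable)
    (fun q => Eventually.of_forall (hb1 q.1 q.2)) (hW.mul_const C1)
    (Eventually.of_forall fun z => ?_)
  exact (hg.comp (continuous_fst.prodMk continuous_const)).smul
    (hφ'.comp (hy.comp (continuous_id.prodMk continuous_const)))

section Kernel

variable {α A R : ℝ} {k : R3 → R3}

/-- Smooth compactly supported approximation of a kernel, up to parts small in `L¹` and `L^∞`. -/
lemma IsKernel.exists_smooth_approx (hk : IsKernel α A R k) (hα : 1 < α) {ε : ℝ} (hε : 0 < ε) :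
    ∃ φ : R3 → R3, HasCompactSupport φ ∧ ContDiff ℝ ∞ φ ∧
      ∀ W : Phase → ℝ≥0∞, Measurable W → ∀ S I : ℝ≥0∞, (∀ x, ∫⁻ u, W (x, u) ≤ S) →
        ∫⁻ z, W z ≤ I → ∀ x : R3, ∫⁻ z : Phase, W z * ‖k (x - z.1) - φ (x - z.1)‖ₑ
          ≤ ENNReal.ofReal ε * S + ENNReal.ofReal ε * I := by
  have hA := hk.pos
  obtain ⟨s, hs1, hs⟩ : ∃ s : ℝ, 1 ≤ s ∧ A * s ^ (-(α + 1)) ≤ ε := by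
    have h := ((tendsto_rpow_neg_atTop (show 0 < α + 1 by linarith)).const_mul A)
    rw [mul_zero] at h
    obtain ⟨s, h1, h2⟩ := ((eventually_ge_atTop (1 : ℝ)).and
      (h.eventually (gt_mem_nhds hε))).exists
    exact ⟨s, h1, h2.le⟩
  set B := Metric.ball (0 : R3) (R * s) with hB
  set k1 : R3 → R3 := B.indicator k with hk1
  have hk1m : Measurable k1 := hk.measurable.indicator measurableSet_ball
  have hk1i : Integrable k1 := by
    rw [hk1, integrable_indicator_iff measurableSet_ball]
    exact ⟨hk.measurable.aestronglyMeasurable, (hk.near s hs1).trans_lt ENNReal.ofReal_lt_top⟩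
  -- The tail beyond Rs is uniformly below ε, and the truncated kernel is integrable, hence
  -- approximable in L¹ by test functions.
  obtain ⟨φ, hφc, hφ, hle⟩ := MemLp.exist_eLpNorm_sub_le ENNReal.one_ne_top le_rfl
    (memLp_one_iff_integrable.2 hk1i) hε
  rw [eLpNorm_one_eq_lintegral_enorm] at hle
  refine ⟨φ, hφc, hφ, fun W hW S I hS hI x => ?_⟩
  have hφm : Measurable φ := hφ.continuous.measurable
  obtain ⟨r0, hr0⟩ := hφc.isCompact.isBounded.subset_closedBall (0 : R3)
  have hzero : ∀ y, max (R * s) (r0 + 1) ≤ ‖y‖ → ‖(k1 - φ) y‖ₑ ≤ 0 := fun y hy => by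
    have h1 : k1 y = 0 := by
      refine indicator_of_notMem (fun hm => ?_) _
      rw [hB, mem_ball_zero_iff] at hm
      linarith [(le_max_left _ _).trans hy]
    have h2 : φ y = 0 := by
      refine image_eq_zero_of_notMem_tsupport fun hm => ?_
      have := hr0 hm
      rw [mem_closedBall_zero_iff] at this
      linarith [(le_max_right _ _).trans hy]
    simp [h1, h2]
  have hfirst := lintegral_mul_enorm_comp_sub_le (k := k1 - φ) (hk1m.sub hφm)
    ((setLIntegral_le_lintegral (Metric.ball 0 (max (R * s) (r0 + 1))) _).trans hle) hzero hW hS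
    hI x
  rw [zero_mul, add_zero] at hfirst
  have hpt : ∀ y, ‖k y - φ y‖ₑ ≤ ‖(k1 - φ) y‖ₑ + ENNReal.ofReal ε := fun y => by
    by_cases hy : y ∈ B
    · rw [Pi.sub_apply, hk1, indicator_of_mem hy]
      exact le_self_add
    · have h1 : k1 y = 0 := indicator_of_notMem hy _
      rw [Pi.sub_apply, h1, zero_sub, enorm_neg, add_comm]
      refine (enorm_sub_le).trans ?_
      gcongr
      rw [← ofReal_norm]
      refine ENNReal.ofReal_le_ofReal ((hk.far s hs1 y ?_).trans hs)
      rwa [hB, mem_ball_zero_iff, not_lt] at hy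
  have hm1 : Measurable fun z : Phase => W z * ‖(k1 - φ) (x - z.1)‖ₑ :=
    hW.mul ((hk1m.sub hφm).comp (measurable_const.sub measurable_fst)).enorm
  calc _ ≤ ∫⁻ z : Phase, (W z * ‖(k1 - φ) (x - z.1)‖ₑ + ENNReal.ofReal ε * W z) := by
        refine lintegral_mono fun z => ?_
        rw [mul_comm (ENNReal.ofReal ε), ← mul_add]
        gcongr
        exact hpt _
    _ = (∫⁻ z : Phase, W z * ‖(k1 - φ) (x - z.1)‖ₑ) + ENNReal.ofReal ε * ∫⁻ z, W z := by
        rw [lintegral_add_left hm1, lintegral_const_mul _ hW]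
    _ ≤ _ := by gcongr

/-- Increments of a convolution, estimated through increments of the density. -/
lemma norm_integral_shift_sub_le {r : R3 → R3} {h : Phase → ℝ}
    (hi : ∀ x, Integrable fun z : Phase => h z • r (x - z.1)) {W : Phase → ℝ} {c : ℝ} (hc : 0 ≤ c)
    {a : R3} (hdiff : ∀ z, |h (z + (a, 0)) - h z| ≤ c * W z) {N : ℝ} (hN0 : 0 ≤ N) {x : R3}
    (hN : ∫⁻ z : Phase, ENNReal.ofReal (W z) * ‖r (x - z.1)‖ₑ ≤ ENNReal.ofReal N) :
    ‖(∫ z : Phase, h z • r (x + a - z.1)) - ∫ z : Phase, h z • r (x - z.1)‖ ≤ c * N := by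
  have hshift : ∀ z : Phase, h (z + (a, 0)) • r (x + a - (z + (a, 0)).1)
      = h (z + (a, 0)) • r (x - z.1) := fun z => by
    have e2 : x + a - (z + (a, 0)).1 = x - z.1 := by
      simp only [Prod.fst_add]; abel
    rw [e2]
  have hi2 : Integrable fun z : Phase => h (z + (a, 0)) • r (x - z.1) :=
    ((hi (x + a)).comp_add_right (a, 0)).congr (Eventually.of_forall hshift)
  rw [← integral_add_right_eq_self _ ((a, 0) : Phase),
    integral_congr_ae (Eventually.of_forall hshift), ← integral_sub hi2 (hi x)]
  refine (norm_integral_le_lintegral_norm _).trans ?_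
  refine ENNReal.toReal_le_of_le_ofReal (by positivity) ?_
  calc _ ≤ ∫⁻ z : Phase, ENNReal.ofReal c * (ENNReal.ofReal (W z) * ‖r (x - z.1)‖ₑ) := by
        refine lintegral_mono fun z => ?_
        rw [ofReal_norm, ← sub_smul, enorm_smul, ← mul_assoc, ← ENNReal.ofReal_mul hc,
          ← ofReal_norm (h (z + (a, 0)) - h z)]
        gcongr
        exact hdiff z
    _ ≤ _ := by
        rw [lintegral_const_mul' _ _ ENNReal.ofReal_ne_top, ENNReal.ofReal_mul hc]
        gcongr

lemma integral_distr_smul {θ : ℝ} {E : ℝ → R3 → R3} {f0 : Phase → ℝ} {t : ℝ}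
    (hm : Measurable (distr θ E f0 t)) {φ : R3 → R3} (hφ : Measurable φ) (x : R3) :
    ∫ z : Phase, distr θ E f0 t z • φ (x - z.1)
      = ∫ z : Phase, pull θ E f0 t z • φ (x - (z.1 + t • vel θ z.2)) := by
  have h := measurePreserving_stream θ t
  have hms : Measurable fun z : Phase => distr θ E f0 t z • φ (x - z.1) :=
    hm.smul (hφ.comp (measurable_const.sub measurable_fst))
  have h1 := integral_map (μ := volume) h.measurable.aemeasurable hms.aestronglyMeasurable
  rw [h.map_eq] at h1
  rw [h1]
  simp [distr]

lemma IsSmoothField.const_smul {E : ℝ → R3 → R3} (hE : IsSmoothField E) (β : ℝ) :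
    IsSmoothField fun t x => β • E t x := by
  refine ⟨fun t => (hE.differentiable t).const_smul β, ?_⟩
  have e : (fun q : ℝ × R3 => fderiv ℝ (fun x => β • E q.1 x) q.2)
      = fun q => β • fderiv ℝ (E q.1) q.2 :=
    funext fun q => fderiv_const_smul (hE.differentiable q.1 q.2) β
  rw [e]
  exact hE.continuous_fderiv.const_smul β

lemma abs_distr_add_sub_le {θ σ c : ℝ} {E : ℝ → R3 → R3} {f0 : Phase → ℝ}
    (hlip : ∀ t (z z' : Phase), ‖z.1 - z'.1‖ ≤ 1 → ‖z.2 - z'.2‖ ≤ 1 / 2 * bracket z.2 →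
      |pull θ E f0 t z - pull θ E f0 t z'| ≤ c * weight σ 9 z * ‖z - z'‖) (hc : 0 ≤ c)
    (t : ℝ) (z : Phase) {a : R3} (ha : ‖a‖ ≤ 1) :
    |distr θ E f0 t (z + (a, 0)) - distr θ E f0 t z|
      ≤ c * weight σ 4 (z.1 - t • vel θ z.2, z.2) * ‖a‖ := by
  have hbp := bracket_pos z.2
  have h1 := hlip t (z.1 - t • vel θ z.2, z.2) (z.1 + a - t • vel θ z.2, z.2)
    (by
      have : z.1 - t • vel θ z.2 - (z.1 + a - t • vel θ z.2) = -a := by abel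
      rw [this, norm_neg]; exact ha) (by rw [sub_self, norm_zero]; positivity)
  have e1 : ((z.1 - t • vel θ z.2, z.2) : Phase) - (z.1 + a - t • vel θ z.2, z.2)
      = (-a, 0) := by
    ext1
    · simp
    · simp
  rw [e1, Prod.norm_mk, norm_neg, norm_zero, max_eq_left (norm_nonneg _), abs_sub_comm] at h1
  have h2 := weight_anti (σ := σ) (show 4 ≤ 9 by norm_num) (z.1 - t • vel θ z.2, z.2)
  have h3 : distr θ E f0 t (z + (a, 0)) = pull θ E f0 t (z.1 + a - t • vel θ z.2, z.2) := by
    simp [distr]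
  rw [h3]
  exact h1.trans (by gcongr)

/-- The field generated by a transported datum is `C¹` in space. -/
lemma isSmoothField_newField {σ M η β θ : ℝ} {E : ℝ → R3 → R3} {f0 : Phase → ℝ} (hα1 : 1 < α)
    (hα2 : α < 2) (hσ : 3 < σ) (hk : IsKernel α A R k) (hβ : |β| ≤ 1) (hθ : 0 ≤ θ) (hθ1 : θ ≤ 1)
    (hE : IsField α M E) (hf : IsDatum σ η f0) : IsSmoothField (newField k β θ f0 E) := by
  have hα0 : 0 ≤ α := by linarith
  have hM := hE.nonneg
  have hη := hf.nonneg_size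
  obtain ⟨K, hK, hpull⟩ := exists_pull_bounds hα1 hM (by linarith : (0 : ℝ) ≤ σ)
  obtain ⟨hb, hlip, -⟩ := hpull θ η f0 E hθ hθ1 hE hf
  obtain ⟨C, hC, hnew⟩ := exists_norm_newField_le hα1 hα2 hσ hk hM
  obtain ⟨C1, hC1, hS⟩ := exists_shifted_weight_bound hσ
  have hpc := continuous_pull hE hα0 hθ hθ1 hf.contDiff.continuous
  have hdm : ∀ t, Measurable (distr θ E f0 t) := fun t =>
    ((continuous_distr hE hα0 hθ hθ1 hf.contDiff.continuous).comp
      (continuous_const.prodMk continuous_id)).measurable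
  have hdi : ∀ t, Integrable (distr θ E f0 t) := integrable_distr hE hα0 hθ hθ1 hσ hf hb
  refine isSmoothField_of_approx fun ε hε => ?_
  set ε' := ε / (K * η * (2 * C1) + 1) with hε'
  have hden : 0 < K * η * (2 * C1) + 1 := by positivity
  have hε0 : 0 < ε' := by positivity
  obtain ⟨φ, hφc, hφ, happ⟩ := hk.exists_smooth_approx hα1 hε0
  have hφm : Measurable φ := hφ.continuous.measurable
  obtain ⟨C0, hC0⟩ := hφ.continuous.bounded_above_of_compact_support hφc
  refine ⟨fun t x => β • ∫ z : Phase, pull θ E f0 t z • φ (x - (z.1 + t • vel θ z.2)),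
    (isSmoothField_integral_smooth hpc ((integrable_weight hσ (k := 8) (by norm_num)).const_mul
      (K * η)) hb hφ hφc θ).const_smul β, fun t x a ha => ?_⟩
  have hi1 : ∀ x, Integrable fun z : Phase => distr θ E f0 t z • k (x - z.1) :=
    fun x => (hnew θ β η f0 E hθ hθ1 hβ hE hf t x).1
  have hi2 : ∀ x, Integrable fun z : Phase => distr θ E f0 t z • φ (x - z.1) := fun x =>
    (hdi t).smul_bdd C0
      (hφm.comp (measurable_const.sub measurable_fst)).aestronglyMeasurable
      (Eventually.of_forall fun z => hC0 _)
  -- The error is the field of the kernel k - φ. Its increments fall on the density, which is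
  -- Lipschitz in space, so no regularity of k - φ is needed beyond its small size.
  have hrep : ∀ x, newField k β θ f0 E t x
      - β • ∫ z : Phase, pull θ E f0 t z • φ (x - (z.1 + t • vel θ z.2))
      = β • ∫ z : Phase, distr θ E f0 t z • (fun y => k y - φ y) (x - z.1) := fun x => by
    rw [← integral_distr_smul (hdm t) hφm, newField, force, ← smul_sub,
      ← integral_sub (hi1 x) (hi2 x)]
    simp only [smul_sub]
  have hi3 : ∀ x, Integrable fun z : Phase =>
      distr θ E f0 t z • (fun y => k y - φ y) (x - z.1) := fun x => by
    refine ((hi1 x).sub (hi2 x)).congr (Eventually.of_forall fun z => ?_)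
    simp [smul_sub]
  rw [hrep, hrep, ← smul_sub]
  refine (norm_smul_le_of_abs_le_one hβ _).trans ?_
  set W : Phase → ℝ := fun z => weight σ 4 (z.1 - t • vel θ z.2, z.2) with hW
  have hWm : Measurable W := (continuous_weight σ 4).measurable.comp
    ((measurable_fst.sub (((measurable_vel θ).comp measurable_snd).const_smul t)).prodMk
      measurable_snd)
  obtain ⟨hS1, hS2⟩ := hS (fun u => t • vel θ u) ((measurable_vel θ).const_smul t)
  have hNle := happ (fun z => ENNReal.ofReal (W z)) hWm.ennreal_ofReal _ _ hS1 hS2 x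
  rw [← ENNReal.ofReal_mul hε0.le, ← ENNReal.ofReal_add (by positivity) (by positivity)] at hNle
  have hN0 : 0 ≤ ε' * C1 + ε' * C1 := by positivity
  have hc0 : 0 ≤ K * η * ‖a‖ := by positivity
  have hmain := norm_integral_shift_sub_le (r := fun y => k y - φ y) (h := distr θ E f0 t) hi3
    (W := W) (c := K * η * ‖a‖) (a := a) (N := ε' * C1 + ε' * C1) (x := x) hc0 (fun z => ?_) hN0
    hNle
  rotate_left
  · exact (abs_distr_add_sub_le hlip (by positivity) t z ha).trans_eq (by ring)
  · refine hmain.trans ?_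
    have hna := norm_nonneg a
    calc _ = (K * η * (2 * C1)) * ε' * ‖a‖ := by ring
      _ ≤ (K * η * (2 * C1) + 1) * ε' * ‖a‖ := by gcongr; linarith
      _ = ε * ‖a‖ := by rw [hε', mul_div_cancel₀ _ hden.ne']

/-! ### The self-consistent field -/

lemma isField_zero (α : ℝ) {M : ℝ} (hM : 0 ≤ M) : IsField α M fun _ _ => 0 :=
  ⟨continuous_const, fun t x => by rw [norm_zero]; positivity,
    fun t x y => by rw [sub_zero, norm_zero]; positivity⟩

/-- Closedness of the class of dispersing fields. -/
lemma isField_of_tendsto {M : ℝ} {E : ℕ → ℝ → R3 → R3} {E' : ℝ → R3 → R3}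
    (hE : ∀ n, IsField α M (E n)) {d : ℕ → ℝ} (hd : Tendsto d atTop (𝓝 0))
    (h : ∀ n t x, ‖E n t x - E' t x‖ ≤ d n) : IsField α M E' := by
  have hlim : ∀ t x, Tendsto (fun n => E n t x) atTop (𝓝 (E' t x)) := fun t x =>
    tendsto_iff_norm_sub_tendsto_zero.2 (squeeze_zero (fun _ => norm_nonneg _)
      (fun n => h n t x) hd)
  refine ⟨?_, fun t x => le_of_tendsto (hlim t x).norm
    (Eventually.of_forall fun n => (hE n).bound t x), fun t x y =>
    le_of_tendsto ((hlim t x).sub (hlim t y)).norm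
      (Eventually.of_forall fun n => (hE n).lip t x y)⟩
  have hunif : TendstoUniformly (fun n (q : ℝ × R3) => E n q.1 q.2) (fun q => E' q.1 q.2)
      atTop := by
    rw [Metric.tendstoUniformly_iff]
    intro ε hε
    filter_upwards [hd.eventually (gt_mem_nhds hε)] with n hn q
    rw [dist_comm, dist_eq_norm]
    exact (h n q.1 q.2).trans_lt hn
  exact hunif.continuous (Frequently.of_forall fun n => (hE n).continuous)

/-- For small data the field map is a contraction. -/
lemma exists_newField_contraction {σ : ℝ} (hα1 : 1 < α) (hα2 : α < 2) (hσ : 3 < σ)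
    (hk : IsKernel α A R k) : ∃ ε : ℝ, 0 < ε ∧
    ∀ (θ β η : ℝ) (f0 : Phase → ℝ) (E E' : ℝ → R3 → R3), 0 ≤ θ → θ ≤ 1 → |β| ≤ 1 → η ≤ ε →
      IsDatum σ η f0 → IsField α 1 E → IsField α 1 E' → ∀ d, 0 ≤ d →
      (∀ t x, ‖E t x - E' t x‖ ≤ d * (1 + |t|) ^ (-(α + 1))) → ∀ t x,
      ‖newField k β θ f0 E t x - newField k β θ f0 E' t x‖
        ≤ d / 2 * (1 + |t|) ^ (-(α + 1)) := by
  obtain ⟨C, hC, h⟩ := exists_norm_newField_sub_newField_le hα1 hα2 hσ hk zero_le_one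
  have hτ := totalDecay_nonneg α
  set Q := 2 * totalDecay α * Real.exp (10 * 1 * totalDecay α) with hQ
  have hQ0 : 0 ≤ Q := by positivity
  -- A field distance d moves the flow by dQ and the generated field by CηQd; the choice of ε makes
  -- this at most d/2.
  refine ⟨1 / (2 * (C * Q + 1)), by positivity,
    fun θ β η f0 E E' hθ hθ1 hβ hηε hf hE hE' d hd hEE' t x => ?_⟩
  have hη := hf.nonneg_size
  have hα0 : 0 ≤ α := by linarith
  have hflow : ∀ z, ‖waveFlow θ E t z 0 - waveFlow θ E' t z 0‖ ≤ d * Q := fun z => by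
    have h1 := hE.norm_waveFlow_sub_waveFlow_le_of_field hE' hα1 hθ hθ1
      (d := fun u => d * (1 + |u|) ^ (-(α + 1))) (D := fun u => d * decayPrim α u) (t := t)
      (s := 0) (fun u => by positivity) (fun u => by
        refine ((hasDerivAt_decayPrim α u).const_mul d).congr_deriv ?_
        rw [mul_left_comm, decay_mul]) (fun u _ y => hEE' u y) z
    refine h1.trans ?_
    rw [← mul_sub, abs_mul, abs_of_nonneg hd]
    calc _ ≤ 2 * (d * totalDecay α) * Real.exp (10 * 1 * totalDecay α) := by
          gcongr; exact abs_decayPrim_sub_le hα1 _ _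
      _ = _ := by rw [hQ]; ring
  refine (h θ β η f0 E E' hθ hθ1 hβ hE hE' hf t (d * Q) (by positivity) hflow x).trans ?_
  have hsmall : C * Q * η ≤ 1 / 2 := by
    rw [le_div_iff₀ (by positivity)] at hηε
    nlinarith [mul_nonneg hC.le hQ0]
  have hw : 0 ≤ (1 + |t|) ^ (-(α + 1)) := by positivity
  calc _ = d * (C * Q * η) * (1 + |t|) ^ (-(α + 1)) := by ring
    _ ≤ d * (1 / 2) * (1 + |t|) ^ (-(α + 1)) := by gcongr
    _ = _ := by ring

/-- Existence of the self-consistent field for small data. -/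
lemma exists_selfConsistent {σ : ℝ} (hα1 : 1 < α) (hα2 : α < 2) (hσ : 3 < σ) (hσ4 : σ ≤ 4)
    (hk : IsKernel α A R k) : ∃ ε : ℝ, 0 < ε ∧ ∃ C : ℝ, 0 < C ∧
    ∀ (θ β η : ℝ) (f0 : Phase → ℝ), 0 ≤ θ → θ ≤ 1 → |β| ≤ 1 → η ≤ ε → IsDatum σ η f0 →
      ∃ E : ℝ → R3 → R3, IsField α 1 E ∧ IsField α (C * η) E ∧ IsSmoothField E ∧
        newField k β θ f0 E = E := by
  obtain ⟨ε1, hε1, hcontr⟩ := exists_newField_contraction hα1 hα2 hσ hk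
  obtain ⟨C, hC, hfield⟩ := exists_isField_newField hα1 hα2 hσ hσ4 hk zero_le_one
  refine ⟨min ε1 (1 / C), by positivity, C, hC, fun θ β η f0 hθ hθ1 hβ hηε hf => ?_⟩
  have hη1 : η ≤ ε1 := hηε.trans (min_le_left _ _)
  have hη2 : C * η ≤ 1 := by
    have := hηε.trans (min_le_right _ _)
    rwa [le_div_iff₀ hC, mul_comm] at this
  have hmap : ∀ E, IsField α 1 E → IsField α 1 (newField k β θ f0 E) := fun E hE =>
    (hfield θ β η f0 E hθ hθ1 hβ hE hf).mono hη2
  -- Picard iteration from the zero field. The distances are measured relative to (1+|t|)^{-(α+1)}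
  -- and halve at each step; the bound η ≤ 1/C keeps all iterates in the class of size 1.
  set F : ℕ → ℝ → R3 → R3 := fun n => (newField k β θ f0)^[n] fun _ _ => 0 with hF
  have hFs : ∀ n, F (n + 1) = newField k β θ f0 (F n) := fun n => by
    rw [hF]; exact Function.iterate_succ_apply' _ _ _
  have hFf : ∀ n, IsField α 1 (F n) := fun n => by
    induction n with
    | zero => exact isField_zero α zero_le_one
    | succ n ih => rw [hFs]; exact hmap _ ih
  have hstep : ∀ n t x, ‖F n t x - F (n + 1) t x‖ ≤ (1 / 2) ^ n * (1 + |t|) ^ (-(α + 1)) := by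
    intro n
    induction n with
    | zero =>
      intro t x
      have h0 : F 0 t x = 0 := rfl
      rw [h0, zero_sub, norm_neg, pow_zero]
      exact (hFf 1).bound t x
    | succ n ih =>
      intro t x
      rw [hFs (n + 1), hFs n]
      have := hcontr θ β η f0 (F n) (F (n + 1)) hθ hθ1 hβ hη1 hf (hFf n) (hFf (n + 1)) _
        (by positivity) ih t x
      rw [hFs n] at this
      refine this.trans_eq ?_
      rw [pow_succ]; ring
  have hcs : ∀ t x, CauchySeq fun n => F n t x := fun t x =>
    cauchySeq_of_le_geometric (1 / 2) ((1 + |t|) ^ (-(α + 1))) (by norm_num) fun n => by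
      rw [dist_eq_norm, mul_comm]; exact hstep n t x
  choose E hE using fun t x => cauchySeq_tendsto_of_complete (hcs t x)
  have hdist : ∀ n t x, ‖F n t x - E t x‖ ≤ 2 * (1 / 2) ^ n * (1 + |t|) ^ (-(α + 1)) :=
    fun n t x => by
      have := dist_le_of_le_geometric_of_tendsto (1 / 2) ((1 + |t|) ^ (-(α + 1)))
        (by norm_num) (fun n => by rw [dist_eq_norm, mul_comm]; exact hstep n t x) (hE t x) n
      rw [dist_eq_norm] at this
      refine this.trans_eq ?_
      ring
  have hpow : Tendsto (fun n : ℕ => 2 * (1 / 2 : ℝ) ^ n) atTop (𝓝 0) := by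
    have := (tendsto_pow_atTop_nhds_zero_of_lt_one (by norm_num : (0 : ℝ) ≤ 1 / 2)
      (by norm_num)).const_mul 2
    simpa using this
  have hEf : IsField α 1 E := isField_of_tendsto hFf hpow fun n t x =>
    (hdist n t x).trans (mul_le_of_le_one_right (by positivity) (decay_le_one (by linarith) t))
  have hself : newField k β θ f0 E = E := by
    funext t x
    have h1 : Tendsto (fun n => F (n + 1) t x) atTop (𝓝 (newField k β θ f0 E t x)) := by
      refine tendsto_iff_norm_sub_tendsto_zero.2 (squeeze_zero (fun _ => norm_nonneg _)
        (fun n => ?_) hpow)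
      rw [hFs]
      refine (hcontr θ β η f0 (F n) E hθ hθ1 hβ hη1 hf (hFf n) hEf _ (by positivity)
        (hdist n) t x).trans ?_
      have := decay_le_one (show 0 ≤ α + 1 by linarith) t
      have hp : 0 < (1 / 2 : ℝ) ^ n := by positivity
      nlinarith
    exact tendsto_nhds_unique h1 ((tendsto_add_atTop_iff_nat 1).2 (hE t x))
  refine ⟨E, hEf, ?_, ?_, hself⟩
  · have := hfield θ β η f0 E hθ hθ1 hβ hEf hf
    rwa [hself] at this
  · have := isSmoothField_newField hα1 hα2 hσ hk hβ hθ hθ1 hEf hf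
    rwa [hself] at this

end Kernel

end Vlasov

end

noncomputable section

namespace Vlasov

/-! ### Uniqueness -/

section Uniqueness

variable {α A R σ η β M T : ℝ} {c : ℝ≥0∞} {k : R3 → R3} {f0 : Phase → ℝ} {f : ℝ → Phase → ℝ}

/-- A cutoff in time, equal to one on `[-T, T]`. -/
def timeCutoff (T t : ℝ) : ℝ := ((1 + T) / (1 + max |t| T)) ^ 4

lemma timeCutoff_of_abs_le {t : ℝ} (hT : 0 ≤ T) (h : |t| ≤ T) : timeCutoff T t = 1 := by
  rw [timeCutoff, max_eq_right h, div_self (by positivity), one_pow]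

lemma continuous_timeCutoff (hT : 0 ≤ T) : Continuous (timeCutoff T) := by
  unfold timeCutoff
  refine (continuous_const.div (by fun_prop) fun t => ?_).pow 4
  have := le_max_right |t| T
  positivity

lemma timeCutoff_nonneg (hT : 0 ≤ T) (t : ℝ) : 0 ≤ timeCutoff T t := by
  unfold timeCutoff
  have := (abs_nonneg t).trans (le_max_left |t| T)
  positivity

/-- The fourth power dominates both required rates α+1 and α+2, since α < 2. -/
lemma timeCutoff_le (hT : 0 ≤ T) {a : ℝ} (ha : a ≤ 4) (t : ℝ) :
    timeCutoff T t ≤ (1 + T) ^ 4 * (1 + |t|) ^ (-a) := by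
  have h1 : 1 + |t| ≤ 1 + max |t| T := by gcongr; exact le_max_left _ _
  have h0 : 0 < 1 + |t| := by positivity
  calc timeCutoff T t ≤ ((1 + T) / (1 + |t|)) ^ 4 := by unfold timeCutoff; gcongr
    _ = (1 + T) ^ 4 * (1 + |t|) ^ (-(4 : ℝ)) := by
        rw [div_pow, Real.rpow_neg h0.le, div_eq_mul_inv]
        norm_cast
    _ ≤ _ := mul_le_mul_of_nonneg_left (decay_mono ha t) (by positivity)

/-- The force field of a solution on `[0, T]`, extended to all times. -/
def extendedField (k : R3 → R3) (β : ℝ) (f : ℝ → Phase → ℝ) (T t : ℝ) (x : R3) : R3 :=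
  timeCutoff T t • force k β (f (max 0 (min t T))) x

lemma extendedField_of_mem (k : R3 → R3) (β : ℝ) (f : ℝ → Phase → ℝ) {t : ℝ} (ht : t ∈ Icc 0 T)
    (x : R3) : extendedField k β f T t x = force k β (f t) x := by
  have hT : 0 ≤ T := ht.1.trans ht.2
  rw [extendedField, timeCutoff_of_abs_le hT (by rw [abs_of_nonneg ht.1]; exact ht.2), one_smul,
    min_eq_left ht.2, max_eq_right ht.1]

/-- An arbitrary solution has no known decay, only bounds on [0, T]. Freezing its field outside [0,
T] and cutting it off puts it into the class of decaying fields, with a possibly large constant, so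
that the global flow theory applies to it. -/
lemma IsSolution.exists_isField_extendedField (hf : IsSolution k β c f0 f) (hα : α < 2)
    (hT : 0 ≤ T) : ∃ M, IsField α M (extendedField k β f T) := by
  obtain ⟨M, hM⟩ := hf.bounded_force T
  have hM0 : 0 ≤ M := (norm_nonneg _).trans (hM 0 le_rfl hT 0).1
  have hcl : ∀ t : ℝ, 0 ≤ max 0 (min t T) ∧ max 0 (min t T) ≤ T := fun t =>
    ⟨le_max_left _ _, max_le hT (min_le_right _ _)⟩
  refine ⟨(1 + T) ^ 4 * M, ?_, fun t x => ?_, fun t x y => ?_⟩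
  · have hcc : Continuous fun q : ℝ × R3 => ((max 0 (min q.1 T), q.2) : ℝ × R3) := by fun_prop
    refine ((continuous_timeCutoff hT).comp continuous_fst).smul ?_
    exact hf.continuous_force.comp_continuous hcc fun q => ⟨(hcl q.1).1, mem_univ _⟩
  · rw [extendedField, norm_smul, Real.norm_of_nonneg (timeCutoff_nonneg hT t)]
    calc _ ≤ ((1 + T) ^ 4 * (1 + |t|) ^ (-(α + 1))) * M :=
          mul_le_mul (timeCutoff_le hT (by linarith) t)
            (hM _ (hcl t).1 (hcl t).2 x).1 (norm_nonneg _) (by positivity)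
      _ = _ := by ring
  · rw [extendedField, extendedField, ← smul_sub, norm_smul,
      Real.norm_of_nonneg (timeCutoff_nonneg hT t)]
    have h := convex_univ.norm_image_sub_le_of_norm_fderiv_le (𝕜 := ℝ)
      (f := force k β (f (max 0 (min t T)))) (C := M)
      (fun z _ => hf.differentiable_force _ (hcl t).1 z)
      (fun z _ => (hM _ (hcl t).1 (hcl t).2 z).2) (mem_univ y) (mem_univ x)
    calc _ ≤ ((1 + T) ^ 4 * (1 + |t|) ^ (-(α + 2))) * (M * ‖x - y‖) :=
          mul_le_mul (timeCutoff_le hT (by linarith) t) h (norm_nonneg _) (by positivity)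
      _ = _ := by ring

/-- A solution is constant along its characteristics. -/
lemma IsSolution.hasDerivWithinAt_comp (hf : IsSolution k β c f0 f) {Z : ℝ → Phase} {s : ℝ}
    (hs : 0 ≤ s) (hZ : HasDerivAt Z (velocity c (Z s).2, force k β (f s) (Z s).1) s) :
    HasDerivWithinAt (fun u => f u (Z u)) 0 (Ici 0) s := by
  set F : ℝ × Phase → ℝ := fun q => f q.1 q.2 with hF
  set V : Phase := (velocity c (Z s).2, force k β (f s) (Z s).1) with hV
  have hd := (hf.contDiff.differentiableOn one_ne_zero (s, Z s) ⟨hs, mem_univ _⟩).hasFDerivWithinAt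
  set F' := fderivWithin ℝ (fun q : ℝ × Phase => f q.1 q.2) (Ici 0 ×ˢ univ) (s, Z s) with hF'
  have h1 : HasDerivWithinAt (fun u => f u (Z s)) (F' (1, 0)) (Ici 0) s :=
    HasFDerivWithinAt.comp_hasDerivWithinAt (l := F) (f := fun u => (u, Z s)) s hd
      ((hasDerivWithinAt_id s _).prodMk (hasDerivWithinAt_const s _ (Z s)))
      fun u hu => ⟨hu, mem_univ _⟩
  have h2 : HasFDerivAt (f s) (F'.comp (ContinuousLinearMap.inr ℝ ℝ Phase)) (Z s) := by
    have := HasFDerivWithinAt.comp (g := F) (f := fun y => (s, y)) (Z s) hd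
      (hasFDerivAt_prodMk_right s (Z s)).hasFDerivWithinAt (s := univ)
      fun y _ => ⟨hs, mem_univ _⟩
    exact hasFDerivWithinAt_univ.1 this
  have h3 := hf.equation s hs (Z s).1 (Z s).2
  have h4 := ((uniqueDiffOn_Ici (0 : ℝ)) s hs).eq_deriv _ h1 h3
  rw [h2.fderiv] at h4
  have h5 : HasDerivWithinAt (fun u => f u (Z u)) (F' (1, V)) (Ici 0) s :=
    HasFDerivWithinAt.comp_hasDerivWithinAt (l := F) (f := fun u => (u, Z u)) s hd
      ((hasDerivWithinAt_id s _).prodMk hZ.hasDerivWithinAt) fun u hu => ⟨hu, mem_univ _⟩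
  refine h5.congr_deriv ?_
  have e : ((1, V) : ℝ × Phase) = (1, 0) + (0, V) := by simp
  rw [e, map_add, h4]
  simp [hV]

/-- A solution is the transport of its datum by its own field. -/
lemma IsSolution.eq_distr_of_field (hf : IsSolution k β c f0 f) (hα : 0 ≤ α) (hθ : 0 ≤ invSpeed c)
    (hθ1 : invSpeed c ≤ 1) {E : ℝ → R3 → R3} (hE : IsField α M E)
    (heq : ∀ t ∈ Icc 0 T, ∀ x, E t x = force k β (f t) x) {t : ℝ} (ht : t ∈ Icc 0 T) :
    f t = distr (invSpeed c) E f0 t := by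
  funext z
  set y := freeFlow c (-t) z with hy
  set Z : ℝ → Phase := fun s => freeFlow c s (waveFlow (invSpeed c) E t y s) with hZ
  have hder : ∀ s ∈ Icc 0 t, HasDerivWithinAt (fun u => f u (Z u)) 0 (Ici 0) s := fun s hs => by
    refine hf.hasDerivWithinAt_comp hs.1 ?_
    have h := hasDerivAt_freeFlow (c := c) (hE.hasDerivAt_waveFlow hα hθ hθ1 t y s)
    rwa [heq s ⟨hs.1, hs.2.trans ht.2⟩] at h
  have hconst := constant_of_has_deriv_right_zero (f := fun u => f u (Z u)) (a := 0) (b := t)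
    (fun s hs => ((hder s hs).continuousWithinAt).mono Icc_subset_Ici_self)
    (fun s hs => (hder s (Ico_subset_Icc_self hs)).mono (Ici_subset_Ici.2 hs.1)) t
    (right_mem_Icc.2 ht.1)
  have h1 : Z t = z := by
    simp only [hZ, hE.waveFlow_self hα hθ hθ1, hy, freeFlow_freeFlow_neg]
  have h2 : Z 0 = waveFlow (invSpeed c) E t y 0 := by simp [hZ, freeFlow_eq]
  simp only [h1, h2, hf.initial] at hconst
  rw [hconst, distr, pull]
  simp [hy, freeFlow_eq, sub_eq_add_neg]

/-- Two fields that are self-consistent on `[0, T]` coincide there. -/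
lemma eq_of_selfConsistent (hα1 : 1 < α) (hα2 : α < 2) (hσ : 3 < σ) (hk : IsKernel α A R k)
    (hβ : |β| ≤ 1) {θ : ℝ} (hθ : 0 ≤ θ) (hθ1 : θ ≤ 1) (hf0 : IsDatum σ η f0)
    {E E' : ℝ → R3 → R3} (hE : IsField α M E) (hE' : IsField α M E')
    (heq : ∀ t ∈ Icc 0 T, ∀ x, newField k β θ f0 E t x = E t x)
    (heq' : ∀ t ∈ Icc 0 T, ∀ x, newField k β θ f0 E' t x = E' t x) {t : ℝ} (ht : t ∈ Icc 0 T)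
    (x : R3) : E t x = E' t x := by
  have hM := hE.nonneg
  have hη := hf0.nonneg_size
  have hT : 0 ≤ T := ht.1.trans ht.2
  obtain ⟨C, hC, h⟩ := exists_norm_newField_sub_newField_le hα1 hα2 hσ hk hM
  set e := Real.exp (10 * M * totalDecay α) with he
  -- The constant M may be large here, so contraction is not due to small data: in the sup norm
  -- weighted by exp(-l t), integration in time gains 1/l, and this l makes the factor at most 1/2.
  set l := 4 * (C * η * (1 + T) * e) + 1 with hl
  have hl0 : 0 < l := by positivity
  have key : ∀ n : ℕ, ∀ t ∈ Icc 0 T, ∀ x,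
      ‖E t x - E' t x‖ ≤ 2 * M * (1 / 2) ^ n * Real.exp (l * t) := by
    intro n
    induction n with
    | zero =>
      intro t ht x
      have h1 := (hE.bound t x).trans (mul_le_of_le_one_right hM (decay_le_one (by linarith) t))
      have h2 := (hE'.bound t x).trans (mul_le_of_le_one_right hM (decay_le_one (by linarith) t))
      have h3 : 1 ≤ Real.exp (l * t) := Real.one_le_exp (mul_nonneg hl0.le ht.1)
      refine (norm_sub_le _ _).trans ?_
      rw [pow_zero, mul_one]
      nlinarith
    | succ n ih =>
      intro t ht x
      set S := 2 * M * (1 / 2 : ℝ) ^ n with hS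
      have hS0 : 0 ≤ S := by positivity
      have hflow : ∀ z, ‖waveFlow θ E t z 0 - waveFlow θ E' t z 0‖
          ≤ 2 * (S * (1 + T) / l * Real.exp (l * t)) * e := fun z => by
        have h1 := hE.norm_waveFlow_sub_waveFlow_le_of_field hE' hα1 hθ hθ1
          -- The flow estimate integrates (1+|u|)d(u). Dividing by 1+|u| and paying the factor 1+T
          -- on [0, T] makes the primitive an explicit exponential.
          (d := fun u => S * (1 + T) * Real.exp (l * u) / (1 + |u|))
          (D := fun u => S * (1 + T) / l * Real.exp (l * u)) (t := t) (s := 0)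
          (fun u => by positivity) (fun u => by
            have hu : (1 + |u|) ≠ 0 := by positivity
            have hd := (((hasDerivAt_id u).const_mul l).exp).const_mul (S * (1 + T) / l)
            refine hd.congr_deriv ?_
            simp only [id]
            field_simp) (fun u hu y => by
            rw [uIcc_of_ge ht.1] at hu
            refine (ih u ⟨hu.1, hu.2.trans ht.2⟩ y).trans ?_
            rw [le_div_iff₀ (by positivity)]
            have hexp := Real.exp_pos (l * u)
            have hu1 : 1 + |u| ≤ 1 + T := by
              rw [abs_of_nonneg hu.1]; linarith [hu.2, ht.2]
            calc _ ≤ S * Real.exp (l * u) * (1 + T) := by gcongr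
              _ = _ := by ring) z
        refine h1.trans ?_
        have hc0 : 0 ≤ S * (1 + T) / l := by positivity
        rw [← mul_sub, abs_mul, abs_of_nonneg hc0, mul_zero, Real.exp_zero]
        gcongr
        have h3 : 1 ≤ Real.exp (l * t) := Real.one_le_exp (mul_nonneg hl0.le ht.1)
        rw [abs_le]
        constructor <;> linarith
      have h2 := h θ β η f0 E E' hθ hθ1 hβ hE hE' hf0 t _ (by positivity) hflow x
      rw [heq t ht, heq' t ht] at h2
      refine h2.trans ?_
      have hsmall : C * η * (2 * ((1 + T) / l) * e) ≤ 1 / 2 := by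
        have e1 : C * η * (2 * ((1 + T) / l) * e) = 2 * (C * η * (1 + T) * e) / l := by
          field_simp
        rw [e1, div_le_iff₀ hl0]
        linarith
      have hexp := Real.exp_pos (l * t)
      have hw0 : 0 ≤ (1 + |t|) ^ (-(α + 1)) := by positivity
      calc _ = (C * η * (2 * ((1 + T) / l) * e)) * (S * Real.exp (l * t))
            * (1 + |t|) ^ (-(α + 1)) := by ring
        _ ≤ 1 / 2 * (S * Real.exp (l * t)) * 1 := by
            gcongr
            exact decay_le_one (by linarith) t
        _ = _ := by rw [hS, pow_succ]; ring
  have hlim : Tendsto (fun n : ℕ => 2 * M * (1 / 2 : ℝ) ^ n * Real.exp (l * t)) atTop (𝓝 0) := by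
    have := ((tendsto_pow_atTop_nhds_zero_of_lt_one (by norm_num : (0 : ℝ) ≤ 1 / 2)
      (by norm_num)).const_mul (2 * M)).mul_const (Real.exp (l * t))
    simpa using this
  have := ge_of_tendsto' hlim fun n => key n t ht x
  exact sub_eq_zero.1 (norm_le_zero_iff.1 this)

/-- Every solution is the transport of its datum by the self-consistent field. -/
lemma IsSolution.eq_distr (hf : IsSolution k β c f0 f) (hα1 : 1 < α) (hα2 : α < 2) (hσ : 3 < σ)
    (hk : IsKernel α A R k) (hβ : |β| ≤ 1) (hθ : 0 ≤ invSpeed c) (hθ1 : invSpeed c ≤ 1)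
    (hf0 : IsDatum σ η f0) {E : ℝ → R3 → R3} (hE : IsField α M E)
    (hself : newField k β (invSpeed c) f0 E = E) {t : ℝ} (ht : 0 ≤ t) :
    f t = distr (invSpeed c) E f0 t := by
  have hα0 : 0 ≤ α := by linarith
  obtain ⟨M', hE'⟩ := hf.exists_isField_extendedField (T := t) hα2 ht
  have heq' : ∀ s ∈ Icc 0 t, ∀ x, extendedField k β f t s x = force k β (f s) x :=
    fun s hs x => extendedField_of_mem k β f hs x
  have hrep : ∀ s ∈ Icc 0 t, f s = distr (invSpeed c) (extendedField k β f t) f0 s :=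
    fun s hs => hf.eq_distr_of_field hα0 hθ hθ1 hE' heq' hs
  have hsame : ∀ s ∈ Icc 0 t, ∀ x, extendedField k β f t s x = E s x := fun s hs x =>
    eq_of_selfConsistent (M := max M M') hα1 hα2 hσ hk hβ hθ hθ1 hf0
      (hE'.mono (le_max_right _ _)) (hE.mono (le_max_left _ _))
      (fun s hs x => by rw [newField, ← hrep s hs, heq' s hs])
      (fun s _ x => by rw [hself]) hs x
  exact hf.eq_distr_of_field hα0 hθ hθ1 hE
    (fun s hs x => by rw [← hsame s hs, heq' s hs]) (right_mem_Icc.2 ht)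

/-- The characteristic flow in free-streaming coordinates. -/
lemma IsCharFlow.eq_freeFlow_waveFlow {Φ : ℝ → Phase → Phase} {E E' : ℝ → R3 → R3}
    (hΦ : IsCharFlow c E' Φ) (hα : 0 ≤ α) (hθ : 0 ≤ invSpeed c) (hθ1 : invSpeed c ≤ 1)
    (hE : IsField α M E) (heq : ∀ t, 0 ≤ t → E' t = E t) {t : ℝ} (ht : 0 ≤ t) (z : Phase) :
    Φ t z = freeFlow c t (waveFlow (invSpeed c) E 0 z t) := by
  set Z : ℝ → Phase := fun s => freeFlow c (-s) (Φ s z) with hZ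
  have hder : ∀ s, 0 ≤ s →
      HasDerivWithinAt Z (waveField (invSpeed c) E s (Z s)) (Ici 0) s := fun s hs => by
    have h0 := hΦ.equation s hs z
    rw [heq s hs] at h0
    have h1 : HasDerivWithinAt (fun s => (Φ s z).1) (velocity c (Φ s z).2) (Ici 0) s := h0.fst
    have h2 : HasDerivWithinAt (fun s => (Φ s z).2) (E s (Φ s z).1) (Ici 0) s := h0.snd
    have hv := (hasFDerivAt_vel (invSpeed c) (Φ s z).2).comp_hasDerivWithinAt s h2
    have h := (h1.add (((hasDerivAt_id s).neg.hasDerivWithinAt).smul hv)).prodMk h2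
    refine h.congr_deriv ?_
    simp only [hZ, freeFlow_eq, waveField, velocity_eq_vel, Function.comp]
    ext1
    · simp
    · simp
  have h := (hE.isBoundedLipschitz hα hθ hθ1).eq_flow_of_forward (T := t) (Z := Z)
    (fun s hs => (hder s hs.1).continuousWithinAt.mono Icc_subset_Ici_self)
    (fun s hs => (hder s hs.1).mono (Ici_subset_Ici.2 hs.1)) (right_mem_Icc.2 ht)
  have h0 : Z 0 = z := by simp [hZ, freeFlow_eq, hΦ.initial]
  rw [h0] at h
  rw [waveFlow, ← h, hZ, freeFlow_freeFlow_neg]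

end Uniqueness

end Vlasov

end

noncomputable section

namespace Vlasov

/-! ### Pointwise form of the smallness condition -/

/-- For continuous g the set where |g| > η is open; if it were nonempty it would have positive
measure. -/
lemma abs_le_of_eLpNorm_le {g : Phase → ℝ} (hg : Continuous g) {η : ℝ} (hη : 0 ≤ η)
    (h : eLpNorm g ∞ volume ≤ ENNReal.ofReal η) (z : Phase) : |g z| ≤ η := by
  by_contra! hlt
  have hopen : IsOpen {z | η < |g z|} := isOpen_lt continuous_const hg.abs
  have hpos : 0 < volume {z | η < |g z|} := hopen.measure_pos volume ⟨z, hlt⟩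
  refine hpos.ne' ?_
  have hae : ∀ᵐ y : Phase, ‖g y‖ₑ ≤ ENNReal.ofReal η := by
    filter_upwards [ae_le_eLpNormEssSup (f := g) (μ := volume)] with y hy
    rw [eLpNorm_exponent_top] at h
    exact hy.trans h
  refine measure_mono_null (fun y hy => ?_) (ae_iff.1 hae)
  simp only [mem_ofPred_eq] at hy ⊢
  rw [not_le, ← ofReal_norm, Real.norm_eq_abs]
  exact (ENNReal.ofReal_lt_ofReal_iff (hη.trans_lt hy)).2 hy

lemma isDatum_of_dataSize_le {σ η : ℝ} {f0 : Phase → ℝ} (hη : 0 ≤ η) (hf : ContDiff ℝ 1 f0)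
    (hf0 : ∀ z, 0 ≤ f0 z) (h : dataSize σ f0 ≤ ENNReal.ofReal η) : IsDatum σ η f0 := by
  have hb1 : Continuous fun z : Phase => bracket z.1 ^ σ :=
    (continuous_bracket.comp continuous_fst).rpow_const fun z => Or.inl (bracket_pos _).ne'
  have hb2 : ∀ k, Continuous fun z : Phase => bracket z.2 ^ k := fun k =>
    (continuous_bracket.comp continuous_snd).pow k
  have hmul : ∀ (k : ℕ) (z : Phase) (a : ℝ), |bracket z.1 ^ σ * bracket z.2 ^ k * a| ≤ η →
      |a| ≤ η * weight σ k z := fun k z a ha => by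
    have h1 : 0 < bracket z.1 ^ σ := Real.rpow_pos_of_pos (bracket_pos _) σ
    have h2 : 0 < bracket z.2 ^ k := pow_pos (bracket_pos _) k
    rw [abs_mul, abs_of_pos (mul_pos h1 h2)] at ha
    rw [weight, Real.rpow_neg (bracket_pos _).le, ← mul_inv, ← div_eq_mul_inv,
      le_div_iff₀ (mul_pos h1 h2)]
    linarith
  refine ⟨hf, hf0, fun z => hmul 8 z _ ?_, fun z => ?_⟩
  · exact abs_le_of_eLpNorm_le ((hb1.mul (hb2 8)).mul hf.continuous) hη (le_self_add.trans h) z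
  · rw [← abs_norm (fderiv ℝ f0 z)]
    exact hmul 9 z _ (abs_le_of_eLpNorm_le ((hb1.mul (hb2 9)).mul
      (hf.continuous_fderiv one_ne_zero).norm) hη (le_add_self.trans h) z)

lemma IsDatum.mono_left {σ σ' η : ℝ} {f0 : Phase → ℝ} (hf : IsDatum σ η f0) (h : σ' ≤ σ) :
    IsDatum σ' η f0 := by
  have hη := hf.nonneg_size
  exact ⟨hf.contDiff, hf.nonneg,
    fun z => (hf.bound z).trans (by gcongr; exact weight_anti_left h 8 z),
    fun z => (hf.grad z).trans (by gcongr; exact weight_anti_left h 9 z)⟩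

lemma IsDatum.integrable_grad {σ η : ℝ} {f0 : Phase → ℝ} (hf : IsDatum σ η f0) (hσ : 3 < σ) :
    Integrable fun z : Phase => bracket z.2 ^ 3 * ‖fderiv ℝ f0 z‖ := by
  have hη := hf.nonneg_size
  refine ((integrable_weight hσ (k := 6) (by norm_num)).const_mul η).mono'
    (((continuous_bracket.comp continuous_snd).pow 3).mul
      (hf.contDiff.continuous_fderiv one_ne_zero).norm).aestronglyMeasurable
    (Eventually.of_forall fun z => ?_)
  have hb := bracket_pos z.2
  rw [Real.norm_of_nonneg (by positivity), ← bracket_pow_mul_weight σ 3 6]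
  calc _ ≤ bracket z.2 ^ 3 * (η * weight σ 9 z) := by gcongr; exact hf.grad z
    _ = _ := by norm_num; ring

/-! ### Almost isometric changes of variables -/

/-- Such a map shrinks distances by at most a factor 2, so preimages gain at most 2⁶ in measure in
dimension 6. Hausdorff measure gives this for Lipschitz maps, without a Jacobian. -/
lemma lintegral_comp_le_of_near_id {T : Phase → Phase} (hT : Continuous T)
    (h : ∀ z z', ‖(T z - T z') - (z - z')‖ ≤ 1 / 2 * ‖z - z'‖) {g : Phase → ℝ≥0∞}
    (hg : Measurable g) : ∫⁻ z, g (T z) ≤ 2 ^ 6 * ∫⁻ z, g z := by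
  have hanti : AntilipschitzWith 2 T := AntilipschitzWith.of_le_mul_dist fun z z' => by
    rw [dist_eq_norm, dist_eq_norm]
    have h1 := h z z'
    have h2 := norm_sub_norm_le (z - z') ((z - z') - (T z - T z'))
    rw [sub_sub_cancel, norm_sub_rev (z - z') (T z - T z')] at h2
    push_cast
    linarith
  have hfin : Module.finrank ℝ Phase = 6 := by simp [Module.finrank_prod]
  have hmap : Measure.map T volume ≤ (2 ^ 6 : ℝ≥0∞) • (volume : Measure Phase) := by
    refine Measure.le_iff.2 fun s hs => ?_
    rw [Measure.map_apply hT.measurable hs, Measure.smul_apply, smul_eq_mul]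
    have hH : (Measure.hausdorffMeasure (Module.finrank ℝ Phase) : Measure Phase).IsAddHaarMeasure :=
      inferInstance
    have e := Measure.isAddLeftInvariant_eq_smul (volume : Measure Phase)
      (Measure.hausdorffMeasure (Module.finrank ℝ Phase))
    have h6 := hanti.hausdorffMeasure_preimage_le
      (d := (Module.finrank ℝ Phase : ℝ)) (Nat.cast_nonneg _) s
    have e6 : ((2 : NNReal) : ℝ≥0∞) ^ (Module.finrank ℝ Phase : ℝ) = 2 ^ 6 := by
      rw [ENNReal.rpow_natCast, hfin]; norm_num
    rw [e6] at h6
    rw [e, Measure.smul_apply, Measure.smul_apply]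
    rw [ENNReal.smul_def, ENNReal.smul_def, smul_eq_mul, smul_eq_mul, mul_left_comm]
    gcongr
  calc ∫⁻ z, g (T z) = ∫⁻ z, g z ∂(Measure.map T volume) := (lintegral_map hg hT.measurable).symm
    _ ≤ ∫⁻ z, g z ∂((2 ^ 6 : ℝ≥0∞) • (volume : Measure Phase)) := lintegral_mono' hmap le_rfl
    _ = _ := by rw [lintegral_smul_measure, smul_eq_mul]

lemma enorm_comp_sub_comp_le {f0 : Phase → ℝ} (hf : ContDiff ℝ 1 f0) (a b : Phase) :
    ‖f0 b - f0 a‖ₑ ≤ ∫⁻ s in Icc (0 : ℝ) 1, ‖fderiv ℝ f0 (a + s • (b - a))‖ₑ * ‖b - a‖ₑ := by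
  have hline : ∀ s : ℝ, HasDerivAt (fun s : ℝ => a + s • (b - a)) (b - a) s := fun s => by
    simpa using ((hasDerivAt_id s).smul_const (b - a)).const_add a
  have hder : ∀ s : ℝ, HasDerivAt (fun s : ℝ => f0 (a + s • (b - a)))
      (fderiv ℝ f0 (a + s • (b - a)) (b - a)) s := fun s =>
    ((hf.differentiable one_ne_zero) _).hasFDerivAt.comp_hasDerivAt s (hline s)
  have hcont : Continuous fun s : ℝ => fderiv ℝ f0 (a + s • (b - a)) (b - a) :=
    ((hf.continuous_fderiv one_ne_zero).comp (by fun_prop)).clm_apply continuous_const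
  have h := intervalIntegral.integral_eq_sub_of_hasDerivAt (a := 0) (b := 1)
    (fun s _ => hder s) (hcont.intervalIntegrable 0 1)
  simp only [one_smul, zero_smul, add_zero, add_sub_cancel] at h
  rw [← h, intervalIntegral.integral_of_le zero_le_one, ← integral_Icc_eq_integral_Ioc]
  refine (enorm_integral_le_lintegral_enorm _).trans (lintegral_mono fun s => ?_)
  exact ContinuousLinearMap.le_opENorm _ _

/-- Two almost isometric changes of variables with nearby values change an `L¹` function little. -/
lemma integral_comp_sub_comp_le {f0 : Phase → ℝ} (hf : ContDiff ℝ 1 f0)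
    (hfi : Integrable fun z : Phase => bracket z.2 ^ 3 * ‖fderiv ℝ f0 z‖) {V V' : Phase → Phase}
    (hV : Continuous V) (hV' : Continuous V')
    (h : ∀ z z', ‖(V z - V z') - (z - z')‖ ≤ 1 / 2 * ‖z - z'‖)
    (h' : ∀ z z', ‖(V' z - V' z') - (z - z')‖ ≤ 1 / 2 * ‖z - z'‖) {A δ : ℝ} (hδ : 0 ≤ δ)
    (hA : ∀ z, ‖V z - z‖ ≤ A) (hA' : ∀ z, ‖V' z - z‖ ≤ A)
    (hVV' : ∀ z, ‖V z - V' z‖ ≤ δ * bracket z.2 ^ 3) :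
    ∫ z, |f0 (V z) - f0 (V' z)|
      ≤ 2 ^ 6 * (1 + A) ^ 3 * δ * ∫ z : Phase, bracket z.2 ^ 3 * ‖fderiv ℝ f0 z‖ := by
  have hA0 : 0 ≤ A := (norm_nonneg _).trans (hA 0)
  set G : Phase → ℝ := fun z => bracket z.2 ^ 3 * ‖fderiv ℝ f0 z‖ with hG
  have hGc : Continuous G := ((continuous_bracket.comp continuous_snd).pow 3).mul
    (hf.continuous_fderiv one_ne_zero).norm
  have hG0 : ∀ z, 0 ≤ G z := fun z =>
    mul_nonneg (pow_nonneg (bracket_pos _).le 3) (norm_nonneg _)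
  set T : ℝ → Phase → Phase := fun s z => V' z + s • (V z - V' z) with hT
  have hTc : Continuous fun q : ℝ × Phase => T q.1 q.2 :=
    (hV'.comp continuous_snd).add (continuous_fst.smul
      ((hV.comp continuous_snd).sub (hV'.comp continuous_snd)))
  have hGm : Measurable fun q : ℝ × Phase => ENNReal.ofReal (G (T q.1 q.2)) :=
    (hGc.comp hTc).measurable.ennreal_ofReal
  have hconv : ∀ s ∈ Icc (0 : ℝ) 1, ∀ (a b : Phase) (r : ℝ), ‖a‖ ≤ r → ‖b‖ ≤ r →
      ‖(1 - s) • a + s • b‖ ≤ r := fun s hs a b r ha hb => by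
    refine (norm_add_le _ _).trans ?_
    rw [norm_smul, norm_smul, Real.norm_of_nonneg hs.1,
      Real.norm_of_nonneg (by linarith [hs.2] : 0 ≤ 1 - s)]
    nlinarith [hs.1, hs.2]
  -- Each interpolating map is a convex combination of V and V', so it satisfies the same closeness
  -- to the identity and changes variables at the same cost.
  have hchange : ∀ s ∈ Icc (0 : ℝ) 1,
      ∫⁻ z, ENNReal.ofReal (G (T s z)) ≤ 2 ^ 6 * ∫⁻ z, ENNReal.ofReal (G z) := fun s hs => by
    refine lintegral_comp_le_of_near_id (T := T s)
      (hTc.comp (continuous_const.prodMk continuous_id)) (fun z z' => ?_) hGc.measurable.ennreal_ofReal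
    have e : T s z - T s z' - (z - z') = (1 - s) • ((V' z - V' z') - (z - z'))
        + s • ((V z - V z') - (z - z')) := by
      simp only [hT]; module
    rw [e]
    exact hconv s hs _ _ _ (h' z z') (h z z')
  have hpt : ∀ z, ‖f0 (V z) - f0 (V' z)‖ₑ ≤ ENNReal.ofReal ((1 + A) ^ 3 * δ)
      * ∫⁻ s in Icc (0 : ℝ) 1, ENNReal.ofReal (G (T s z)) := fun z => by
    refine (enorm_comp_sub_comp_le hf (V' z) (V z)).trans ?_
    rw [← lintegral_const_mul' _ _ ENNReal.ofReal_ne_top]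
    refine setLIntegral_mono' measurableSet_Icc fun s hs => ?_
    rw [← ofReal_norm, ← ofReal_norm, ← ENNReal.ofReal_mul (norm_nonneg _),
      ← ENNReal.ofReal_mul (by positivity)]
    refine ENNReal.ofReal_le_ofReal ?_
    have hTz : ‖z - T s z‖ ≤ A := by
      have e : z - T s z = -((1 - s) • (V' z - z) + s • (V z - z)) := by
        simp only [hT]; module
      rw [e, norm_neg]
      exact hconv s hs _ _ _ (hA' z) (hA z)
    have hb : bracket z.2 ≤ (1 + A) * bracket (T s z).2 :=
      bracket_le_mul ((norm_snd_le (z - T s z)).trans hTz)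
    have hbp := bracket_pos z.2
    calc ‖fderiv ℝ f0 (T s z)‖ * ‖V z - V' z‖
        ≤ ‖fderiv ℝ f0 (T s z)‖ * (δ * ((1 + A) * bracket (T s z).2) ^ 3) := by
          gcongr
          exact (hVV' z).trans (by gcongr)
      _ = _ := by simp only [hG]; ring
  have hint : ∫⁻ z, ‖f0 (V z) - f0 (V' z)‖ₑ ≤
      ENNReal.ofReal (2 ^ 6 * (1 + A) ^ 3 * δ * ∫ z, G z) := by
    calc _ ≤ ∫⁻ z, ENNReal.ofReal ((1 + A) ^ 3 * δ)
          * ∫⁻ s in Icc (0 : ℝ) 1, ENNReal.ofReal (G (T s z)) := lintegral_mono hpt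
      _ = ENNReal.ofReal ((1 + A) ^ 3 * δ)
          * ∫⁻ s in Icc (0 : ℝ) 1, ∫⁻ z, ENNReal.ofReal (G (T s z)) := by
          rw [lintegral_const_mul' _ _ ENNReal.ofReal_ne_top]
          congr 1
          exact lintegral_lintegral_swap (hGm.comp measurable_swap).aemeasurable
      _ ≤ ENNReal.ofReal ((1 + A) ^ 3 * δ)
          * ∫⁻ _ in Icc (0 : ℝ) 1, 2 ^ 6 * ∫⁻ z, ENNReal.ofReal (G z) := by
          exact mul_le_mul' le_rfl (setLIntegral_mono' measurableSet_Icc hchange)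
      _ = _ := by
          rw [setLIntegral_const, Real.volume_Icc, sub_zero, ENNReal.ofReal_one, mul_one,
            ← ofReal_integral_eq_lintegral_ofReal hfi (Eventually.of_forall hG0),
            show (2 ^ 6 : ℝ≥0∞) = ENNReal.ofReal (2 ^ 6) by
              rw [ENNReal.ofReal_pow (by norm_num)]; norm_num,
            ← ENNReal.ofReal_mul (by positivity), ← ENNReal.ofReal_mul (by positivity)]
          congr 1; ring
  have hI0 : 0 ≤ ∫ z, G z := integral_nonneg hG0
  have hle := norm_integral_le_lintegral_norm (μ := volume)
    (fun z : Phase => |f0 (V z) - f0 (V' z)|)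
  refine (Real.le_norm_self _).trans (hle.trans (ENNReal.toReal_le_of_le_ofReal (by positivity) ?_))
  refine le_trans (le_of_eq (lintegral_congr fun z => ?_)) hint
  rw [Real.norm_eq_abs, abs_abs, ← Real.norm_eq_abs, ofReal_norm]

end Vlasov

end

noncomputable section

namespace Vlasov

/-! ### The non-relativistic limit -/

lemma invSpeed_nonneg (c : ℝ≥0∞) : 0 ≤ invSpeed c := ENNReal.toReal_nonneg

lemma invSpeed_le_one {c : ℝ≥0∞} (hc : 1 ≤ c) : invSpeed c ≤ 1 := by
  have h : c⁻¹ ≤ 1 := by rwa [ENNReal.inv_le_one]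
  exact ENNReal.toReal_le_of_le_ofReal zero_le_one (by rwa [ENNReal.ofReal_one])

lemma invSpeed_top : invSpeed ∞ = 0 := by simp [invSpeed]

lemma tendsto_invSpeed : Tendsto invSpeed (𝓝 ∞) (𝓝 0) := by
  have h1 : Tendsto (fun c : ℝ≥0∞ => c⁻¹) (𝓝 ∞) (𝓝 0) := by
    have := (continuous_inv (G := ℝ≥0∞)).tendsto ∞
    rwa [ENNReal.inv_top] at this
  have h2 := (ENNReal.tendsto_toReal ENNReal.zero_ne_top).comp h1
  rw [ENNReal.toReal_zero] at h2
  exact h2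

section Comparison

variable {α A R σ : ℝ} {k : R3 → R3}

/-- Flows of nearby fields at nearby speeds of light. -/
lemma IsField.norm_waveFlow_sub_waveFlow_zero_le_bracket {M θ D : ℝ} {E E' : ℝ → R3 → R3}
    (hE : IsField α M E) (hE' : IsField α M E') (hM : M ≤ 1) (hα : 1 < α) (hθ : 0 ≤ θ)
    (hθ1 : θ ≤ 1) (hD : 0 ≤ D)
    (hd : ∀ u x, ‖E u x - E' u x‖ ≤ D * (1 + |u|) ^ (-(α + 1))) (t s : ℝ) (z : Phase) :
    ‖waveFlow θ E t z s - waveFlow 0 E' t z s‖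
      ≤ (2 * D + 6 * M * (1 + 2 * totalDecay α) ^ 3 * θ ^ 2) * totalDecay α
        * Real.exp (10 * totalDecay α) * bracket z.2 ^ 3 := by
  have hM0 := hE.nonneg
  have hτ := totalDecay_nonneg α
  have hb := one_le_bracket z.2
  have hb3 : 1 ≤ bracket z.2 ^ 3 := one_le_pow₀ hb
  refine (hE.norm_waveFlow_sub_waveFlow_zero_le hE' hα hθ hθ1 hD hd t s z).trans ?_
  have e1 : Real.exp (10 * M * totalDecay α) ≤ Real.exp (10 * totalDecay α) := by
    refine Real.exp_le_exp.2 ?_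
    nlinarith
  have e2 : ((1 + 2 * M * totalDecay α) * bracket z.2) ^ 3
      ≤ (1 + 2 * totalDecay α) ^ 3 * bracket z.2 ^ 3 := by
    rw [← mul_pow]
    have : 2 * M * totalDecay α ≤ 2 * totalDecay α := by nlinarith
    gcongr
  calc _ ≤ (2 * D * bracket z.2 ^ 3
        + 6 * M * θ ^ 2 * ((1 + 2 * totalDecay α) ^ 3 * bracket z.2 ^ 3))
        * totalDecay α * Real.exp (10 * totalDecay α) := by
        have e3 : 2 * D ≤ 2 * D * bracket z.2 ^ 3 := le_mul_of_one_le_right (by positivity) hb3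
        exact mul_le_mul (mul_le_mul_of_nonneg_right
          (add_le_add e3 (mul_le_mul_of_nonneg_left e2 (by positivity))) hτ) e1
          (Real.exp_pos _).le (by positivity)
    _ = _ := by ring

/-- Self-consistent fields for different speeds of light are close. -/
lemma exists_norm_selfConsistent_sub_le (hα1 : 1 < α) (hα2 : α < 2) (hσ : 3 < σ)
    (hk : IsKernel α A R k) : ∃ ε : ℝ, 0 < ε ∧ ∃ C : ℝ, 0 < C ∧
    ∀ (θ β η : ℝ) (f0 : Phase → ℝ) (E E' : ℝ → R3 → R3), 0 ≤ θ → θ ≤ 1 → |β| ≤ 1 → η ≤ ε →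
      IsDatum σ η f0 → IsField α 1 E → IsField α 1 E' → newField k β θ f0 E = E →
      newField k β 0 f0 E' = E' → ∀ t x,
      ‖E t x - E' t x‖ ≤ C * η * θ ^ 2 * (1 + |t|) ^ (-(α + 1)) := by
  obtain ⟨C, hC, h⟩ := exists_norm_newField_sub_newField_zero_le hα1 hα2 hσ hk zero_le_one
  have hτ := totalDecay_nonneg α
  set e := Real.exp (10 * totalDecay α) with he
  have he0 : 0 < e := Real.exp_pos _
  set Q1 := 2 * totalDecay α * e with hQ1
  set Q2 := 6 * (1 + 2 * totalDecay α) ^ 3 * totalDecay α * e with hQ2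
  have hQ1' : 0 ≤ Q1 := by positivity
  have hQ2' : 0 ≤ Q2 := by positivity
  refine ⟨1 / (2 * (C * Q1 + 1)), by positivity, 2 * (C * (Q2 + 1)), by positivity,
    fun θ β η f0 E E' hθ hθ1 hβ hηε hf hE hE' hself hself' t x => ?_⟩
  have hη := hf.nonneg_size
  have hsmall : C * Q1 * η ≤ 1 / 2 := by
    rw [le_div_iff₀ (by positivity)] at hηε
    nlinarith [mul_nonneg hC.le hQ1']
  -- A bound d on the relative distance of the fields improves to d/2 + B by self-consistency.
  -- Starting from the trivial bound and iterating leads to the fixed point 2B.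
  set B := C * (Q2 + 1) * η * θ ^ 2 with hB
  have hB0 : 0 ≤ B := by positivity
  have key : ∀ n : ℕ, ∀ t x,
      ‖E t x - E' t x‖ ≤ (2 * (1 / 2) ^ n + 2 * B) * (1 + |t|) ^ (-(α + 1)) := by
    intro n
    induction n with
    | zero =>
      intro t x
      have h1 := hE.bound t x
      have h2 := hE'.bound t x
      have hw : 0 ≤ (1 + |t|) ^ (-(α + 1)) := by positivity
      refine (norm_sub_le _ _).trans ?_
      rw [pow_zero]
      nlinarith [mul_nonneg hB0 hw]
    | succ n ih =>
      intro t x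
      set d := 2 * (1 / 2 : ℝ) ^ n + 2 * B with hd
      have hd0 : 0 ≤ d := by positivity
      have hflow : ∀ z : Phase, ‖waveFlow θ E t z 0 - waveFlow 0 E' t z 0‖
          ≤ (Q1 * d + Q2 * θ ^ 2) * bracket z.2 ^ 3 := fun z =>
        (hE.norm_waveFlow_sub_waveFlow_zero_le_bracket hE' le_rfl hα1 hθ hθ1 hd0 ih t 0
          z).trans_eq (by rw [hQ1, hQ2]; ring)
      have h2 := h θ β η f0 E E' hθ hθ1 hβ hE hE' hf t _ (by positivity) hflow x
      rw [hself, hself'] at h2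
      refine h2.trans ?_
      gcongr
      calc C * η * (Q1 * d + Q2 * θ ^ 2 + θ ^ 2) = C * Q1 * η * d + B := by rw [hB]; ring
        _ ≤ 1 / 2 * d + B := by gcongr
        _ = _ := by rw [hd, pow_succ]; ring
  have hlim : Tendsto (fun n : ℕ => (2 * (1 / 2 : ℝ) ^ n + 2 * B) * (1 + |t|) ^ (-(α + 1))) atTop
      (𝓝 ((2 * 0 + 2 * B) * (1 + |t|) ^ (-(α + 1)))) :=
    (((tendsto_pow_atTop_nhds_zero_of_lt_one (by norm_num : (0 : ℝ) ≤ 1 / 2)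
      (by norm_num)).const_mul 2).add_const _).mul_const _
  refine (ge_of_tendsto' hlim fun n => key n t x).trans_eq ?_
  rw [hB]; ring

end Comparison

/-! ### Scattering data in terms of the self-consistent field -/

section Identification

variable {α A R σ η β M : ℝ} {c : ℝ≥0∞} {k : R3 → R3} {f0 : Phase → ℝ} {f : ℝ → Phase → ℝ}
  {Φ : ℝ → Phase → Phase} {Wp : Phase → Phase} {fp : Phase → ℝ} {E : ℝ → R3 → R3}

lemma IsScattering.congr_kernel {k' : R3 → R3} (h : k =ᵐ[volume] k')
    (hs : IsScattering k β c f0 f Φ Wp fp) : IsScattering k' β c f0 f Φ Wp fp := by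
  have e : (fun t => force k β (f t)) = fun t => force k' β (f t) :=
    funext fun t => force_congr_kernel h β (f t)
  refine ⟨hs.solution.congr_kernel h, ?_, hs.continuous_wave, hs.tendsto_wave, hs.nonneg_state,
    hs.integrable_state, hs.tendsto_state, hs.tendsto_state_L1⟩
  rw [← e]
  exact hs.flow

/-- The data of a scattering solution, expressed through the self-consistent field. -/
lemma IsScattering.eq_of_selfConsistent (hs : IsScattering k β c f0 f Φ Wp fp) (hα1 : 1 < α)
    (hα2 : α < 2) (hσ : 3 < σ) (hk : IsKernel α A R k) (hβ : |β| ≤ 1) (hc : 1 ≤ c)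
    (hf0 : IsDatum σ η f0) (hE : IsField α M E) (hself : newField k β (invSpeed c) f0 E = E) :
    (∀ t, 0 ≤ t → force k β (f t) = E t) ∧
    (∀ t, 0 ≤ t → ∀ z, Φ t z = freeFlow c t (waveFlow (invSpeed c) E 0 z t)) ∧
    (∀ z, Tendsto (fun t => waveFlow (invSpeed c) E 0 z t) atTop (𝓝 (Wp z))) ∧
    ∀ z, Tendsto (fun t => pull (invSpeed c) E f0 t z) atTop (𝓝 (fp z)) := by
  have hα0 : 0 ≤ α := by linarith
  have hθ := invSpeed_nonneg c
  have hθ1 := invSpeed_le_one hc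
  have hf : ∀ t, 0 ≤ t → f t = distr (invSpeed c) E f0 t := fun t ht =>
    hs.solution.eq_distr hα1 hα2 hσ hk hβ hθ hθ1 hf0 hE hself ht
  have hforce : ∀ t, 0 ≤ t → force k β (f t) = E t := fun t ht => by
    rw [hf t ht]
    exact congrFun hself t
  have hΦ : ∀ t, 0 ≤ t → ∀ z, Φ t z = freeFlow c t (waveFlow (invSpeed c) E 0 z t) :=
    fun t ht z => hs.flow.eq_freeFlow_waveFlow hα0 hθ hθ1 hE hforce ht z
  refine ⟨hforce, hΦ, fun z => ?_, fun z => ?_⟩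
  · refine (hs.tendsto_wave z).congr' ?_
    filter_upwards [eventually_ge_atTop 0] with t ht
    rw [waveOp, hΦ t ht, freeFlow_neg_freeFlow]
  · refine (hs.tendsto_state z).congr' ?_
    filter_upwards [eventually_ge_atTop 0] with t ht
    rw [hf t ht, distr_freeFlow]

end Identification

/-! ### Rates of convergence -/

section Convergence

variable {α A R σ : ℝ} {k : R3 → R3}

/-- Limits of the data along the inverse wave operators of two nearby weak fields are close in
`L¹`. -/
lemma IsField.integral_state_sub_le {η M θ δ : ℝ} {E E' : ℝ → R3 → R3} {f0 fp fp' : Phase → ℝ}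
    (hE : IsField α M E) (hE' : IsField α M E') (hα : 1 < α) (hσ : 3 < σ)
    (hθ : 0 ≤ θ) (hθ1 : θ ≤ 1) (hM : M ≤ 1)
    (hM5 : 20 * M * totalDecay α * Real.exp (10 * totalDecay α) ≤ 1) (hf : IsDatum σ η f0)
    (hδ : 0 ≤ δ)
    (hflow : ∀ t (z : Phase),
      ‖waveFlow θ E t z 0 - waveFlow 0 E' t z 0‖ ≤ δ * bracket z.2 ^ 3)
    (hfp : ∀ z, Tendsto (fun t => pull θ E f0 t z) atTop (𝓝 (fp z)))
    (hfp' : ∀ z, Tendsto (fun t => pull 0 E' f0 t z) atTop (𝓝 (fp' z))) :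
    ∫ z, |fp z - fp' z| ≤ 2 ^ 6 * (1 + 2 * totalDecay α) ^ 3 * δ
      * ∫ z : Phase, bracket z.2 ^ 3 * ‖fderiv ℝ f0 z‖ := by
  have hτ := totalDecay_nonneg α
  have hM0 := hE.nonneg
  set τ := totalDecay α with hτdef
  obtain ⟨V, hVc, hV⟩ := hE.exists_inverse_wave hα hθ hθ1
  obtain ⟨V', hVc', hV'⟩ := hE'.exists_inverse_wave hα le_rfl zero_le_one
  have hfpV : fp = fun z => f0 (V z) := funext fun z =>
    tendsto_nhds_unique (hfp z) ((hf.contDiff.continuous.tendsto _).comp (hV z))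
  have hfpV' : fp' = fun z => f0 (V' z) := funext fun z =>
    tendsto_nhds_unique (hfp' z) ((hf.contDiff.continuous.tendsto _).comp (hV' z))
  -- Smallness of the fields makes both inverse wave operators perturbations of the identity with
  -- Lipschitz constant 1/2, as the change of variables requires.
  have hhalf : 10 * M * τ * Real.exp (10 * M * τ) ≤ 1 / 2 := by
    have h1 : Real.exp (10 * M * τ) ≤ Real.exp (10 * τ) := by
      refine Real.exp_le_exp.2 ?_
      nlinarith
    calc _ ≤ 10 * M * τ * Real.exp (10 * τ) :=
          mul_le_mul_of_nonneg_left h1 (by positivity)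
      _ ≤ _ := by linarith
  have hnear : ∀ {θ : ℝ} {E : ℝ → R3 → R3} {V : Phase → Phase}, IsField α M E → 0 ≤ θ → θ ≤ 1 →
      (∀ z, Tendsto (fun t => waveFlow θ E t z 0) atTop (𝓝 (V z))) →
      ∀ z z', ‖(V z - V z') - (z - z')‖ ≤ 1 / 2 * ‖z - z'‖ :=
    fun hE hθ hθ1 hV z z' =>
      le_of_tendsto (((hV z).sub (hV z')).sub_const (z - z')).norm
        (Eventually.of_forall fun t =>
          (hE.norm_waveFlow_sub_sub_le hα hθ hθ1 t 0 z z').trans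
            (mul_le_mul_of_nonneg_right hhalf (norm_nonneg _)))
  have hdisp : ∀ {θ : ℝ} {E : ℝ → R3 → R3} {V : Phase → Phase}, IsField α M E → 0 ≤ θ → θ ≤ 1 →
      (∀ z, Tendsto (fun t => waveFlow θ E t z 0) atTop (𝓝 (V z))) →
      ∀ z, ‖V z - z‖ ≤ 2 * τ := fun hE hθ hθ1 hV z =>
    le_of_tendsto ((hV z).sub_const z).norm (Eventually.of_forall fun t =>
      (hE.norm_waveFlow_sub_le_totalDecay hα hθ hθ1 t 0 z).trans (by
        rw [← hτdef]; nlinarith))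
  rw [hfpV, hfpV']
  exact integral_comp_sub_comp_le hf.contDiff (hf.integrable_grad hσ) hVc hVc'
    (hnear hE hθ hθ1 hV) (hnear hE' le_rfl zero_le_one hV') hδ
    (hdisp hE hθ hθ1 hV) (hdisp hE' le_rfl zero_le_one hV')
    (fun z => le_of_tendsto ((hV z).sub (hV' z)).norm
      (Eventually.of_forall fun t => hflow t z))

/-- Positions separate linearly in time through the differences of the velocities and of the
momenta, while the free-streaming coordinates contribute a bounded part. -/
lemma norm_freeFlow_fst_sub_le {θ P d t b : ℝ} (ht : 0 ≤ t) {q q' : Phase}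
    (hq : ‖q - q'‖ ≤ d * θ ^ 2 * b ^ 3) (hq2 : bracket q.2 ≤ P * b) :
    ‖q.1 + t • vel θ q.2 - (q'.1 + t • q'.2)‖ ≤ (d + (P ^ 3 + d) * t) * θ ^ 2 * b ^ 3 := by
  have hv : ‖vel θ q.2 - q.2‖ ≤ θ ^ 2 * (P * b) ^ 3 :=
    (norm_vel_sub_self_le θ q.2).trans (mul_le_mul_of_nonneg_left
      (pow_le_pow_left₀ (norm_nonneg _) ((norm_le_bracket _).trans hq2) 3) (sq_nonneg θ))
  have eX : q.1 + t • vel θ q.2 - (q'.1 + t • q'.2)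
      = (q.1 - q'.1) + t • ((vel θ q.2 - q.2) + (q.2 - q'.2)) := by module
  rw [eX]
  refine (norm_add_le _ _).trans ?_
  rw [norm_smul, Real.norm_of_nonneg ht]
  have h1 : ‖q.1 - q'.1‖ ≤ d * θ ^ 2 * b ^ 3 := (norm_fst_le (q - q')).trans hq
  have h2 : ‖q.2 - q'.2‖ ≤ d * θ ^ 2 * b ^ 3 := (norm_snd_le (q - q')).trans hq
  calc _ ≤ d * θ ^ 2 * b ^ 3 + t * (θ ^ 2 * (P * b) ^ 3 + d * θ ^ 2 * b ^ 3) :=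
        add_le_add h1 (mul_le_mul_of_nonneg_left
          ((norm_add_le _ _).trans (add_le_add hv h2)) ht)
    _ = _ := by ring

/-- Distance of two scattering solutions, for fixed speed of light and in the limit. -/
lemma exists_scattering_sub_le (hα1 : 1 < α) (hα2 : α < 2) (hσ : 3 < σ) (hσ4 : σ ≤ 4)
    (hk : IsKernel α A R k) : ∃ ε : ℝ, 0 < ε ∧ ∃ C : ℝ, 0 < C ∧
    ∀ (β η : ℝ) (f0 : Phase → ℝ), |β| ≤ 1 → η ≤ ε → IsDatum σ η f0 →
    ∀ (c : ℝ≥0∞), 1 ≤ c → ∀ (f f' : ℝ → Phase → ℝ) (Φ Φ' : ℝ → Phase → Phase)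
      (Wp Wp' : Phase → Phase) (fp fp' : Phase → ℝ),
      IsScattering k β c f0 f Φ Wp fp → IsScattering k β ∞ f0 f' Φ' Wp' fp' →
      (∫ z, |fp z - fp' z|
        ≤ C * invSpeed c ^ 2 * ∫ z : Phase, bracket z.2 ^ 3 * ‖fderiv ℝ f0 z‖) ∧
      (∀ z : Phase, ‖Wp z - Wp' z‖ ≤ C * η * invSpeed c ^ 2 * bracket z.2 ^ 3) ∧
      (∀ t, 0 ≤ t → ∀ z : Phase, ‖waveOp c Φ t z - waveOp ∞ Φ' t z‖
        ≤ C * η * invSpeed c ^ 2 * bracket z.2 ^ 3) ∧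
      (∀ t, 0 ≤ t → ∀ x : R3, ‖force k β (f t) x - force k β (f' t) x‖
        ≤ C * η * invSpeed c ^ 2 * (1 + |t|) ^ (-(α + 1))) ∧
      ∀ t, 0 ≤ t → ∀ z : Phase,
        ‖(Φ t z).1 - (Φ' t z).1‖ ≤ C * invSpeed c ^ 2 * (1 + t) * bracket z.2 ^ 3 ∧
        ‖(Φ t z).2 - (Φ' t z).2‖ ≤ C * η * invSpeed c ^ 2 * bracket z.2 ^ 3 := by
  obtain ⟨ε1, hε1, C1, hC1, hex⟩ := exists_selfConsistent hα1 hα2 hσ hσ4 hk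
  obtain ⟨ε2, hε2, C2, hC2, hcomp⟩ := exists_norm_selfConsistent_sub_le hα1 hα2 hσ hk
  have hτ := totalDecay_nonneg α
  have hα0 : 0 ≤ α := by linarith
  set τ := totalDecay α with hτdef
  set e := Real.exp (10 * τ) with he
  have he0 : 0 < e := Real.exp_pos _
  set C3 := (2 * C2 + 6 * C1 * (1 + 2 * τ) ^ 3) * τ * e with hC3
  have hC3' : 0 ≤ C3 := by positivity
  set C4 := 2 * C3 + (1 + 2 * τ) ^ 3 with hC4
  set C5 := 2 ^ 6 * (1 + 2 * τ) ^ 3 * C3 with hC5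
  refine ⟨min (min ε1 ε2) (min 1 (min (1 / C1) (1 / (C1 * (20 * τ * e + 1))))), by positivity,
    C2 + C3 + C4 + C5, by positivity,
    fun β η f0 hβ hηε hf c hc f f' Φ Φ' Wp Wp' fp fp' hs hs' => ?_⟩
  have hη := hf.nonneg_size
  have hη1 : η ≤ ε1 := hηε.trans ((min_le_left _ _).trans (min_le_left _ _))
  have hη2 : η ≤ ε2 := hηε.trans ((min_le_left _ _).trans (min_le_right _ _))
  have hη3 : η ≤ 1 := hηε.trans ((min_le_right _ _).trans (min_le_left _ _))
  have hη4 : C1 * η ≤ 1 := by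
    have := hηε.trans ((min_le_right _ _).trans ((min_le_right _ _).trans (min_le_left _ _)))
    rwa [le_div_iff₀ hC1, mul_comm] at this
  have hη5 : C1 * η * (20 * τ * e) ≤ 1 := by
    have := hηε.trans ((min_le_right _ _).trans ((min_le_right _ _).trans (min_le_right _ _)))
    rw [le_div_iff₀ (by positivity)] at this
    nlinarith [mul_nonneg hη hC1.le]
  have hθ := invSpeed_nonneg c
  have hθ1 := invSpeed_le_one hc
  set θ := invSpeed c with hθdef
  -- The field belongs to the class of size 1, used to compare the fields, and to the class of size
  -- C1 η, which supplies the factor η in the flow estimates.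
  obtain ⟨E, hE1, hE, -, hself⟩ := hex θ β η f0 hθ hθ1 hβ hη1 hf
  obtain ⟨E', hE1', hE', -, hself'⟩ := hex 0 β η f0 le_rfl zero_le_one hβ hη1 hf
  obtain ⟨hforce, hΦ, hWp, hfp⟩ := hs.eq_of_selfConsistent hα1 hα2 hσ hk hβ hc hf hE hself
  obtain ⟨hforce', hΦ', hWp', hfp'⟩ := hs'.eq_of_selfConsistent hα1 hα2 hσ hk hβ le_top hf hE'
    (by rw [invSpeed_top]; exact hself')
  rw [invSpeed_top] at hΦ' hWp' hfp'
  have hEE' := hcomp θ β η f0 E E' hθ hθ1 hβ hη2 hf hE1 hE1' hself hself'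
  have hflow : ∀ t s (z : Phase), ‖waveFlow θ E t z s - waveFlow 0 E' t z s‖
      ≤ C3 * η * θ ^ 2 * bracket z.2 ^ 3 := fun t s z => by
    refine (hE.norm_waveFlow_sub_waveFlow_zero_le_bracket hE' hη4 hα1 hθ hθ1 (by positivity)
      hEE' t s z).trans_eq ?_
    rw [hC3]; ring
  have hb : ∀ z : Phase, 0 < bracket z.2 ^ 3 := fun z => pow_pos (bracket_pos _) 3
  have hle3 : ∀ z : Phase, C3 * η * θ ^ 2 * bracket z.2 ^ 3
      ≤ (C2 + C3 + C4 + C5) * η * θ ^ 2 * bracket z.2 ^ 3 := fun z => by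
    have := hb z
    have h4 : 0 ≤ C4 := by positivity
    have h5 : 0 ≤ C5 := by positivity
    gcongr
    linarith
  have hI0 : 0 ≤ ∫ z : Phase, bracket z.2 ^ 3 * ‖fderiv ℝ f0 z‖ :=
    integral_nonneg fun z => mul_nonneg (hb z).le (norm_nonneg _)
  refine ⟨?_, fun z => ?_, fun t ht z => ?_, fun t ht x => ?_, fun t ht z => ⟨?_, ?_⟩⟩
  · refine (hE.integral_state_sub_le hE' hα1 hσ hθ hθ1 hη4 (by rw [← hτdef]; linarith) hf
      (by positivity) (fun t z => hflow t 0 z) hfp hfp').trans ?_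
    refine mul_le_mul_of_nonneg_right ?_ hI0
    rw [← hτdef]
    have h4 : 0 ≤ C4 := by positivity
    calc 2 ^ 6 * (1 + 2 * τ) ^ 3 * (C3 * η * θ ^ 2) = C5 * η * θ ^ 2 := by rw [hC5]; ring
      _ ≤ C5 * 1 * θ ^ 2 := by gcongr
      _ ≤ _ := by
        rw [mul_one]
        gcongr
        linarith
  · exact (le_of_tendsto ((hWp z).sub (hWp' z)).norm
      (Eventually.of_forall fun t => hflow 0 t z)).trans (hle3 z)
  · rw [waveOp, waveOp, hΦ t ht, hΦ' t ht, freeFlow_neg_freeFlow, freeFlow_neg_freeFlow]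
    exact (hflow 0 t z).trans (hle3 z)
  · rw [hforce t ht, hforce' t ht]
    refine (hEE' t x).trans ?_
    have h4 : 0 ≤ C4 := by positivity
    have h5 : 0 ≤ C5 := by positivity
    gcongr
    linarith
  · rw [hΦ t ht, hΦ' t ht, freeFlow_eq, freeFlow_eq, invSpeed_top, vel_zero]
    have hP : bracket (waveFlow θ E 0 z t).2 ≤ (1 + 2 * τ) * bracket z.2 := by
      refine bracket_le_mul ((norm_snd_le (waveFlow θ E 0 z t - z)).trans
        ((hE.norm_waveFlow_sub_le_totalDecay hα1 hθ hθ1 0 t z).trans ?_))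
      rw [← hτdef]; nlinarith
    have hC3η : C3 * η * θ ^ 2 * bracket z.2 ^ 3 ≤ C3 * θ ^ 2 * bracket z.2 ^ 3 :=
      mul_le_mul_of_nonneg_right (mul_le_mul_of_nonneg_right
        (mul_le_of_le_one_right hC3' hη3) (sq_nonneg θ)) (hb z).le
    refine (norm_freeFlow_fst_sub_le ht ((hflow 0 t z).trans hC3η) hP).trans
      (mul_le_mul_of_nonneg_right ?_ (hb z).le)
    rw [mul_right_comm _ (θ ^ 2)]
    refine mul_le_mul_of_nonneg_right ?_ (sq_nonneg θ)
    have h5 : 0 ≤ C5 := by positivity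
    have hT : 0 ≤ (1 + 2 * τ) ^ 3 := by positivity
    have p1 : 0 ≤ t * C3 := mul_nonneg ht hC3'
    have p2 : 0 ≤ t * C5 := mul_nonneg ht h5
    have p3 : 0 ≤ t * C2 := mul_nonneg ht hC2.le
    rw [hC4]
    linarith
  · rw [hΦ t ht, hΦ' t ht, freeFlow_eq, freeFlow_eq]
    exact ((norm_snd_le _).trans (hflow 0 t z)).trans (hle3 z)

end Convergence

end Vlasov

end


/-! ### Proof of the theorem -/

theorem theorem3
    (α : ℝ) (hα : α ∈ Ioo (1 : ℝ) 2)
    (β : ℝ) (hβ : β = -1 ∨ β = 0 ∨ β = 1)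
    (w : R3 → ℝ) (gradw : R3 → R3) (hw : IsShortRange α w gradw)
    (σ : ℝ) (hσ : 3 < σ) :
    ∃ ε : ℝ, 0 < ε ∧ ∃ C : ℝ, 0 < C ∧
      ∀ η₀ : ℝ, 0 < η₀ → η₀ ≤ ε →
      ∀ f0 : Phase → ℝ, ContDiff ℝ 1 f0 → (∀ z, 0 ≤ f0 z) →
        dataSize σ f0 ≤ ENNReal.ofReal η₀ →
        -- global solutions are unique, and the scattering objects exist, for all `1 ≤ c ≤ ∞`
        (∀ c : ℝ≥0∞, 1 ≤ c →
          (∀ f g : ℝ → Phase → ℝ, IsSolution gradw β c f0 f → IsSolution gradw β c f0 g →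
            ∀ t, 0 ≤ t → f t = g t) ∧
          ∃ (f : ℝ → Phase → ℝ) (Φ : ℝ → Phase → Phase) (Wp : Phase → Phase) (fp : Phase → ℝ),
            IsScattering gradw β c f0 f Φ Wp fp) ∧
        -- the norm on the right of the main estimate is finite
        Integrable (fun z : Phase => bracket z.2 ^ 3 * ‖fderiv ℝ f0 z‖) ∧
        -- the non-relativistic limit
        ∀ (f : ℝ≥0∞ → ℝ → Phase → ℝ) (Φ : ℝ≥0∞ → ℝ → Phase → Phase)
          (Wp : ℝ≥0∞ → Phase → Phase) (fp : ℝ≥0∞ → Phase → ℝ),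
          (∀ c : ℝ≥0∞, 1 ≤ c → IsScattering gradw β c f0 (f c) (Φ c) (Wp c) (fp c)) →
          Tendsto (fun c : ℝ≥0∞ => ∫ z, |fp c z - fp ∞ z|) (𝓝 ∞) (𝓝 0) ∧
          ∀ c : ℝ≥0∞, 1 ≤ c →
            -- scattering states
            (∫ z, |fp c z - fp ∞ z|
              ≤ C * invSpeed c ^ 2 * ∫ z : Phase, bracket z.2 ^ 3 * ‖fderiv ℝ f0 z‖) ∧
            -- limiting wave operators
            (∀ z : Phase, (bracket z.2 ^ 3)⁻¹ * ‖Wp c z - Wp ∞ z‖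
              ≤ C * η₀ * invSpeed c ^ 2) ∧
            -- finite-time wave operators
            (∀ t, 0 ≤ t → ∀ z : Phase,
              (bracket z.2 ^ 3)⁻¹ * ‖waveOp c (Φ c) t z - waveOp ∞ (Φ ∞) t z‖
                ≤ C * η₀ * invSpeed c ^ 2) ∧
            -- force fields
            (∀ t, 0 ≤ t → ∀ x : R3,
              ‖force gradw β (f c t) x - force gradw β (f ∞ t) x‖
                ≤ C * η₀ * invSpeed c ^ 2 * bracket t ^ (-(α + 1))) ∧
            -- characteristic flows
            (∀ t, 0 ≤ t → ∀ z : Phase,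
              (bracket z.2 ^ 3)⁻¹ * ‖(Φ c t z).1 - (Φ ∞ t z).1‖
                ≤ C * invSpeed c ^ 2 * (1 + t) ∧
              (bracket z.2 ^ 3)⁻¹ * ‖(Φ c t z).2 - (Φ ∞ t z).2‖
                ≤ C * η₀ * invSpeed c ^ 2) := by
  obtain ⟨hα1, hα2⟩ := hα
  have hβ1 : |β| ≤ 1 := by rcases hβ with rfl | rfl | rfl <;> simp
  obtain ⟨k, A, R, hk, hae⟩ := hw.exists_isKernel hα1 hα2
  -- Lowering σ to at most 4 weakens the hypothesis on the datum and keeps σ > 3; joint continuity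
  -- of the field uses σ ≤ 4.
  have hσ' : 3 < min σ 4 := lt_min hσ (by norm_num)
  have hσ4 : min σ 4 ≤ 4 := min_le_right _ _
  obtain ⟨ε1, hε1, C1, hC1, hex⟩ := exists_selfConsistent hα1 hα2 hσ' hσ4 hk
  obtain ⟨ε2, hε2, C, hC, hcomp⟩ := exists_scattering_sub_le hα1 hα2 hσ' hσ4 hk
  refine ⟨min ε1 ε2, by positivity, C, hC, fun η₀ hη₀ hηε f0 hf0 hf0' hsize => ?_⟩
  have hf : IsDatum (min σ 4) η₀ f0 :=
    (isDatum_of_dataSize_le hη₀.le hf0 hf0' hsize).mono_left (min_le_left _ _)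
  have hη1 : η₀ ≤ ε1 := hηε.trans (min_le_left _ _)
  have hη2 : η₀ ≤ ε2 := hηε.trans (min_le_right _ _)
  refine ⟨fun c hc => ?_, hf.integrable_grad hσ', fun f Φ Wp fp hs => ?_⟩
  · have hθ := invSpeed_nonneg c
    have hθ1 := invSpeed_le_one hc
    obtain ⟨E, hE, -, hE1, hself⟩ := hex (invSpeed c) β η₀ f0 hθ hθ1 hβ1 hη1 hf
    refine ⟨fun f g hf' hg' t ht => ?_, ?_⟩
    · rw [(hf'.congr_kernel hae).eq_distr hα1 hα2 hσ' hk hβ1 hθ hθ1 hf hE hself ht,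
        (hg'.congr_kernel hae).eq_distr hα1 hα2 hσ' hk hβ1 hθ hθ1 hf hE hself ht]
    · obtain ⟨Φ, Wp, fp, h⟩ :=
        exists_isScattering hα1 hα2 hσ' hk hβ1 hθ hθ1 hE hE1 hf hself
      exact ⟨_, Φ, Wp, fp, h.congr_kernel hae.symm⟩
  · have hmain := fun c hc => hcomp β η₀ f0 hβ1 hη2 hf c hc _ _ _ _ _ _ _ _
      ((hs c hc).congr_kernel hae) ((hs ∞ le_top).congr_kernel hae)
    have hdiv : ∀ (z : Phase) (a b : ℝ), a ≤ b * bracket z.2 ^ 3 →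
        (bracket z.2 ^ 3)⁻¹ * a ≤ b := fun z a b h => by
      rwa [inv_mul_le_iff₀ (pow_pos (bracket_pos _) 3), mul_comm]
    refine ⟨?_, fun c hc => ?_⟩
    · have hlim : Tendsto (fun c : ℝ≥0∞ => C * invSpeed c ^ 2
          * ∫ z : Phase, bracket z.2 ^ 3 * ‖fderiv ℝ f0 z‖) (𝓝 ∞) (𝓝 0) := by
        have := ((tendsto_invSpeed.pow 2).const_mul C).mul_const
          (∫ z : Phase, bracket z.2 ^ 3 * ‖fderiv ℝ f0 z‖)
        simpa using this
      refine tendsto_of_tendsto_of_tendsto_of_le_of_le' tendsto_const_nhds hlim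
        (Eventually.of_forall fun c => integral_nonneg fun z => abs_nonneg _) ?_
      filter_upwards [eventually_ge_nhds (ENNReal.one_lt_top)] with c hc
      exact (hmain c hc).1
    · obtain ⟨h1, h2, h3, h4, h5⟩ := hmain c hc
      refine ⟨h1, fun z => hdiv z _ _ (h2 z), fun t ht z => hdiv z _ _ (h3 t ht z),
        fun t ht x => ?_, fun t ht z => ⟨hdiv z _ _ (h5 t ht z).1, hdiv z _ _ (h5 t ht z).2⟩⟩
      rw [force_congr_kernel hae, force_congr_kernel hae]
      -- The rate in 1+|t| is the stronger one, since ⟨t⟩ ≤ 1+|t| and the exponent is negative.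
      refine (h4 t ht x).trans (mul_le_mul_of_nonneg_left ?_ (by positivity))
      refine Real.rpow_le_rpow_of_nonpos (bracket_pos t) ?_ (by linarith)
      exact (bracket_le_one_add_norm t).trans_eq (by rw [Real.norm_eq_abs])
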